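/- Let $N\ge 1$ be an integer, $(X,\mathsf d)$ a non-empty complete separable metric space, $\mathscr H^N$ its $N$-dimensional Hausdorff measure (normalised to be Lebesgue measure on $\mathbb R^N$) and $\omega_N$ the volume of the unit ball of $\mathbb R^N$. **Regular points and (ETR).** For $p\in X$ and $\varepsilon,r>0$, a *regular chart of accuracy $\varepsilon$ on $B_r(p)$* is a homeomorphism $u:B_r(p)\to u(B_r(p))\subset\mathbb R^N$ with $|u(x)-u(y)|\le(1+\varepsilon)\,\mathsf d(x,y)$ on $B_r(p)$, $u(B_r(p))\supset B^{\mathbb R^N}_{(1-2\varepsilon)r}(0)$, $(1-\varepsilon)\omega_Nr^N\le\mathscr H^N(B_r(p))\le(1+\varepsilon)\omega_Nr^N$, such that there are countably many pairwise disjoint Borel sets $U_i\subset B_r(p)$ which cover $B_r(p)$ up to an $\mathscr H^N$-null set and on each of which $u$ is biLipschitz onto its image. The point $p$ is *regular* if for every $\varepsilon>0$ there is $r>0$ such that $B_r(p)$ carries a regular chart of accuracy $\varepsilon$. $(X,\mathsf d,\mathscr H^N)$ satisfies (ETR) with regular set $\mathcal R\subset X$ if all metric balls of $X$ are connected, $\mathscr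 H^N(X\setminus\mathcal R)=0$, and every $p\in\mathcal R$ is regular. The set $\mathcal R$ is *a.e.-connected* if for every $p\in\mathcal R$ and $\mathscr H^N$-a.e. $q\in\mathcal R$ there is a continuous curve in $\mathcal R$ from $p$ to $q$. **Weights.** Let $T$ be a locally integral $N$-current in $X$ in the sense of Lang and Wenger, with mass measure $\|T\|$, and let $\mathrm{set}(T)=\{x:\liminf_{r\to0}\|T\|(B_r(x))/(\omega_Nr^N)>0\}$. An *atlas* for $\mathrm{set}(T)$ is a countable family of biLipschitz maps $f_i:K_i\to f_i(K_i)\subset X$, $K_i\subset\mathbb R^N$ compact, with pairwise disjoint images that cover $\mathrm{set}(T)$ up to an $\mathscr H^N$-null set. The *weight* of $T$ with respect to the atlas is the Borel function $\theta_T=\sum_i\theta_i\circ f_i^{-1}$, where $\theta_i\in L^1(\mathbb R^N)$ vanishes off $K_i$ and $(f_i^{-1})_\sharp(T\llcorner f_i(K_i))=[[\theta_i]]$, with $[[\theta]](f,\pi)=\int_{\mathbb R^N}\theta f\det(D\pi)\,d\mathscr L^N$. An atlas determines $\theta_T$ up to $\mathscr H^N$-null sets, and a change of atlas can change the sign of $\theta_T$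 on sets of positive measure. An atlas is *oriented at* $p\in\mathcal R$ if there are $\varepsilon\in(0,1/5)$, $0<s\le r$ and a regular chart $u$ of accuracy $\varepsilon$ on $B_r(p)$ such that for every $i$, $\det D(u\circ f_i)(a)>0$ for a.e. $a\in K_i$ with $f_i(a)\in B_s(p)$ (for instance, if near $p$ the $f_i$ are restrictions of $u^{-1}$). **Proposition.** Let $(X,\mathsf d,\mathscr H^N)$ satisfy (ETR) with regular set $\mathcal R$, and let $T$ be a locally integral $N$-current in $X$ with $\|T\|=\mathscr H^N$ and $\partial T=0$. There is an atlas for $\mathrm{set}(T)$ that is oriented at every point of $\mathcal R$. For every atlas for $\mathrm{set}(T)$ the weight $\theta_T$ exists and $\theta_T\in\{1,-1\}$ $\mathscr H^N$-a.e. on $X$; moreover: 1. For every $p\in\mathcal R$ at which the atlas is oriented there exist $r>0$ and $\sigma\in\{1,-1\}$ such that $\theta_T=\sigma$ $\mathscr H^N$-a.e. on $B_r(p)$. 2. If $\mathcal R$ is a.e.-connected and the atlas is oriented at every point of $\mathcal R$, then there exists $\sigma\in\{1,-1\}$ such that $\theta_T=\sigma$ $\mathscr H^N$-a.e. on $X$.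 -/

import Mathlib

open MeasureTheory Metric Set Filter Topology Bornology
open scoped NNReal ENNReal

namespace MetricCurrents

/-! ## Lipschitz test functions -/

/-- `Lip_bs(X)`: the real Lipschitz functions on `X` with bounded support. -/
def LipBs (X : Type*) [MetricSpace X] : Submodule ℝ (X → ℝ) where
  carrier := {f | (∃ C : ℝ≥0, LipschitzWith C f) ∧ IsBounded (Function.support f)}
  zero_mem' := ⟨⟨0, LipschitzWith.const 0⟩, by simp⟩
  add_mem' := by
    rintro f g ⟨⟨C, hC⟩, hf⟩ ⟨⟨D, hD⟩, hg⟩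
    exact ⟨⟨C + D, hC.add hD⟩, (hf.union hg).subset (Function.support_add f g)⟩
  smul_mem' := by
    rintro c f ⟨⟨C, hC⟩, hf⟩
    exact ⟨⟨‖c‖₊ * C, (lipschitzWith_smul c).comp hC⟩,
      hf.subset (Function.support_const_smul_subset c f)⟩

/-- `Lip_loc(X)`: the real functions on `X` that are Lipschitz on every bounded set. -/
def LipLoc (X : Type*) [MetricSpace X] : Submodule ℝ (X → ℝ) where
  carrier := {f | ∀ A : Set X, IsBounded A → ∃ C : ℝ≥0, LipschitzOnWith C f A}
  zero_mem' := fun _ _ => ⟨0, (LipschitzWith.const (0 : ℝ)).lipschitzOnWith⟩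
  add_mem' := by
    intro f g hf hg A hA
    obtain ⟨C, hC⟩ := hf A hA
    obtain ⟨D, hD⟩ := hg A hA
    exact ⟨C + D, hC.add hD⟩
  smul_mem' := by
    intro c f hf A hA
    obtain ⟨C, hC⟩ := hf A hA
    exact ⟨‖c‖₊ * C, (lipschitzWith_smul c).comp_lipschitzOnWith hC⟩

theorem LipBs.mem_lipLoc {X : Type*} [MetricSpace X] (f : LipBs X) : (f : X → ℝ) ∈ LipLoc X :=
  fun _ _ => f.2.1.imp fun _ hC => hC.lipschitzOnWith

/-- The inclusion `Lip_bs(X) ⊆ Lip_loc(X)`. -/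
def LipBs.toLipLoc {X : Type*} [MetricSpace X] (f : LipBs X) : LipLoc X :=
  ⟨f, LipBs.mem_lipLoc f⟩

theorem LipLoc.comp_mem {X Y : Type*} [MetricSpace X] [MetricSpace Y] (π : LipLoc Y)
    {Ψ : X → Y} (hΨ : ∃ C : ℝ≥0, LipschitzWith C Ψ) : (π : Y → ℝ) ∘ Ψ ∈ LipLoc X := by
  intro A hA
  obtain ⟨C, hC⟩ := hΨ
  obtain ⟨D, hD⟩ := π.2 (Ψ '' A) (hC.isBounded_image hA)
  exact ⟨D * C, hD.comp hC.lipschitzOnWith (mapsTo_image Ψ A)⟩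

/-- The composition `π ∘ Ψ ∈ Lip_loc(X)` of `π ∈ Lip_loc(Y)` and a Lipschitz map `Ψ : X → Y`. -/
def LipLoc.comp {X Y : Type*} [MetricSpace X] [MetricSpace Y] (π : LipLoc Y)
    (Ψ : X → Y) (hΨ : ∃ C : ℝ≥0, LipschitzWith C Ψ) : LipLoc X :=
  ⟨(π : Y → ℝ) ∘ Ψ, LipLoc.comp_mem π hΨ⟩

/-! ## Metric currents with locally finite mass -/

/-- Multilinear functionals `T : Lip_bs(X) × Lip_loc(X)^n → ℝ`, written `T f π`. -/
abbrev Functional (X : Type*) [MetricSpace X] (n : ℕ) : Type _ :=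
  LipBs X →ₗ[ℝ] MultilinearMap ℝ (fun _ : Fin n => LipLoc X) ℝ

/-- `T` is an `n`-dimensional metric functional: it is continuous in the entries `π` (pointwise
convergence with Lipschitz constants controlled on bounded sets) and local. -/
structure IsMetricFunctional {X : Type*} [MetricSpace X] {n : ℕ} (T : Functional X n) : Prop where
  continuous : ∀ (f : LipBs X) (π : ℕ → Fin n → LipLoc X) (π' : Fin n → LipLoc X),
    (∀ j x, Tendsto (fun k => (π k j : X → ℝ) x) atTop (𝓝 ((π' j : X → ℝ) x))) →
    (∀ A : Set X, IsBounded A → ∃ C : ℝ≥0, ∀ k j, LipschitzOnWith C (π k j : X → ℝ) A) →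
    Tendsto (fun k => T f (π k)) atTop (𝓝 (T f π'))
  isLocal : ∀ (f : LipBs X) (π : Fin n → LipLoc X),
    (∃ j, ∃ U ∈ 𝓝ˢ (Function.support (f : X → ℝ)), ∃ c : ℝ, ∀ x ∈ U, (π j : X → ℝ) x = c) →
    T f π = 0

/-- The mass `M_V(T) ∈ [0, ∞]` of `T` in an open set `V`: the supremum of `∑ T(f_l, π_l)` over the
finite families with `π_l` made of `1`-Lipschitz functions, `spt f_l ⊆ V` and `∑ |f_l| ≤ 1`. -/
noncomputable def massOn {X : Type*} [MetricSpace X] {n : ℕ} (T : Functional X n) (V : Set X) :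
    ℝ≥0∞ :=
  ⨆ (m : ℕ) (f : Fin m → LipBs X) (π : Fin m → Fin n → LipLoc X)
    (_ : ∀ l j, LipschitzWith 1 (π l j : X → ℝ))
    (_ : ∀ l, tsupport (f l : X → ℝ) ⊆ V)
    (_ : ∀ x, ∑ l, |(f l : X → ℝ) x| ≤ 1),
    ENNReal.ofReal (∑ l, T (f l) (π l))

/-- `‖T‖(A) = inf {M_V(T) : V ⊇ A open}`. -/
noncomputable def mass {X : Type*} [MetricSpace X] {n : ℕ} (T : Functional X n) (A : Set X) :
    ℝ≥0∞ :=
  ⨅ (V : Set X) (_ : IsOpen V) (_ : A ⊆ V), massOn T V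

/-- The measure `μ` is the mass measure `‖T‖`, i.e. `μ = ‖T‖` on Borel sets. -/
def IsMassMeasure {X : Type*} [MetricSpace X] [MeasurableSpace X] {n : ℕ} (T : Functional X n)
    (μ : Measure X) : Prop :=
  ∀ A : Set X, MeasurableSet A → mass T A = μ A

/-- `T ∈ M_{loc,n}(X)`: `T` is a metric current with locally finite mass. -/
structure IsLocFiniteMassCurrent {X : Type*} [MetricSpace X] {n : ℕ} (T : Functional X n) :
    Prop where
  isMetricFunctional : IsMetricFunctional T
  tight : ∀ V : Set X, IsOpen V → IsBounded V → ∀ ε : ℝ≥0∞, 0 < ε →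
    ∃ C ⊆ V, IsCompact C ∧ massOn T V < ⊤ ∧ massOn T (V \ C) < ε

/-- `S = ∂T`, that is `S(f, π) = T(σ, f, π)` for every `σ ∈ Lip_bs(X)` with `σ = 1` on `spt f`. -/
def HasBoundary {X : Type*} [MetricSpace X] {n : ℕ} (T : Functional X (n + 1))
    (S : Functional X n) : Prop :=
  ∀ (f : LipBs X) (π : Fin n → LipLoc X) (σ : LipBs X),
    (∀ x ∈ tsupport (f : X → ℝ), (σ : X → ℝ) x = 1) →
    S f π = T σ (Fin.cons (α := fun _ => LipLoc X) (LipBs.toLipLoc f) π)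

/-- `T(g, π) = v` for the extension of `T` to bounded Borel functions `g` with bounded support: `v`
is the limit of `T(f_k, π)` along functions `f_k ∈ Lip_bs(X)` with uniformly bounded supports that
converge to `g` in `L¹(‖T‖)`. (For a current with locally finite mass such sequences exist, and the
limit does not depend on the sequence.) -/
def HasBorelValue {X : Type*} [MetricSpace X] [MeasurableSpace X] {n : ℕ} (T : Functional X n)
    (g : X → ℝ) (π : Fin n → LipLoc X) (v : ℝ) : Prop :=
  ∃ μ : Measure X, IsMassMeasure T μ ∧
    ∃ (f : ℕ → LipBs X) (A : Set X), IsBounded A ∧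
      (∀ k, Function.support (f k : X → ℝ) ⊆ A) ∧
      Tendsto (fun k => ∫⁻ x, ‖(f k : X → ℝ) x - g x‖ₑ ∂μ) atTop (𝓝 0) ∧
      Tendsto (fun k => T (f k) π) atTop (𝓝 v)

/-- The Euclidean space `ℝ^n`. -/
abbrev E (n : ℕ) : Type := EuclideanSpace ℝ (Fin n)

/-- The Euclidean current `[[θ]](f, π) = ∫ θ f det(Dπ) dL^n`. -/
noncomputable def euclideanCurrent {n : ℕ} (θ : E n → ℝ) (f : E n → ℝ) (π : Fin n → E n → ℝ) : ℝ :=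
  ∫ x, θ x * f x *
    (Matrix.of fun i j : Fin n => fderiv ℝ (π i) x (EuclideanSpace.single j 1)).det

/-- `Ψ_♯(T ⌞ B) = [[θ]]`, where `B` is a bounded Borel set and `Ψ : X → ℝ^n` is Lipschitz: for all
`(f, π)`, `T(1_B (f ∘ Ψ), π ∘ Ψ) = [[θ]](f, π)`. -/
def PushforwardRestrictEq {X : Type*} [MetricSpace X] [MeasurableSpace X] {n : ℕ}
    (T : Functional X n) (B : Set X) (Ψ : X → E n) (θ : E n → ℝ) : Prop :=
  ∃ hΨ : ∃ C : ℝ≥0, LipschitzWith C Ψ,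
    ∀ (f : LipBs (E n)) (π : Fin n → LipLoc (E n)),
      HasBorelValue T (B.indicator ((f : E n → ℝ) ∘ Ψ)) (fun j => LipLoc.comp (π j) Ψ hΨ)
        (euclideanCurrent θ f (fun j => π j))

/-- `T` is locally integer rectifiable. -/
structure IsLocIntegerRectifiable {X : Type*} [MetricSpace X] [MeasurableSpace X] {n : ℕ}
    (T : Functional X n) : Prop where
  isCurrent : IsLocFiniteMassCurrent T
  pushforward : ∀ B : Set X, MeasurableSet B → IsBounded B →
    ∀ Ψ : X → E n, (∃ C : ℝ≥0, LipschitzWith C Ψ) →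
      ∃ θ : E n → ℤ, Integrable (fun x => (θ x : ℝ)) ∧
        PushforwardRestrictEq T B Ψ (fun x => (θ x : ℝ))

/-- `T ∈ I_{loc,n+1}(X)`: `T` is a locally integral current of dimension `n + 1 ≥ 1`, i.e. `T` and
`∂T` are locally integer rectifiable. -/
def IsLocallyIntegral {X : Type*} [MetricSpace X] [MeasurableSpace X] {n : ℕ}
    (T : Functional X (n + 1)) : Prop :=
  IsLocIntegerRectifiable T ∧ ∃ S : Functional X n, HasBoundary T S ∧ IsLocIntegerRectifiable S

/-- The volume `ω_N` of the unit ball of `ℝ^N`. -/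
noncomputable def unitBallVolume (N : ℕ) : ℝ := (volume (ball (0 : E N) 1)).toReal

/-- `set(T)`, the set of points of positive lower `N`-density of `‖T‖`. -/
def currentSet {X : Type*} [MetricSpace X] {N : ℕ} (T : Functional X N) : Set X :=
  {x | 0 < liminf (fun r : ℝ => mass T (ball x r) / ENNReal.ofReal (unitBallVolume N * r ^ N))
    (𝓝[>] 0)}

/-! ## Charts, atlases and weights -/

/-- `f` is biLipschitz from `s` onto its image. -/
def BiLipschitzOn {Y Z : Type*} [MetricSpace Y] [MetricSpace Z] (f : Y → Z) (s : Set Y) : Prop :=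
  ∃ C : ℝ, ∀ x ∈ s, ∀ y ∈ s, dist (f x) (f y) ≤ C * dist x y ∧ dist x y ≤ C * dist (f x) (f y)

/-- A countable family of maps `f i : K i → X` with `K i ⊆ ℝ^N` (the values of `f i` outside `K i`
play no role). -/
structure ChartFamily (X : Type*) (N : ℕ) where
  K : ℕ → Set (E N)
  f : ℕ → E N → X

/-- The family `A` is an atlas for `set(T)`. -/
structure IsAtlas {X : Type*} [MetricSpace X] [MeasurableSpace X] [BorelSpace X] {N : ℕ}
    (T : Functional X N) (A : ChartFamily X N) : Prop where
  isCompact : ∀ i, IsCompact (A.K i)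
  biLipschitz : ∀ i, BiLipschitzOn (A.f i) (A.K i)
  disjoint : Pairwise fun i j => Disjoint (A.f i '' A.K i) (A.f j '' A.K j)
  cover : μHE[N] (currentSet T \ ⋃ i, A.f i '' A.K i) = 0

/-- `θ` is the weight function `θ_T` of `T` with respect to the atlas `A`, i.e.
`θ_T = ∑ θ_i ∘ f_i⁻¹` where `θ_i ∈ L¹(ℝ^N)` vanishes off `K_i` and is determined by
`(f_i⁻¹)_♯ (T ⌞ f_i(K_i)) = [[θ_i]]`. Here `Ψ` is a Lipschitz extension of `f_i⁻¹` to `X`; by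
locality of `T` the condition does not depend on which one is taken. -/
def IsWeight {X : Type*} [MetricSpace X] [MeasurableSpace X] {N : ℕ}
    (T : Functional X N) (A : ChartFamily X N) (θ : X → ℝ) : Prop :=
  Measurable θ ∧ ∀ i, Integrable ((A.K i).indicator (θ ∘ A.f i)) ∧
    ∃ Ψ : X → E N, (∃ C : ℝ≥0, LipschitzWith C Ψ) ∧ (∀ a ∈ A.K i, Ψ (A.f i a) = a) ∧
      PushforwardRestrictEq T (A.f i '' A.K i) Ψ ((A.K i).indicator (θ ∘ A.f i))

/-! ## Essential topological regularity -/

/-- `u : B_r(p) → ℝ^N` is a chart as required, at scale `r` and with accuracy `ε`, in the definition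
of a regular point (only the values of `u` on `B_r(p)` play a role). -/
structure IsRegularChart {X : Type*} [MetricSpace X] [MeasurableSpace X] [BorelSpace X] (N : ℕ)
    (p : X) (ε r : ℝ) (u : X → E N) : Prop where
  isEmbedding : IsEmbedding ((ball p r).domRestrict u)
  lipschitz : ∀ x ∈ ball p r, ∀ y ∈ ball p r, dist (u x) (u y) ≤ (1 + ε) * dist x y
  image : ball (0 : E N) ((1 - 2 * ε) * r) ⊆ u '' ball p r
  volume_ge : ENNReal.ofReal ((1 - ε) * unitBallVolume N * r ^ N) ≤ μHE[N] (ball p r)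
  volume_le : μHE[N] (ball p r) ≤ ENNReal.ofReal ((1 + ε) * unitBallVolume N * r ^ N)
  pieces : ∃ U : ℕ → Set X, (∀ i, MeasurableSet (U i)) ∧
    (Pairwise fun i j => Disjoint (U i) (U j)) ∧ (∀ i, U i ⊆ ball p r) ∧
    μHE[N] (ball p r \ ⋃ i, U i) = 0 ∧ ∀ i, BiLipschitzOn u (U i)

/-- `p` is a regular point. -/
def IsRegularPoint {X : Type*} [MetricSpace X] [MeasurableSpace X] [BorelSpace X] (N : ℕ)
    (p : X) : Prop :=
  ∀ ε : ℝ, 0 < ε → ∃ r : ℝ, 0 < r ∧ ∃ u : X → E N, IsRegularChart N p ε r u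

/-- `(X, d, H^N)` satisfies (ETR) with regular set `R`. -/
structure IsETR {X : Type*} [MetricSpace X] [MeasurableSpace X] [BorelSpace X] (N : ℕ)
    (R : Set X) : Prop where
  ball_connected : ∀ (p : X) (r : ℝ), 0 < r → IsConnected (ball p r)
  null : μHE[N] Rᶜ = 0
  regular : ∀ p ∈ R, IsRegularPoint N p

/-- The set `R` is a.e.-connected: each `p ∈ R` is joined to a.e. `q ∈ R` by a continuous curve that
stays in `R`. -/
def IsAEConnected {X : Type*} [MetricSpace X] [MeasurableSpace X] [BorelSpace X] (N : ℕ)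
    (R : Set X) : Prop :=
  ∀ p ∈ R, ∀ᵐ q ∂(μHE[N] : Measure X), q ∈ R → JoinedIn R p q

/-- The family `A` is oriented at `p`: near `p` all the `f i` induce the orientation of one
chart `u` of the kind used to define regular points, i.e. `det D(u ∘ f i) > 0` a.e. on the part of
`K i` that `f i` maps near `p`. This holds in particular if, near `p`, the `f i` are restrictions of
`u⁻¹`. -/
def IsOrientedAt {X : Type*} [MetricSpace X] [MeasurableSpace X] [BorelSpace X] {N : ℕ}
    (A : ChartFamily X N) (p : X) : Prop :=
  ∃ (ε r s : ℝ) (u : X → E N), 0 < ε ∧ ε < 1 / 5 ∧ 0 < s ∧ s ≤ r ∧ IsRegularChart N p ε r u ∧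
    ∀ i, ∀ᵐ a : E N, a ∈ A.K i → A.f i a ∈ ball p s →
      0 < (fderivWithin ℝ (u ∘ A.f i) (A.K i) a).det

end MetricCurrents

set_option linter.unusedSectionVars false

namespace MetricCurrents

/-! ## Mass inequality, locality and extension to Borel functions -/

section Basics

variable {X : Type*} [MetricSpace X]

/-! In a regular chart `Ψ` the cycle `T` is a constant multiple of Lebesgue integration. The
push-forward under `Ψ` of `T` restricted to `B_r(p)` is `[[θ]]` with `θ` integer valued, and `∂T =
0` makes the distributional gradient of `θ` vanish on the model ball, so `θ` is there a constant
integer `c`, the degree (`exists_hasDegree`). The mass pins `c` down. Testing `T` with the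
coordinates of `Ψ`, which are `(1 + ε)`-Lipschitz, and using the upper volume bound gives `|c| < 2`
once `ε` is small (`HasDegree.abs_mul_le`). If `c` were `0`, then `T` would vanish on the compact
pieces on which `Ψ` is biLipschitz, hence `‖T‖ = H^N` would vanish on the chart domain, an open set
of positive measure (`HasDegree.ne_zero`). So `c = ±1`, and a reflection of the chart arranges `c =
1`.

Weight and degree are compared by evaluating `T` in two ways on a compact piece of an atlas chart
`f` (`HasDegree.ae_weight_mul_det`). With the transition map `G = Ψ ∘ f`, the degree yields `c ∫
|det DG|` by the area formula and the weight yields `∫ θ det DG`. Hence `θ det DG = c |det DG|`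
a.e., and `det DG ≠ 0` a.e. (`IsGlobalChart.ae_det_ne_zero`), so `θ` is `c` times the sign of `det
DG`. This gives `θ = ±1`, and `θ = c` near a point at which the atlas is oriented by `Ψ`.

An oriented atlas is built from inverses of degree-one charts. Its weight is `1`, so the same
identity, read in a degree-one chart at any regular point, forces `det DG > 0`. For the global
statement, the set of points near which `θ = σ` a.e. is open, and on the regular set the sets for
`σ` and `-σ` are disjoint and cover, so the sign is carried along curves in the regular set.

The analytic input is the mass inequality (`IsCurrentWithMass.abs_apply_le`) together with the
strengthened locality of the extension of `T` to `L¹(‖T‖)` (`IsCurrentWithMass.limVal_congr`). The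
latter permits replacing `Ψ` by `G ∘ Φ`, with `Φ` a Lipschitz extension of `f⁻¹`, on a compact part
of the image of `f`. -/

theorem LipBs.continuous (f : LipBs X) : Continuous (f : X → ℝ) :=
  f.2.1.choose_spec.continuous

theorem LipBs.exists_bound (f : LipBs X) : ∃ M : ℝ, 0 ≤ M ∧ ∀ x, |(f : X → ℝ) x| ≤ M := by
  obtain ⟨⟨C, hC⟩, hb⟩ := f.2
  have h := (hC.isBounded_image hb)
  obtain ⟨M, hM⟩ := h.exists_norm_le
  refine ⟨max M 0, le_max_right _ _, fun x => ?_⟩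
  by_cases hx : x ∈ Function.support (f : X → ℝ)
  · exact (hM _ (mem_image_of_mem _ hx)).trans (le_max_left _ _)
  · rw [Function.notMem_support.1 hx]; simp

theorem LipBs.isBounded_tsupport (f : LipBs X) : IsBounded (tsupport (f : X → ℝ)) :=
  f.2.2.closure

/-- Post-composition of a compactly supported Lipschitz function with a Lipschitz function that
vanishes at zero. -/
theorem LipBs.comp_mem (f : LipBs X) {φ : ℝ → ℝ} {D : ℝ≥0} (hφ : LipschitzWith D φ) (h0 : φ 0 = 0) :
    (fun x => φ ((f : X → ℝ) x)) ∈ LipBs X := by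
  obtain ⟨⟨C, hC⟩, hb⟩ := f.2
  refine ⟨⟨D * C, hφ.comp hC⟩, hb.subset fun x hx => ?_⟩
  rw [Function.mem_support] at hx ⊢
  exact fun h => hx (by rw [h, h0])

theorem mul_mem_lipBs (f : LipBs X) {g : X → ℝ} {D : ℝ≥0} (hg : LipschitzWith D g) {B : ℝ}
    (hB : ∀ x, |g x| ≤ B) : (fun x => (f : X → ℝ) x * g x) ∈ LipBs X := by
  obtain ⟨M, hM0, hM⟩ := LipBs.exists_bound f
  obtain ⟨⟨C, hC⟩, hb⟩ := f.2
  refine ⟨⟨(C * |B| + M * D).toNNReal, LipschitzWith.of_dist_le_mul fun x y => ?_⟩,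
    hb.subset fun x hx => ?_⟩
  · have h1 := hC.dist_le_mul x y
    have h2 := hg.dist_le_mul x y
    rw [Real.dist_eq] at h1 h2 ⊢
    rw [Real.coe_toNNReal _ (by positivity)]
    have e : (f : X → ℝ) x * g x - (f : X → ℝ) y * g y
      = ((f : X → ℝ) x - (f : X → ℝ) y) * g x + (f : X → ℝ) y * (g x - g y) := by ring
    rw [e]
    refine (abs_add_le _ _).trans ?_
    rw [abs_mul, abs_mul]
    have h3 : |g x| ≤ |B| := (hB x).trans (le_abs_self _)
    calc _ ≤ (C * dist x y) * |B| + M * (D * dist x y) := by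
          gcongr
          exact hM y
      _ = _ := by ring
  · rw [Function.mem_support] at hx ⊢
    exact left_ne_zero_of_mul hx

/-- The slice `min (max (f - a) 0) d` of a function between the levels `a` and `a + d`. -/
def LipBs.slice (f : LipBs X) (a d : ℝ≥0) : LipBs X :=
  ⟨fun x => min (max ((f : X → ℝ) x - a) 0) d, by
    refine LipBs.comp_mem f (φ := fun t => min (max (t - a) 0) (d : ℝ)) (D := 1) ?_ ?_
    · exact ((LipschitzWith.id.sub (LipschitzWith.const (a : ℝ))).weaken (by simp)
        |>.max_const 0).min_const _
    · simp⟩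

theorem LipBs.slice_apply (f : LipBs X) (a d : ℝ≥0) (x : X) :
    (LipBs.slice f a d : X → ℝ) x = min (max ((f : X → ℝ) x - a) 0) d := rfl

theorem LipBs.sum_slice (f : LipBs X) (d : ℝ≥0) (m : ℕ) (x : X) :
    ∑ k ∈ Finset.range m, (LipBs.slice f (k * d) d : X → ℝ) x = min (max ((f : X → ℝ) x) 0) (m * d) := by
  induction m with
  | zero => simp
  | succ m ih =>
    rw [Finset.sum_range_succ, ih, LipBs.slice_apply]
    push_cast
    have h1 : (0 : ℝ) ≤ d := d.2
    have h2 : (0 : ℝ) ≤ m * d := by positivity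
    have h3 : ((m : ℝ) + 1) * d = m * d + d := by ring
    rw [h3]
    generalize (f : X → ℝ) x = t
    generalize (m : ℝ) * d = s at *
    simp only [min_def, max_def]
    split_ifs <;> linarith

theorem LipBs.slice_nonneg (f : LipBs X) (a d : ℝ≥0) (x : X) :
    0 ≤ (LipBs.slice f a d : X → ℝ) x :=
  le_min (le_max_right _ _) d.2

theorem LipBs.abs_slice_le (f : LipBs X) (a d : ℝ≥0) (x : X) :
    |(LipBs.slice f a d : X → ℝ) x| ≤ d := by
  rw [abs_of_nonneg (LipBs.slice_nonneg f a d x)]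
  exact min_le_right _ _

theorem lipschitzWith_mem_lipLoc {f : X → ℝ} {C : ℝ≥0} (h : LipschitzWith C f) : f ∈ LipLoc X :=
  fun _ _ => ⟨C, h.lipschitzOnWith⟩

/-- Entries of `w` are exchanged for entries of `v` one at a time, and each exchange costs a value
of `m` with a difference in one slot. This lets locality, which concerns a single constant entry,
act on all entries at once. -/
theorem _root_.MultilinearMap.eq_of_sub_mem_ker {N : ℕ} {V : Type*} [AddCommGroup V] [Module ℝ V]
    (m : MultilinearMap ℝ (fun _ : Fin N => V) ℝ) (v w : Fin N → V)
    (h : ∀ (ρ : Fin N → V) (j : Fin N), ρ j = v j - w j → m ρ = 0) : m v = m w := by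
  classical
  have key : ∀ s : Finset (Fin N), m (s.piecewise v w) = m w := by
    intro s
    induction s using Finset.induction_on with
    | empty => simp
    | insert j s hj ih =>
      rw [Finset.piecewise_insert, ← ih]
      have e : s.piecewise v w = Function.update (s.piecewise v w) j (w j) := by
        rw [eq_comm, Function.update_eq_self_iff, Finset.piecewise_eq_of_notMem _ _ _ hj]
      conv_rhs => rw [e]
      rw [← sub_eq_zero, ← MultilinearMap.map_update_sub]
      exact h _ j (by simp)
  have := key Finset.univ
  simpa using this

variable {N : ℕ} {T : Functional X N}

/-- Locality: `T f π` depends only on `π` near the support of `f`. -/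
theorem IsMetricFunctional.congr (hT : IsMetricFunctional T) (f : LipBs X)
    {π π' : Fin N → LipLoc X} {U : Set X} (hU : IsOpen U)
    (hfU : Function.support (f : X → ℝ) ⊆ U)
    (h : ∀ j, ∀ x ∈ U, (π j : X → ℝ) x = (π' j : X → ℝ) x) : T f π = T f π' := by
  refine (T f).eq_of_sub_mem_ker π π' fun ρ j hj => hT.isLocal f ρ ⟨j, U, ?_, 0, fun x hx => ?_⟩
  · exact mem_nhdsSet_iff_exists.2 ⟨U, hU, hfU, Subset.rfl⟩
  · rw [hj]; simp [h j x hx]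

theorem ofReal_apply_le_massOn (f : LipBs X) (π : Fin N → LipLoc X)
    (hπ : ∀ j, LipschitzWith 1 (π j : X → ℝ)) {V : Set X}
    (hf : tsupport (f : X → ℝ) ⊆ V) (hf1 : ∀ x, |(f : X → ℝ) x| ≤ 1) :
    ENNReal.ofReal (T f π) ≤ massOn T V := by
  unfold massOn
  refine le_iSup_of_le 1 (le_iSup_of_le (fun _ => f) (le_iSup_of_le (fun _ => π) ?_))
  refine le_iSup_of_le (fun _ => hπ) (le_iSup_of_le (fun _ => hf) (le_iSup_of_le (fun x => ?_) ?_))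
  · simpa using hf1 x
  · simp

/-- Multiplying `f` by `±1/δ` makes it a one-term competitor in the supremum defining the mass; the
sign turns `T f π` into its absolute value. -/
theorem ofReal_abs_apply_le_mass (f : LipBs X) (π : Fin N → LipLoc X)
    (hπ : ∀ j, LipschitzWith 1 (π j : X → ℝ)) {A : Set X} {δ : ℝ} (hδ : 0 < δ)
    (hf : tsupport (f : X → ℝ) ⊆ A) (hf1 : ∀ x, |(f : X → ℝ) x| ≤ δ) :
    ENNReal.ofReal |T f π| ≤ ENNReal.ofReal δ * mass T A := by
  have key : ∀ c : ℝ, |c| = δ⁻¹ → ENNReal.ofReal (c * T f π) ≤ mass T A := by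
    intro c hc
    unfold mass
    refine le_iInf fun V => le_iInf fun _ => le_iInf fun hAV => ?_
    have := ofReal_apply_le_massOn (T := T) (c • f) π hπ (V := V)
      ((closure_mono (Function.support_const_smul_subset c (f : X → ℝ))).trans (hf.trans hAV))
      (fun x => by
        have : ((c • f : LipBs X) : X → ℝ) x = c * (f : X → ℝ) x := rfl
        rw [this, abs_mul, hc, inv_mul_le_iff₀ hδ, mul_one]
        exact hf1 x)
    simpa using this
  have h1 : ∃ c : ℝ, |c| = δ⁻¹ ∧ c * T f π = δ⁻¹ * |T f π| := by
    rcases abs_cases (T f π) with h | h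
    · exact ⟨δ⁻¹, abs_of_pos (inv_pos.2 hδ), by rw [h.1]⟩
    · exact ⟨-δ⁻¹, by rw [abs_neg, abs_of_pos (inv_pos.2 hδ)], by rw [h.1]; ring⟩
  obtain ⟨c, hc, hc'⟩ := h1
  have h2 := key c hc
  rw [hc', ENNReal.ofReal_mul (inv_pos.2 hδ).le] at h2
  calc ENNReal.ofReal |T f π| = ENNReal.ofReal δ * (ENNReal.ofReal δ⁻¹ * ENNReal.ofReal |T f π|) := by
        rw [← mul_assoc, ← ENNReal.ofReal_mul hδ.le, mul_inv_cancel₀ hδ.ne']; simp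
    _ ≤ _ := by gcongr

/-- `T` is a metric current with locally finite mass and mass measure `μ`. -/
structure IsCurrentWithMass [MeasurableSpace X] (T : Functional X N) (μ : Measure X) : Prop where
  current : IsLocFiniteMassCurrent T
  massMeasure : IsMassMeasure T μ

variable [MeasurableSpace X] [BorelSpace X] {μ : Measure X}

theorem IsCurrentWithMass.measure_lt_top (h : IsCurrentWithMass T μ) {A : Set X}
    (hA : IsBounded A) : μ A < ⊤ := by
  rcases A.eq_empty_or_nonempty with rfl | ⟨x₀, -⟩
  · simp
  obtain ⟨r, hr⟩ := hA.subset_ball x₀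
  obtain ⟨-, -, -, h1, -⟩ := h.current.tight (ball x₀ r) isOpen_ball isBounded_ball 1 one_pos
  refine (measure_mono hr).trans_lt ?_
  rw [← h.massMeasure _ isOpen_ball.measurableSet]
  refine lt_of_le_of_lt ?_ h1
  exact iInf_le_of_le (ball x₀ r) (iInf_le_of_le isOpen_ball (iInf_le _ Subset.rfl))

theorem IsCurrentWithMass.integrable_of_bounded (h : IsCurrentWithMass T μ) {g : X → ℝ} {S : Set X}
    (hS : IsBounded S) (hg : AEStronglyMeasurable g μ) (hgS : Function.support g ⊆ S) {M : ℝ}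
    (hM : ∀ x, |g x| ≤ M) : Integrable g μ := by
  have h1 : Function.support g ⊆ closure S := hgS.trans subset_closure
  rw [← integrableOn_iff_integrable_of_support_subset h1]
  exact Measure.integrableOn_of_bounded (M := M) (h.measure_lt_top hS.closure).ne hg
    (Eventually.of_forall hM)

theorem IsCurrentWithMass.integrable (h : IsCurrentWithMass T μ) (f : LipBs X) :
    Integrable (f : X → ℝ) μ := by
  obtain ⟨M, -, hM⟩ := LipBs.exists_bound f
  exact h.integrable_of_bounded f.2.2 (LipBs.continuous f).aestronglyMeasurable Subset.rfl hM

theorem IsCurrentWithMass.abs_apply_le_measureReal (h : IsCurrentWithMass T μ) (f : LipBs X)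
    (π : Fin N → LipLoc X) (hπ : ∀ j, LipschitzWith 1 (π j : X → ℝ)) {A : Set X} {δ : ℝ}
    (hδ : 0 < δ) (hA : IsClosed A) (hAb : IsBounded A)
    (hf : Function.support (f : X → ℝ) ⊆ A) (hf1 : ∀ x, |(f : X → ℝ) x| ≤ δ) :
    |T f π| ≤ δ * μ.real A := by
  have h1 := ofReal_abs_apply_le_mass (T := T) f π hπ hδ (closure_minimal hf hA) hf1
  rw [h.massMeasure _ hA.measurableSet] at h1
  have h2 := ENNReal.toReal_mono (ENNReal.mul_ne_top ENNReal.ofReal_ne_top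
    (h.measure_lt_top hAb).ne) h1
  rwa [ENNReal.toReal_ofReal (abs_nonneg _), ENNReal.toReal_mul, ENNReal.toReal_ofReal hδ.le] at h2

/-- A discrete layer-cake argument. The function `f` is cut into `m` slices of height `d = M/m`.
Each slice other than the lowest lives on a superlevel set on which the slice below it has its full
height `d`, so the crude bound `d * μ(A)` is at most the integral of the slice below. The lowest
slice costs at most `d * μ(spt f)`, which tends to `0` as `m → ∞`. -/
theorem IsCurrentWithMass.abs_apply_le_of_nonneg (h : IsCurrentWithMass T μ) (f : LipBs X)
    (hf : ∀ x, 0 ≤ (f : X → ℝ) x) (π : Fin N → LipLoc X)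
    (hπ : ∀ j, LipschitzWith 1 (π j : X → ℝ)) : |T f π| ≤ ∫ x, (f : X → ℝ) x ∂μ := by
  obtain ⟨M, hM0, hM⟩ := LipBs.exists_bound f
  have hfb := LipBs.isBounded_tsupport f
  have key : ∀ m : ℕ, 0 < m →
      |T f π| ≤ M / m * μ.real (tsupport (f : X → ℝ)) + ∫ x, (f : X → ℝ) x ∂μ := by
    intro m hm
    rcases hM0.eq_or_lt with rfl | hMpos
    · have : f = 0 := by
        ext x
        exact abs_nonpos_iff.1 (hM x)
      simp [this]
    have hm' : (0 : ℝ) < m := by exact_mod_cast hm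
    set d : ℝ≥0 := ⟨M / m, by positivity⟩ with hd
    have hd' : (d : ℝ) = M / m := rfl
    have hdpos : (0 : ℝ) < d := by rw [hd']; positivity
    have hsum : ∀ x, ∑ k ∈ Finset.range m, (LipBs.slice f (k * d) d : X → ℝ) x
        = (f : X → ℝ) x := by
      intro x
      rw [LipBs.sum_slice, max_eq_left (hf x), hd', mul_div_cancel₀ _ hm'.ne', min_eq_left]
      exact (le_abs_self _).trans (hM x)
    have hfs : f = ∑ k ∈ Finset.range m, LipBs.slice f (k * d) d := by
      ext x
      rw [← hsum x]
      simp
    have hT1 : |T f π| ≤ ∑ k ∈ Finset.range m, |T (LipBs.slice f (k * d) d) π| := by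
      conv_lhs => rw [hfs]
      rw [map_sum, sum_apply]
      exact Finset.abs_sum_le_sum_abs _ _
    obtain ⟨l, rfl⟩ : ∃ l, m = l + 1 := ⟨m - 1, by omega⟩
    rw [Finset.sum_range_succ'] at hT1
    have h0 : |T (LipBs.slice f ((0 : ℕ) * d) d) π| ≤ d * μ.real (tsupport (f : X → ℝ)) := by
      refine h.abs_apply_le_measureReal _ π hπ hdpos (isClosed_tsupport _) hfb ?_
        (LipBs.abs_slice_le f _ _)
      refine Subset.trans (fun x hx => ?_) subset_closure
      rw [Function.mem_support] at hx ⊢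
      rw [LipBs.slice_apply] at hx
      rintro h0
      exact hx (by rw [h0]; simp)
    have h1 : ∀ k ∈ Finset.range l, |T (LipBs.slice f ((k + 1 : ℕ) * d) d) π|
        ≤ ∫ x, (LipBs.slice f (k * d) d : X → ℝ) x ∂μ := by
      intro k _
      -- Slice `k + 1` is supported in `A`, while slice `k` equals `d` on `A`: this is the shift by
      -- one index.
      set A : Set X := {x | ((k + 1 : ℕ) : ℝ) * d ≤ (f : X → ℝ) x} with hAdef
      have hA : IsClosed A := isClosed_le continuous_const (LipBs.continuous f)
      have hkpos : (0 : ℝ) < ((k + 1 : ℕ) : ℝ) * d := by positivity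
      have hAb : IsBounded A := by
        refine IsBounded.subset f.2.2 fun x hx h0 => ?_
        have hx' : ((k + 1 : ℕ) : ℝ) * d ≤ (f : X → ℝ) x := hx
        rw [h0] at hx'
        linarith
      refine (h.abs_apply_le_measureReal _ π hπ hdpos hA hAb (fun x hx => ?_)
        (LipBs.abs_slice_le f _ _)).trans ?_
      · rw [Function.mem_support, LipBs.slice_apply] at hx
        by_contra hx'
        have hx'' : (f : X → ℝ) x < ((k + 1 : ℕ) : ℝ) * d := not_le.1 hx'
        apply hx
        rw [max_eq_right, min_eq_left hdpos.le]
        push_cast at hx'' ⊢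
        linarith
      · have e : d * μ.real A = ∫ x, A.indicator (fun _ => (d : ℝ)) x ∂μ := by
          rw [integral_indicator_const _ hA.measurableSet, smul_eq_mul, mul_comm]
        rw [e]
        refine integral_mono_of_nonneg ?_ (h.integrable _) ?_
        · exact Eventually.of_forall fun x => indicator_nonneg (fun _ _ => hdpos.le) x
        · refine Eventually.of_forall fun x => ?_
          by_cases hx : x ∈ A
          · rw [indicator_of_mem hx, LipBs.slice_apply]
            have hx' : ((k + 1 : ℕ) : ℝ) * d ≤ (f : X → ℝ) x := hx
            refine le_min (le_max_of_le_left ?_) le_rfl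
            push_cast at hx' ⊢
            linarith
          · rw [indicator_of_notMem hx]
            exact LipBs.slice_nonneg f _ _ x
    have h2 : ∑ k ∈ Finset.range l, ∫ x, (LipBs.slice f (k * d) d : X → ℝ) x ∂μ
        ≤ ∫ x, (f : X → ℝ) x ∂μ := by
      rw [← integral_finsetSum _ fun k _ => h.integrable _]
      refine integral_mono (integrable_finsetSum _ fun k _ => h.integrable _) (h.integrable f) ?_
      intro x
      dsimp only
      rw [← hsum x, Finset.sum_range_succ]
      linarith [LipBs.slice_nonneg f (l * d) d x]
    have h3 := Finset.sum_le_sum h1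
    rw [← hd']
    linarith
  have hlim : Tendsto (fun m : ℕ => M / m * μ.real (tsupport (f : X → ℝ))
      + ∫ x, (f : X → ℝ) x ∂μ) atTop (𝓝 (0 * μ.real (tsupport (f : X → ℝ))
      + ∫ x, (f : X → ℝ) x ∂μ)) :=
    ((tendsto_const_div_atTop_nhds_zero_nat M).mul_const _).add_const _
  rw [zero_mul, zero_add] at hlim
  exact ge_of_tendsto hlim (eventually_atTop.2 ⟨1, fun m hm => key m hm⟩)

/-- The mass inequality for `1`-Lipschitz entries. -/
theorem IsCurrentWithMass.abs_apply_le_of_lipschitz_one (h : IsCurrentWithMass T μ) (f : LipBs X)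
    (π : Fin N → LipLoc X) (hπ : ∀ j, LipschitzWith 1 (π j : X → ℝ)) :
    |T f π| ≤ ∫ x, |(f : X → ℝ) x| ∂μ := by
  let fp : LipBs X := ⟨fun x => max ((f : X → ℝ) x) 0,
    LipBs.comp_mem f (φ := fun t => max t 0) (LipschitzWith.id.max_const 0) (by simp)⟩
  let fm : LipBs X := ⟨fun x => max (-(f : X → ℝ) x) 0,
    LipBs.comp_mem f (φ := fun t => max (-t) 0) (LipschitzWith.id.neg.max_const 0) (by simp)⟩
  have e : f = fp - fm := by
    ext x
    show (f : X → ℝ) x = max ((f : X → ℝ) x) 0 - max (-(f : X → ℝ) x) 0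
    rcases le_total 0 ((f : X → ℝ) x) with h | h
    · rw [max_eq_left h, max_eq_right (by linarith)]; ring
    · rw [max_eq_right h, max_eq_left (by linarith)]; ring
  have e2 : ∫ x, |(f : X → ℝ) x| ∂μ = ∫ x, (fp : X → ℝ) x ∂μ + ∫ x, (fm : X → ℝ) x ∂μ := by
    rw [← integral_add (h.integrable fp) (h.integrable fm)]
    refine integral_congr_ae (Eventually.of_forall fun x => ?_)
    show |(f : X → ℝ) x| = max ((f : X → ℝ) x) 0 + max (-(f : X → ℝ) x) 0
    rcases le_total 0 ((f : X → ℝ) x) with h | h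
    · rw [max_eq_left h, max_eq_right (by linarith), abs_of_nonneg h]; ring
    · rw [max_eq_right h, max_eq_left (by linarith), abs_of_nonpos h]; ring
  have h1 := h.abs_apply_le_of_nonneg fp (fun x => le_max_right _ _) π hπ
  have h2 := h.abs_apply_le_of_nonneg fm (fun x => le_max_right _ _) π hπ
  rw [e2]
  conv_lhs => rw [e]
  rw [map_sub, sub_apply]
  exact (abs_sub _ _).trans (add_le_add h1 h2)

/-- The mass inequality `|T(f, π)| ≤ L ^ N ∫ |f| d‖T‖` for `L`-Lipschitz entries. -/
theorem IsCurrentWithMass.abs_apply_le (h : IsCurrentWithMass T μ) (f : LipBs X)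
    (π : Fin N → LipLoc X) {L : ℝ≥0} (hL : 0 < L) (hπ : ∀ j, LipschitzWith L (π j : X → ℝ)) :
    |T f π| ≤ L ^ N * ∫ x, |(f : X → ℝ) x| ∂μ := by
  have hL' : (0 : ℝ) < L := hL
  have e : π = fun j => (L : ℝ) • ((L : ℝ)⁻¹ • π j) := by
    ext j x
    simp [hL'.ne']
  have h1 := h.abs_apply_le_of_lipschitz_one f (fun j => (L : ℝ)⁻¹ • π j) fun j => by
    have := (lipschitzWith_smul ((L : ℝ)⁻¹)).comp (hπ j)
    refine LipschitzWith.weaken this ?_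
    rw [nnnorm_inv, Real.nnnorm_of_nonneg hL'.le]
    exact (inv_mul_cancel₀ hL.ne').le
  conv_lhs => rw [e]
  rw [MultilinearMap.map_smul_univ, Finset.prod_const, Finset.card_univ, Fintype.card_fin,
    smul_eq_mul, abs_mul, abs_of_pos (pow_pos hL' N)]
  gcongr

/-- The quantitative strengthened locality property: changing the entries `π` away from a closed
set `C` only affects `T f π` through the mass of `f` off `C`. -/
theorem IsCurrentWithMass.abs_sub_le_of_eqOn (h : IsCurrentWithMass T μ) (f : LipBs X)
    {π π' : Fin N → LipLoc X} {L : ℝ≥0} (hL : 0 < L) (hπ : ∀ j, LipschitzWith L (π j : X → ℝ))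
    (hπ' : ∀ j, LipschitzWith L (π' j : X → ℝ)) {C : Set X} (hC : IsClosed C)
    (heq : ∀ j, ∀ x ∈ C, (π j : X → ℝ) x = (π' j : X → ℝ) x) :
    |T f π - T f π'| ≤ 2 * (3 * L) ^ N * ∫ x in Cᶜ, |(f : X → ℝ) x| ∂μ := by
  have hL' : (0 : ℝ) < L := hL
  have hLL : (0 : ℝ≥0) < 3 * L := by positivity
  set δ : ℕ → ℝ := fun k => 1 / ((k : ℝ) + 1) with hδ
  have hδpos : ∀ k, 0 < δ k := fun k => by simp only [hδ]; positivity
  have hδlim : Tendsto δ atTop (𝓝 0) := tendsto_one_div_add_atTop_nhds_zero_nat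
  -- The difference of the entries is `2L`-Lipschitz and vanishes on `C`, so within distance `η` of
  -- `C` it is at most `δ` and clipping at `±δ` leaves it unchanged; there the modified entry is
  -- exactly `π'`.
  set η : ℕ → ℝ := fun k => δ k / (2 * L) with hη
  have hηpos : ∀ k, 0 < η k := fun k => div_pos (hδpos k) (by positivity)
  have hηlim : Tendsto η atTop (𝓝 0) := by simpa using hδlim.div_const (2 * (L : ℝ))
  -- the modified entries, equal to `π'` near `C`
  let clip : ℕ → Fin N → X → ℝ := fun k j x =>
    max (-δ k) (min (δ k) ((π j : X → ℝ) x - (π' j : X → ℝ) x))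
  have hclipL : ∀ k j, LipschitzWith (2 * L) (clip k j) := fun k j => by
    have := ((hπ j).sub (hπ' j)).const_min (δ k) |>.const_max (-δ k)
    rwa [two_mul]
  let ρ : ℕ → Fin N → LipLoc X := fun k j => π j - ⟨clip k j, lipschitzWith_mem_lipLoc (hclipL k j)⟩
  have hρ_apply : ∀ k j x, (ρ k j : X → ℝ) x = (π j : X → ℝ) x - clip k j x := fun _ _ _ => rfl
  have hρL : ∀ k j, LipschitzWith (3 * L) (ρ k j : X → ℝ) := fun k j => by
    have := (hπ j).sub (hclipL k j)
    rw [show L + 2 * L = 3 * L by ring] at this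
    exact this
  have hclip_le : ∀ k j x, |clip k j x| ≤ δ k := fun k j x =>
    abs_le.2 ⟨le_max_left _ _, max_le (by linarith [hδpos k]) (min_le_left _ _)⟩
  have hlim1 : Tendsto (fun k => T f (ρ k)) atTop (𝓝 (T f π)) := by
    refine h.current.isMetricFunctional.continuous f ρ π (fun j x => ?_)
      fun A _ => ⟨3 * L, fun k j => (hρL k j).lipschitzOnWith⟩
    have : Tendsto (fun k => clip k j x) atTop (𝓝 0) :=
      squeeze_zero_norm (fun k => hclip_le k j x) hδlim
    simpa [hρ_apply] using this.const_sub ((π j : X → ℝ) x)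
  -- the cutoffs of `f`
  let χ : ℕ → X → ℝ := fun k x => (thickenedIndicator (hηpos k) C x : ℝ)
  have hχL : ∀ k, ∃ D : ℝ≥0, LipschitzWith D (χ k) := fun k =>
    ⟨_, LipschitzWith.of_dist_le_mul (lipschitzWith_thickenedIndicator (hηpos k) C).dist_le_mul⟩
  have hχ1 : ∀ k x, |χ k x| ≤ 1 := fun k x => by
    rw [abs_of_nonneg (NNReal.coe_nonneg _)]
    exact_mod_cast thickenedIndicator_le_one (hηpos k) C x
  let fχ : ℕ → LipBs X := fun k =>
    ⟨fun x => (f : X → ℝ) x * χ k x, mul_mem_lipBs f (hχL k).choose_spec (hχ1 k)⟩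
  have hloc : ∀ k, T (fχ k) (ρ k) = T (fχ k) π' := by
    intro k
    refine h.current.isMetricFunctional.congr (fχ k) (U := thickening (η k) C) isOpen_thickening
      (fun x hx => ?_) fun j x hx => ?_
    · by_contra hx'
      have : χ k x = 0 := by
        simp only [χ]
        rw [thickenedIndicator_zero (hηpos k) C hx']; simp
      exact hx (by show (f : X → ℝ) x * χ k x = 0; rw [this, mul_zero])
    · obtain ⟨y, hy, hxy⟩ := mem_thickening_iff.1 hx
      have h1 := (hπ j).dist_le_mul x y
      have h2 := (hπ' j).dist_le_mul x y
      rw [Real.dist_eq] at h1 h2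
      have h3 : L * dist x y ≤ δ k / 2 := by
        have : L * dist x y ≤ L * η k := by gcongr
        refine this.trans (le_of_eq ?_)
        simp only [hη]; field_simp
      have h4 : |(π j : X → ℝ) x - (π' j : X → ℝ) x| ≤ δ k := by
        have e : (π j : X → ℝ) x - (π' j : X → ℝ) x = ((π j : X → ℝ) x - (π j : X → ℝ) y)
          - ((π' j : X → ℝ) x - (π' j : X → ℝ) y) := by rw [heq j y hy]; ring
        rw [e]
        refine (abs_sub _ _).trans ?_
        linarith
      rw [hρ_apply]
      simp only [clip]
      rw [min_eq_right (abs_le.1 h4).2, max_eq_right (abs_le.1 h4).1]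
      ring
  have hbound : ∀ k, |T f (ρ k) - T f π'| ≤
      2 * (3 * L) ^ N * ∫ x, |(f : X → ℝ) x - (f : X → ℝ) x * χ k x| ∂μ := by
    intro k
    -- The part of `f` near `C` cancels by ordinary locality; only the part away from `C` is left
    -- for the mass inequality.
    have e : T f (ρ k) - T f π' = T (f - fχ k) (ρ k) - T (f - fχ k) π' := by
      rw [map_sub, sub_apply, sub_apply, hloc k]; ring
    rw [e]
    refine (abs_sub _ _).trans ?_
    have h1 := h.abs_apply_le (f - fχ k) (ρ k) hLL (hρL k)
    have h2 := h.abs_apply_le (f - fχ k) π' hLL fun j => (hπ' j).weaken (by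
      rw [← NNReal.coe_le_coe]; push_cast; linarith)
    simp only [NNReal.coe_mul, NNReal.coe_ofNat] at h1 h2
    have e3 : ∫ x, |((f - fχ k : LipBs X) : X → ℝ) x| ∂μ
      = ∫ x, |(f : X → ℝ) x - (f : X → ℝ) x * χ k x| ∂μ := rfl
    rw [e3] at h1 h2
    linarith
  have hlim2 : Tendsto (fun k => ∫ x, |(f : X → ℝ) x - (f : X → ℝ) x * χ k x| ∂μ) atTop
      (𝓝 (∫ x in Cᶜ, |(f : X → ℝ) x| ∂μ)) := by
    rw [← integral_indicator hC.measurableSet.compl]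
    refine tendsto_integral_of_dominated_convergence (fun x => |(f : X → ℝ) x|) (fun k => ?_)
      (h.integrable f).abs (fun k => Eventually.of_forall fun x => ?_)
      (Eventually.of_forall fun x => ?_)
    · exact ((h.integrable f).sub (h.integrable (fχ k))).abs.aestronglyMeasurable
    · rw [Real.norm_eq_abs, abs_abs]
      have e : (f : X → ℝ) x - (f : X → ℝ) x * χ k x = (f : X → ℝ) x * (1 - χ k x) := by ring
      rw [e, abs_mul]
      refine mul_le_of_le_one_right (abs_nonneg _) ?_
      have h0 : 0 ≤ χ k x := NNReal.coe_nonneg _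
      have h1 := (abs_le.1 (hχ1 k x)).2
      rw [abs_le]; constructor <;> linarith
    · have h1 := thickenedIndicator_tendsto_indicator_closure hηpos hηlim C
      rw [tendsto_pi_nhds] at h1
      have h2 := (NNReal.continuous_coe.tendsto _).comp (h1 x)
      rw [hC.closure_eq] at h2
      have h3 : Tendsto (fun k => |(f : X → ℝ) x - (f : X → ℝ) x * χ k x|) atTop
          (𝓝 |(f : X → ℝ) x - (f : X → ℝ) x * (C.indicator (fun _ => (1 : ℝ≥0)) x : ℝ≥0)|) :=
        ((h2.const_mul _).const_sub _).abs
      convert h3 using 2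
      by_cases hx : x ∈ C <;> simp [hx]
  exact le_of_tendsto_of_tendsto' (hlim1.sub_const _).abs (hlim2.const_mul _) hbound

/-! ### Extension of a current to integrable functions -/

/-- `v` is the value at `g` of the `L¹(μ)`-continuous extension of `T (·, π)`. -/
def LimVal (T : Functional X N) (μ : Measure X) (π : Fin N → LipLoc X) (g : X → ℝ) (v : ℝ) : Prop :=
  ∀ δ : ℝ, 0 < δ → ∃ f : LipBs X,
    ∫⁻ x, ‖(f : X → ℝ) x - g x‖ₑ ∂μ ≤ ENNReal.ofReal δ ∧ |T f π - v| ≤ δ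

theorem LimVal.self (f : LipBs X) (π : Fin N → LipLoc X) : LimVal T μ π (f : X → ℝ) (T f π) :=
  fun δ hδ => ⟨f, by simp, by simp [hδ.le]⟩

theorem LimVal.of_tendsto {π : Fin N → LipLoc X} {g : ℕ → X → ℝ} {g' : X → ℝ} {v : ℕ → ℝ} {w : ℝ}
    (hm : ∀ k, AEStronglyMeasurable (g k) μ) (h : ∀ k, LimVal T μ π (g k) (v k))
    (hg : Tendsto (fun k => ∫⁻ x, ‖g k x - g' x‖ₑ ∂μ) atTop (𝓝 0)) (hv : Tendsto v atTop (𝓝 w)) :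
    LimVal T μ π g' w := by
  intro δ hδ
  have h1 : ∀ᶠ k in atTop, ∫⁻ x, ‖g k x - g' x‖ₑ ∂μ < ENNReal.ofReal (δ / 2) :=
    hg.eventually_lt_const (by simpa using hδ)
  have h2 : ∀ᶠ k in atTop, |v k - w| < δ / 2 := by
    have := (tendsto_iff_dist_tendsto_zero.1 hv).eventually_lt_const (half_pos hδ)
    simpa [Real.dist_eq] using this
  obtain ⟨k, hk1, hk2⟩ := (h1.and h2).exists
  obtain ⟨f, hf1, hf2⟩ := h k (δ / 2) (half_pos hδ)
  refine ⟨f, ?_, ?_⟩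
  · calc ∫⁻ x, ‖(f : X → ℝ) x - g' x‖ₑ ∂μ
        ≤ ∫⁻ x, (‖(f : X → ℝ) x - g k x‖ₑ + ‖g k x - g' x‖ₑ) ∂μ := by
          refine lintegral_mono fun x => ?_
          rw [show (f : X → ℝ) x - g' x = ((f : X → ℝ) x - g k x) + (g k x - g' x) by ring]
          exact enorm_add_le _ _
      _ = ∫⁻ x, ‖(f : X → ℝ) x - g k x‖ₑ ∂μ + ∫⁻ x, ‖g k x - g' x‖ₑ ∂μ := by
          rw [lintegral_add_left']
          exact ((LipBs.continuous f).aestronglyMeasurable.sub (hm k)).enorm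
      _ ≤ ENNReal.ofReal (δ / 2) + ENNReal.ofReal (δ / 2) := add_le_add hf1 hk1.le
      _ = ENNReal.ofReal δ := by
          rw [← ENNReal.ofReal_add (by positivity) (by positivity), add_halves]
  · calc |T f π - w| ≤ |T f π - v k| + |v k - w| := abs_sub_le _ _ _
      _ ≤ δ := by linarith

/-- Limits along dominated pointwise convergence. -/
theorem LimVal.of_dominated {π : Fin N → LipLoc X} {g : ℕ → X → ℝ} {g' : X → ℝ} {v : ℕ → ℝ} {w : ℝ}
    (hm : ∀ k, AEStronglyMeasurable (g k) μ) (h : ∀ k, LimVal T μ π (g k) (v k)) (b : X → ℝ)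
    (hb : Integrable b μ) (hgb : ∀ k, ∀ᵐ x ∂μ, ‖g k x‖ ≤ b x)
    (hg : ∀ᵐ x ∂μ, Tendsto (fun k => g k x) atTop (𝓝 (g' x))) (hv : Tendsto v atTop (𝓝 w)) :
    LimVal T μ π g' w := by
  refine LimVal.of_tendsto hm h ?_ hv
  have := tendsto_lintegral_norm_of_dominated_convergence hm hb.hasFiniteIntegral hgb hg
  simpa only [ofReal_norm] using this

theorem LimVal.add {π : Fin N → LipLoc X} {g g' : X → ℝ} {v v' : ℝ} (h : LimVal T μ π g v)
    (h' : LimVal T μ π g' v') (hm : AEStronglyMeasurable g μ) :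
    LimVal T μ π (fun x => g x + g' x) (v + v') := by
  intro δ hδ
  obtain ⟨f, hf1, hf2⟩ := h (δ / 2) (half_pos hδ)
  obtain ⟨f', hf1', hf2'⟩ := h' (δ / 2) (half_pos hδ)
  refine ⟨f + f', ?_, ?_⟩
  · calc ∫⁻ x, ‖((f + f' : LipBs X) : X → ℝ) x - (g x + g' x)‖ₑ ∂μ
        ≤ ∫⁻ x, (‖(f : X → ℝ) x - g x‖ₑ + ‖(f' : X → ℝ) x - g' x‖ₑ) ∂μ := by
          refine lintegral_mono fun x => ?_
          rw [show ((f + f' : LipBs X) : X → ℝ) x - (g x + g' x)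
            = ((f : X → ℝ) x - g x) + ((f' : X → ℝ) x - g' x) from add_sub_add_comm _ _ _ _]
          exact enorm_add_le _ _
      _ = ∫⁻ x, ‖(f : X → ℝ) x - g x‖ₑ ∂μ + ∫⁻ x, ‖(f' : X → ℝ) x - g' x‖ₑ ∂μ := by
          rw [lintegral_add_left']
          exact ((LipBs.continuous f).aestronglyMeasurable.sub hm).enorm
      _ ≤ ENNReal.ofReal (δ / 2) + ENNReal.ofReal (δ / 2) := add_le_add hf1 hf1'
      _ = ENNReal.ofReal δ := by
          rw [← ENNReal.ofReal_add (by positivity) (by positivity), add_halves]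
  · rw [map_add, add_apply,
      show T f π + T f' π - (v + v') = (T f π - v) + (T f' π - v') by ring]
    exact (abs_add_le _ _).trans (by linarith)

theorem lintegral_enorm_sub_le_add {f f' g : X → ℝ} (hf : AEStronglyMeasurable f μ)
    (hg : AEStronglyMeasurable g μ) :
    ∫⁻ x, ‖f x - f' x‖ₑ ∂μ ≤ ∫⁻ x, ‖f x - g x‖ₑ ∂μ + ∫⁻ x, ‖f' x - g x‖ₑ ∂μ := by
  have hm : AEMeasurable (fun x => ‖f x - g x‖ₑ) μ := (hf.sub hg).enorm
  rw [← lintegral_add_left' hm]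
  refine lintegral_mono fun x => ?_
  rw [show f x - f' x = (f x - g x) - (f' x - g x) by ring]
  exact enorm_sub_le

/-- The extended value is unique if the entries are Lipschitz. -/
theorem IsCurrentWithMass.limVal_unique (h : IsCurrentWithMass T μ) {π : Fin N → LipLoc X}
    (hπ : ∀ j, ∃ L : ℝ≥0, LipschitzWith L (π j : X → ℝ)) {g : X → ℝ}
    (hg : AEStronglyMeasurable g μ) {v w : ℝ} (hv : LimVal T μ π g v) (hw : LimVal T μ π g w) :
    v = w := by
  choose L₀ hL₀ using hπ
  set L : ℝ≥0 := 1 + ∑ j, L₀ j with hLdef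
  have hL : 0 < L := by positivity
  have hπL : ∀ j, LipschitzWith L (π j : X → ℝ) := fun j => (hL₀ j).weaken
    ((Finset.single_le_sum (fun i _ => zero_le (a := L₀ i)) (Finset.mem_univ j)).trans
      le_add_self)
  have key : ∀ δ : ℝ, 0 < δ → |v - w| ≤ (2 + 2 * L ^ N) * δ := by
    intro δ hδ
    obtain ⟨f, hf1, hf2⟩ := hv δ hδ
    obtain ⟨f', hf1', hf2'⟩ := hw δ hδ
    have h1 : ∫ x, |((f - f' : LipBs X) : X → ℝ) x| ∂μ ≤ 2 * δ := by
      have e : ∫ x, |((f - f' : LipBs X) : X → ℝ) x| ∂μ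
          = (∫⁻ x, ‖(f : X → ℝ) x - (f' : X → ℝ) x‖ₑ ∂μ).toReal :=
        integral_norm_eq_lintegral_enorm (h.integrable (f - f')).aestronglyMeasurable
      rw [e]
      refine ENNReal.toReal_le_of_le_ofReal (by positivity) ?_
      refine (lintegral_enorm_sub_le_add (LipBs.continuous f).aestronglyMeasurable hg).trans ?_
      rw [two_mul, ENNReal.ofReal_add hδ.le hδ.le]
      exact add_le_add hf1 hf1'
    have h2 := h.abs_apply_le (f - f') π hL hπL
    rw [map_sub, sub_apply] at h2
    have h3 : (L : ℝ) ^ N * ∫ x, |((f - f' : LipBs X) : X → ℝ) x| ∂μ ≤ L ^ N * (2 * δ) := by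
      gcongr
    rw [show v - w = (T f π - T f' π) - (T f π - v) + (T f' π - w) by ring]
    refine (abs_add_le _ _).trans ?_
    have h4 := abs_sub (T f π - T f' π) (T f π - v)
    linarith
  by_contra hne
  have hpos : 0 < |v - w| := abs_pos.2 (sub_ne_zero.2 hne)
  have hc : (0 : ℝ) < 2 + 2 * L ^ N := by positivity
  have := key (|v - w| / (2 * (2 + 2 * L ^ N))) (by positivity)
  rw [show (2 + 2 * (L : ℝ) ^ N) * (|v - w| / (2 * (2 + 2 * L ^ N))) = |v - w| / 2 by
    field_simp] at this
  linarith

/-- Strengthened locality: the extended value at a function vanishing off a closed set `C` depends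
only on the values of the entries on `C`. -/
theorem IsCurrentWithMass.limVal_congr (h : IsCurrentWithMass T μ) {π π' : Fin N → LipLoc X}
    (hπ : ∀ j, ∃ L : ℝ≥0, LipschitzWith L (π j : X → ℝ))
    (hπ' : ∀ j, ∃ L : ℝ≥0, LipschitzWith L (π' j : X → ℝ)) {C : Set X} (hC : IsClosed C)
    (heq : ∀ j, ∀ x ∈ C, (π j : X → ℝ) x = (π' j : X → ℝ) x) {g : X → ℝ}
    (hgC : ∀ x ∉ C, g x = 0) {v : ℝ} (hv : LimVal T μ π g v) : LimVal T μ π' g v := by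
  choose L₀ hL₀ using hπ
  choose L₁ hL₁ using hπ'
  set L : ℝ≥0 := 1 + ∑ j, (L₀ j + L₁ j) with hLdef
  have hL : 0 < L := by positivity
  have hle : ∀ j, L₀ j + L₁ j ≤ L := fun j =>
    ((Finset.single_le_sum (f := fun j => L₀ j + L₁ j) (fun i _ => zero_le)
      (Finset.mem_univ j)).trans le_add_self)
  have hπL : ∀ j, LipschitzWith L (π j : X → ℝ) := fun j =>
    (hL₀ j).weaken (le_self_add.trans (hle j))
  have hπL' : ∀ j, LipschitzWith L (π' j : X → ℝ) := fun j =>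
    (hL₁ j).weaken (le_add_self.trans (hle j))
  intro δ hδ
  -- The term `1` pays for the approximation of `v`, the other one for changing the entries off `C`.
  set c : ℝ := 1 + 2 * (3 * L) ^ N with hc
  have hcpos : 1 ≤ c := by rw [hc]; linarith [show (0 : ℝ) ≤ 2 * (3 * L) ^ N by positivity]
  obtain ⟨f, hf1, hf2⟩ := hv (δ / c) (by positivity)
  have hle' : δ / c ≤ δ := div_le_self hδ.le hcpos
  refine ⟨f, hf1.trans (ENNReal.ofReal_le_ofReal hle'), ?_⟩
  have h1 := h.abs_sub_le_of_eqOn f hL hπL hπL' hC heq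
  have h2 : ∫ x in Cᶜ, |(f : X → ℝ) x| ∂μ ≤ δ / c := by
    have e : ∫ x in Cᶜ, |(f : X → ℝ) x| ∂μ = (∫⁻ x in Cᶜ, ‖(f : X → ℝ) x‖ₑ ∂μ).toReal :=
      integral_norm_eq_lintegral_enorm (h.integrable f).aestronglyMeasurable.restrict
    rw [e]
    refine ENNReal.toReal_le_of_le_ofReal (by positivity) (le_trans ?_ hf1)
    refine le_trans (le_of_eq ?_) (setLIntegral_le_lintegral Cᶜ _)
    refine setLIntegral_congr_fun hC.measurableSet.compl fun x hx => ?_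
    rw [hgC x hx, sub_zero]
  have h3 : 2 * (3 * (L : ℝ)) ^ N * ∫ x in Cᶜ, |(f : X → ℝ) x| ∂μ ≤ 2 * (3 * L) ^ N * (δ / c) := by
    gcongr
  calc |T f π' - v| ≤ |T f π' - T f π| + |T f π - v| := abs_sub_le _ _ _
    _ ≤ 2 * (3 * L) ^ N * (δ / c) + δ / c := by rw [abs_sub_comm]; linarith
    _ = c * (δ / c) := by rw [hc]; ring
    _ = δ := by field_simp

/-- `HasBorelValue` carries its own mass measure; two mass measures agree on all measurable sets, so
it must be `μ`. -/
theorem IsCurrentWithMass.limVal_of_hasBorelValue (h : IsCurrentWithMass T μ)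
    {π : Fin N → LipLoc X} {g : X → ℝ} {v : ℝ} (hv : HasBorelValue T g π v) :
    LimVal T μ π g v := by
  obtain ⟨ν, hν, f, -, -, -, hf, hTf⟩ := hv
  obtain rfl : ν = μ := Measure.ext fun A hA => by rw [← hν A hA, h.massMeasure A hA]
  exact LimVal.of_tendsto (g := fun k => (f k : X → ℝ)) (v := fun k => T (f k) π)
    (fun k => (LipBs.continuous (f k)).aestronglyMeasurable) (fun k => LimVal.self _ _) hf hTf

end Basics

/-! ## Euclidean facts -/

section Euclid

variable {N : ℕ}

/-- A function on a ball of `ℝ^N` with vanishing distributional gradient is constant. -/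
theorem ae_eq_const_of_integral_mul_fderiv_eq_zero {θ : E N → ℝ} (hθ : Integrable θ) (R : ℝ)
    (h : ∀ φ : E N → ℝ, ContDiff ℝ 1 φ → HasCompactSupport φ → tsupport φ ⊆ ball 0 R →
      ∀ j, ∫ x, θ x * fderiv ℝ φ x (EuclideanSpace.single j 1) = 0) :
    ∃ c : ℝ, ∀ᵐ x, x ∈ ball (0 : E N) R → θ x = c := by
  -- Mollify `θ`. The outer radius is twice the inner one because the a.e. convergence of the
  -- convolutions needs a bounded ratio of the radii.
  let φ : ℕ → ContDiffBump (0 : E N) := fun k =>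
    ⟨1 / ((k : ℝ) + 1), 2 * (1 / ((k : ℝ) + 1)), by positivity, by
      have : (0 : ℝ) < 1 / ((k : ℝ) + 1) := by positivity
      linarith⟩
  have hφout : Tendsto (fun k => (φ k).rOut) atTop (𝓝 0) := by
    have : Tendsto (fun k : ℕ => 1 / ((k : ℝ) + 1)) atTop (𝓝 0) :=
      tendsto_one_div_add_atTop_nhds_zero_nat
    simpa [φ] using this.const_mul 2
  set g : ℕ → E N → ℝ := fun k =>
    convolution ((φ k).normed volume) θ
      (ContinuousLinearMap.lsmul ℝ ℝ : ℝ →L[ℝ] ℝ →L[ℝ] ℝ) volume with hg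
  have hlim : ∀ᵐ x, Tendsto (fun k => g k x) atTop (𝓝 (θ x)) :=
    ContDiffBump.ae_convolution_tendsto_right_of_locallyIntegrable (K := 2) hφout
      (Eventually.of_forall fun k => le_rfl) hθ.locallyIntegrable
  have hderiv : ∀ k, ∀ x ∈ ball (0 : E N) (R - (φ k).rOut), HasFDerivAt (g k) (0 : E N →L[ℝ] ℝ) x := by
    intro k x hx
    have h1 := ((φ k).hasCompactSupport_normed (μ := volume)).hasFDerivAt_convolution_left
      (ContinuousLinearMap.lsmul ℝ ℝ : ℝ →L[ℝ] ℝ →L[ℝ] ℝ)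
      ((φ k).contDiff_normed (μ := volume) (n := 1)) hθ.locallyIntegrable x
    have hex := (((φ k).hasCompactSupport_normed (μ := volume)).fderiv
      (𝕜 := ℝ)).convolutionExists_left
      (ContinuousLinearMap.precompL (E N)
        (ContinuousLinearMap.lsmul ℝ ℝ : ℝ →L[ℝ] ℝ →L[ℝ] ℝ))
      (((φ k).contDiff_normed (μ := volume) (n := 1)).continuous_fderiv one_ne_zero)
      hθ.locallyIntegrable x
    refine HasFDerivAt.congr_fderiv h1 (ContinuousLinearMap.coe_injective
      ((EuclideanSpace.basisFun (Fin N) ℝ).toBasis.ext fun j => ?_))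
    rw [OrthonormalBasis.coe_toBasis, EuclideanSpace.basisFun_apply, ContinuousLinearMap.coe_coe]
    set v : E N := EuclideanSpace.single j 1
    rw [convolution_eq_swap, ContinuousLinearMap.integral_apply hex.integrable_swap]
    -- The reflected translate of the mollifier is an admissible test function because its support
    -- stays within `rOut` of `x`, hence in the ball of radius `R`.
    have h2 : ∫ t, θ t * fderiv ℝ (fun t => (φ k).normed volume (x - t)) t v = 0 :=
      h (fun t => (φ k).normed volume (x - t))
      (((φ k).contDiff_normed (μ := volume) (n := 1)).comp (contDiff_const.sub contDiff_id))
      (((φ k).hasCompactSupport_normed (μ := volume)).comp_homeomorph (Homeomorph.subLeft x))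
      (by
        have hsub : tsupport (fun t => (φ k).normed volume (x - t)) ⊆
            closedBall x (φ k).rOut := by
          refine closure_minimal (fun t ht => ?_) isClosed_closedBall
          have ht' : x - t ∈ Function.support ((φ k).normed volume) := ht
          rw [(φ k).support_normed_eq, mem_ball_zero_iff] at ht'
          rw [mem_closedBall, dist_comm, dist_eq_norm]
          exact ht'.le
        refine hsub.trans fun t ht => ?_
        rw [mem_ball_zero_iff] at hx ⊢
        rw [mem_closedBall, dist_eq_norm] at ht
        have : ‖t‖ ≤ ‖t - x‖ + ‖x‖ := by simpa using norm_add_le (t - x) x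
        linarith) j
    have h3 : ∀ t, fderiv ℝ (fun t => (φ k).normed volume (x - t)) t v
        = - fderiv ℝ ((φ k).normed volume) (x - t) v := by
      intro t
      have hd : HasFDerivAt (fun t => (φ k).normed volume (x - t))
          ((fderiv ℝ ((φ k).normed volume) (x - t)).comp (-ContinuousLinearMap.id ℝ (E N))) t :=
        (((φ k).contDiff_normed (μ := volume) (n := 1)).differentiable one_ne_zero
          (x - t)).hasFDerivAt.comp t ((hasFDerivAt_id t).const_sub x)
      rw [hd.fderiv]
      simp
    simp only [h3, mul_neg, integral_neg, neg_eq_zero] at h2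
    rw [show ((0 : E N →L[ℝ] ℝ) : E N →ₗ[ℝ] ℝ) v = 0 from rfl, ← h2]
    refine integral_congr_ae (Eventually.of_forall fun t => ?_)
    simp [ContinuousLinearMap.precompL, mul_comm]
  have hconst : ∀ k, ∀ x ∈ ball (0 : E N) (R - (φ k).rOut), ∀ y ∈ ball (0 : E N) (R - (φ k).rOut),
      g k x = g k y := by
    intro k x hx y hy
    have := (convex_ball (0 : E N) (R - (φ k).rOut)).is_const_of_fderivWithin_eq_zero (𝕜 := ℝ)
      (f := g k) (fun z hz => (hderiv k z hz).hasFDerivWithinAt.differentiableWithinAt)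
      (fun z hz => (hderiv k z hz).hasFDerivWithinAt.fderivWithin
        (isOpen_ball.uniqueDiffWithinAt hz)) hx hy
    exact this
  by_cases hex : ∃ y ∈ ball (0 : E N) R, Tendsto (fun k => g k y) atTop (𝓝 (θ y))
  · obtain ⟨y, hy, hylim⟩ := hex
    refine ⟨θ y, hlim.mono fun x hxlim hx => ?_⟩
    refine tendsto_nhds_unique hxlim (hylim.congr' ?_)
    rw [mem_ball_zero_iff] at hx hy
    have h1 : ∀ᶠ k in atTop, (φ k).rOut < min (R - ‖x‖) (R - ‖y‖) :=
      hφout.eventually_lt_const (lt_min (by linarith) (by linarith))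
    refine h1.mono fun k hk => hconst k y ?_ x ?_
    · rw [mem_ball_zero_iff]; linarith [min_le_right (R - ‖x‖) (R - ‖y‖)]
    · rw [mem_ball_zero_iff]; linarith [min_le_left (R - ‖x‖) (R - ‖y‖)]
  -- Convergence holds a.e., so if it fails throughout the ball then the ball is null and any
  -- constant will do.
  · push Not at hex
    exact ⟨0, hlim.mono fun x hxlim hx => absurd hxlim (hex x hx)⟩

/-! ### Jacobians and derivatives within measurable sets -/

/-- The Jacobian determinant in the definition of `euclideanCurrent`. -/
noncomputable def jacobian (π : Fin N → E N → ℝ) (x : E N) : ℝ :=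
  (Matrix.of fun i j : Fin N => fderiv ℝ (π i) x (EuclideanSpace.single j 1)).det

theorem euclideanCurrent_eq (θ f : E N → ℝ) (π : Fin N → E N → ℝ) :
    euclideanCurrent θ f π = ∫ x, θ x * f x * jacobian π x := rfl

theorem fderiv_coord (i : Fin N) (x v : E N) : fderiv ℝ (fun y : E N => y i) x v = v i := by
  have : HasFDerivAt (fun y : E N => y i) (EuclideanSpace.proj i : E N →L[ℝ] ℝ) x :=
    (EuclideanSpace.proj i : E N →L[ℝ] ℝ).hasFDerivAt
  rw [this.fderiv]; rfl

theorem jacobian_coord (x : E N) : jacobian (fun i (y : E N) => y i) x = 1 := by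
  unfold jacobian
  have e : (Matrix.of fun i j : Fin N => fderiv ℝ (fun y : E N => y i) x
      (EuclideanSpace.single j 1)) = 1 := by
    ext i j
    rw [Matrix.of_apply, fderiv_coord, Matrix.one_apply, PiLp.single_apply]
  rw [e, Matrix.det_one]

theorem jacobian_eq_det {G : E N → E N} {x : E N} (hG : DifferentiableAt ℝ G x) :
    jacobian (fun i y => G y i) x = (fderiv ℝ G x).det := by
  unfold jacobian
  rw [ContinuousLinearMap.det,
    ← LinearMap.det_toMatrix (EuclideanSpace.basisFun (Fin N) ℝ).toBasis]
  congr 1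
  ext i j
  rw [Matrix.of_apply, LinearMap.toMatrix_apply]
  have : HasFDerivAt (fun y => G y i) ((EuclideanSpace.proj i : E N →L[ℝ] ℝ).comp (fderiv ℝ G x)) x :=
    (EuclideanSpace.proj i : E N →L[ℝ] ℝ).hasFDerivAt.comp x hG.hasFDerivAt
  rw [this.fderiv]
  simp

/-- Apart from `φ`, the entries are all coordinates except the `j`-th. Up to exchanging rows `0` and
`j`, the matrix is the identity with row `j` replaced by the gradient of `φ`. These are the entries
through which `∂T = 0` sees the `j`-th partial derivative of the density. -/
theorem jacobian_cons_swap {n : ℕ} (φ : E (n + 1) → ℝ) (j : Fin (n + 1)) (x : E (n + 1)) :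
    jacobian (Fin.cons φ (fun k (y : E (n + 1)) => y (Equiv.swap 0 j k.succ))) x
      = ((Equiv.Perm.sign (Equiv.swap 0 j) : ℤ) : ℝ)
        * fderiv ℝ φ x (EuclideanSpace.single j 1) := by
  unfold jacobian
  have e : (Matrix.of fun i l : Fin (n + 1) => fderiv ℝ ((Fin.cons φ
      (fun k (y : E (n + 1)) => y (Equiv.swap 0 j k.succ)) : Fin (n + 1) → E (n + 1) → ℝ) i) x
        (EuclideanSpace.single l 1))
      = ((1 : Matrix (Fin (n + 1)) (Fin (n + 1)) ℝ).updateRow j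
        (fun l => fderiv ℝ φ x (EuclideanSpace.single l 1))).submatrix (Equiv.swap 0 j) id := by
    ext i l
    rw [Matrix.of_apply, Matrix.submatrix_apply, Matrix.updateRow_apply]
    refine Fin.cases ?_ (fun k => ?_) i
    · simp
    · have hne : Equiv.swap 0 j k.succ ≠ j := by
        intro h
        have := (Equiv.swap 0 j).injective (h.trans (Equiv.swap_apply_left 0 j).symm)
        exact Fin.succ_ne_zero k this
      rw [if_neg hne, Fin.cons_succ, fderiv_coord, Matrix.one_apply, PiLp.single_apply]
      rfl
  rw [e, Matrix.det_permute, ← Matrix.cramer_transpose_apply]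
  simp

theorem measurable_jacobian (π : Fin N → E N → ℝ) : Measurable (jacobian π) := by
  unfold jacobian
  simp only [Matrix.det_apply, Matrix.of_apply]
  refine Finset.measurable_sum _ fun σ _ => Measurable.const_smul ?_ _
  exact Finset.measurable_prod _ fun i _ => measurable_fderiv_apply_const ℝ _ _

theorem exists_abs_jacobian_le {π : Fin N → E N → ℝ} (hπ : ∀ j, ∃ L : ℝ≥0, LipschitzWith L (π j)) :
    ∃ M : ℝ, ∀ x, |jacobian π x| ≤ M := by
  choose L hL using hπ
  refine ⟨_, fun x => Matrix.det_le (abv := IsAbsoluteValue.toAbsoluteValue (abs : ℝ → ℝ))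
    (x := ∑ j, (L j : ℝ)) fun i j => ?_⟩
  show |fderiv ℝ (π i) x (EuclideanSpace.single j 1)| ≤ _
  refine ((fderiv ℝ (π i) x).le_opNorm _).trans ?_
  have h1 : ‖fderiv ℝ (π i) x‖ ≤ L i := norm_fderiv_le_of_lipschitz ℝ (hL i)
  have h2 : (L i : ℝ) ≤ ∑ j, (L j : ℝ) :=
    Finset.single_le_sum (f := fun j => (L j : ℝ)) (fun k _ => (L k).2) (Finset.mem_univ i)
  have h3 : ‖(EuclideanSpace.single j 1 : E N)‖ = 1 := by simp
  rw [h3, mul_one]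
  exact h1.trans h2

/-- Two derivatives within a measurable set agree almost everywhere on it. -/
theorem ae_eq_of_hasFDerivWithinAt {s : Set (E N)} (hs : MeasurableSet s) {g : E N → E N}
    {A B : E N → E N →L[ℝ] E N} (hA : ∀ x ∈ s, HasFDerivWithinAt g (A x) s x)
    (hB : ∀ x ∈ s, HasFDerivWithinAt g (B x) s x) : ∀ᵐ x, x ∈ s → A x = B x := by
  -- `A x - B x` is a derivative within `s` of the zero function, which is approximated by the zero
  -- map with constant `0`; hence the difference has norm at most `0` a.e. on `s`.
  have h0 : ApproximatesLinearOn (fun _ : E N => (0 : E N)) (0 : E N →L[ℝ] E N) s 0 := by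
    intro x _ y _; simp
  have h1 := h0.norm_fderiv_sub_le volume hs (fun x => A x - B x) fun x hx => by
    have := (hA x hx).sub (hB x hx)
    rwa [sub_self] at this
  rw [ae_restrict_iff' hs] at h1
  filter_upwards [h1] with x hx hxs
  have := hx hxs
  simpa [sub_eq_zero] using this

/-- Otherwise inner regularity gives a compact subset of `{g > 0}` of positive measure, on which the
integral is positive. A measurable representative of `g` makes that set measurable. -/
theorem ae_nonpos_of_setIntegral_isCompact_eq_zero {g : E N → ℝ} {Q : Set (E N)}
    (hQ : MeasurableSet Q) (hg : IntegrableOn g Q)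
    (h : ∀ K ⊆ Q, IsCompact K → ∫ x in K, g x = 0) : ∀ᵐ x, x ∈ Q → g x ≤ 0 := by
  set g' := hg.aestronglyMeasurable.mk g with hg'
  have hgg : ∀ᵐ x, x ∈ Q → g x = g' x :=
    (ae_restrict_iff' hQ).1 hg.aestronglyMeasurable.ae_eq_mk
  set A : Set (E N) := Q ∩ {x | 0 < g' x} with hA
  have hAm : MeasurableSet A :=
    hQ.inter (measurableSet_lt measurable_const hg.aestronglyMeasurable.stronglyMeasurable_mk.measurable)
  have hA0 : volume A = 0 := by
    by_contra hne
    obtain ⟨K, hKA, hKc, hKpos⟩ := hAm.exists_lt_isCompact (pos_iff_ne_zero.2 hne)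
    have hKQ : K ⊆ Q := hKA.trans inter_subset_left
    have h1 := h K hKQ hKc
    have h2 : 0 ≤ᵐ[volume.restrict K] g := by
      rw [EventuallyLE, ae_restrict_iff' hKc.measurableSet]
      filter_upwards [hgg] with x hx hxK
      rw [hx (hKQ hxK)]
      exact (hKA hxK).2.le
    have h3 := (setIntegral_pos_iff_support_of_nonneg_ae h2 (hg.mono_set hKQ)).2 (by
      refine hKpos.trans_le (measure_mono_ae ?_)
      filter_upwards [hgg] with x hx hxK
      refine ⟨?_, hxK⟩
      rw [Function.mem_support, hx (hKQ hxK)]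
      exact (hKA hxK).2.ne')
    exact h3.ne' h1
  have hA0' : ∀ᵐ x, x ∉ A := measure_eq_zero_iff_ae_notMem.1 hA0
  filter_upwards [hgg, hA0'] with x hx hxA hxQ
  rw [hx hxQ]
  exact not_lt.1 fun hpos => hxA ⟨hxQ, hpos⟩

theorem ae_eq_zero_of_setIntegral_isCompact_eq_zero {g : E N → ℝ} {Q : Set (E N)}
    (hQ : MeasurableSet Q) (hg : IntegrableOn g Q)
    (h : ∀ K ⊆ Q, IsCompact K → ∫ x in K, g x = 0) : ∀ᵐ x, x ∈ Q → g x = 0 := by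
  have h1 := ae_nonpos_of_setIntegral_isCompact_eq_zero hQ hg h
  have h2 := ae_nonpos_of_setIntegral_isCompact_eq_zero hQ hg.neg fun K hK hKc => by
    simpa [integral_neg] using h K hK hKc
  filter_upwards [h1, h2] with x hx1 hx2 hxQ
  exact le_antisymm (hx1 hxQ) (neg_nonpos.1 (hx2 hxQ))

end Euclid

/-! ## Cutoff functions, Lipschitz images of null sets -/

section Aux

/-- Thickened indicators of `K` whose widths shrink to `0`, starting below the width at which the
closed thickening still lies in `U`. They approximate the indicator of `K` by test functions under a
common bound and support. -/
theorem exists_cutoff_seq {Y : Type*} [MetricSpace Y] {K U : Set Y} (hK : IsCompact K)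
    (hU : IsOpen U) (hKU : K ⊆ U) :
    ∃ (σ : ℕ → LipBs Y) (S : Set Y), IsBounded S ∧ (∀ k x, 0 ≤ (σ k : Y → ℝ) x) ∧
      (∀ k x, (σ k : Y → ℝ) x ≤ 1) ∧ (∀ k, ∀ x ∈ K, (σ k : Y → ℝ) x = 1) ∧
      (∀ k, tsupport (σ k : Y → ℝ) ⊆ U) ∧ (∀ k, Function.support (σ k : Y → ℝ) ⊆ S) ∧
      ∀ x, Tendsto (fun k => (σ k : Y → ℝ) x) atTop (𝓝 (K.indicator (fun _ => 1) x)) := by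
  obtain ⟨δ₀, hδ₀, hδU⟩ := hK.exists_cthickening_subset_open hU hKU
  set η : ℕ → ℝ := fun k => δ₀ / ((k : ℝ) + 1) with hη
  have hηpos : ∀ k, 0 < η k := fun k => by simp only [hη]; positivity
  have hηle : ∀ k, η k ≤ δ₀ := fun k => div_le_self hδ₀.le (by
    have : (0 : ℝ) ≤ k := Nat.cast_nonneg k
    linarith)
  have hηlim : Tendsto η atTop (𝓝 0) := by
    have := (tendsto_one_div_add_atTop_nhds_zero_nat (𝕜 := ℝ)).const_mul δ₀
    simpa [hη, div_eq_mul_inv] using this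
  have hsup : ∀ k, Function.support (fun x => (thickenedIndicator (hηpos k) K x : ℝ)) ⊆
      cthickening δ₀ K := by
    intro k x hx
    by_contra hx'
    refine hx ?_
    show ((thickenedIndicator (hηpos k) K x : ℝ≥0) : ℝ) = 0
    rw [thickenedIndicator_zero (hηpos k) K fun h =>
      hx' (thickening_subset_cthickening_of_le (hηle k) K h)]
    rfl
  have hb : IsBounded (cthickening δ₀ K) := hK.isBounded.cthickening
  refine ⟨fun k => ⟨fun x => (thickenedIndicator (hηpos k) K x : ℝ),
    ⟨_, LipschitzWith.of_dist_le_mul (lipschitzWith_thickenedIndicator (hηpos k) K).dist_le_mul⟩,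
    hb.subset (hsup k)⟩, cthickening δ₀ K, hb, fun k x => NNReal.coe_nonneg _, fun k x => ?_,
    fun k x hx => ?_, fun k => ?_, hsup, fun x => ?_⟩
  · exact_mod_cast thickenedIndicator_le_one (hηpos k) K x
  · show ((thickenedIndicator (hηpos k) K x : ℝ≥0) : ℝ) = 1
    rw [thickenedIndicator_one (hηpos k) K hx]; rfl
  · exact (closure_minimal (hsup k) isClosed_cthickening).trans hδU
  · have h1 := thickenedIndicator_tendsto_indicator_closure hηpos hηlim K
    rw [tendsto_pi_nhds] at h1
    have h2 := (NNReal.continuous_coe.tendsto _).comp (h1 x)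
    rw [hK.isClosed.closure_eq] at h2
    have e : K.indicator (fun _ => (1 : ℝ)) x = ((K.indicator (fun _ => (1 : ℝ≥0)) x : ℝ≥0) : ℝ) := by
      by_cases hx : x ∈ K <;> simp [hx]
    rw [e]
    exact h2

theorem exists_cutoff {Y : Type*} [MetricSpace Y] {K U : Set Y} (hK : IsCompact K)
    (hU : IsOpen U) (hKU : K ⊆ U) :
    ∃ σ : LipBs Y, (∀ x, 0 ≤ (σ : Y → ℝ) x) ∧ (∀ x, (σ : Y → ℝ) x ≤ 1) ∧
      (∀ x ∈ K, (σ : Y → ℝ) x = 1) ∧ tsupport (σ : Y → ℝ) ⊆ U := by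
  obtain ⟨σ, S, -, h1, h2, h3, h4, -, -⟩ := exists_cutoff_seq hK hU hKU
  exact ⟨σ 0, h1 0, h2 0, h3 0, h4 0⟩

/-- A Lipschitz function on `C` factors through any map that is bi-Lipschitz on `C`. -/
theorem exists_lipschitz_factor {X Y : Type*} [MetricSpace X] [MetricSpace Y] {Ψ : X → Y}
    {C : Set X} (hΨ : BiLipschitzOn Ψ C) {g : X → ℝ} {L : ℝ≥0} (hg : LipschitzWith L g) :
    ∃ g' : Y → ℝ, (∃ L' : ℝ≥0, LipschitzWith L' g') ∧ ∀ x ∈ C, g' (Ψ x) = g x := by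
  obtain ⟨K, hK⟩ := hΨ
  rcases C.eq_empty_or_nonempty with rfl | ⟨x₀, hx₀⟩
  · exact ⟨fun _ => 0, ⟨0, LipschitzWith.const 0⟩, by simp⟩
  have : Nonempty X := ⟨x₀⟩
  have hinj : InjOn Ψ C := fun x hx y hy h => by
    have := (hK x hx y hy).2
    rw [h, dist_self, mul_zero] at this
    exact dist_le_zero.1 this
  have h1 : LipschitzOnWith (L * K.toNNReal) (g ∘ Function.invFunOn Ψ C) (Ψ '' C) := by
    refine LipschitzOnWith.of_dist_le_mul ?_
    rintro _ ⟨x, hx, rfl⟩ _ ⟨y, hy, rfl⟩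
    rw [Function.comp_apply, Function.comp_apply, hinj.leftInvOn_invFunOn hx,
      hinj.leftInvOn_invFunOn hy]
    refine (hg.dist_le_mul x y).trans ?_
    push_cast
    rw [mul_assoc]
    refine mul_le_mul_of_nonneg_left ((hK x hx y hy).2.trans ?_) L.2
    exact mul_le_mul_of_nonneg_right (Real.le_coe_toNNReal K) dist_nonneg
  obtain ⟨g', hg', heq⟩ := h1.extend_real
  refine ⟨g', ⟨_, hg'⟩, fun x hx => ?_⟩
  rw [← heq (mem_image_of_mem _ hx), Function.comp_apply, hinj.leftInvOn_invFunOn hx]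

theorem BiLipschitzOn.lipschitzOnWith {X Y : Type*} [MetricSpace X] [MetricSpace Y] {f : X → Y}
    {s : Set X} (h : BiLipschitzOn f s) :
    ∃ K : ℝ≥0, LipschitzOnWith K f s := by
  obtain ⟨C, hC⟩ := h
  refine ⟨C.toNNReal, LipschitzOnWith.of_dist_le_mul fun x hx y hy => (hC x hx y hy).1.trans ?_⟩
  exact mul_le_mul_of_nonneg_right (Real.le_coe_toNNReal C) dist_nonneg

variable {X Y : Type*} [MetricSpace X] [MeasurableSpace X] [BorelSpace X] [MetricSpace Y]
  [MeasurableSpace Y] [BorelSpace Y]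

theorem euclideanHausdorffMeasure_image_le {K : ℝ≥0} {f : X → Y} {s : Set X}
    (h : LipschitzOnWith K f s) (N : ℕ) : μHE[N] (f '' s) ≤ (K : ℝ≥0∞) ^ N * μHE[N] s := by
  have h1 := h.hausdorffMeasure_image_le (d := N) (Nat.cast_nonneg N)
  rw [Measure.euclideanHausdorffMeasure_def, Measure.euclideanHausdorffMeasure_def,
    Measure.smul_apply, Measure.smul_apply, ENNReal.smul_def, ENNReal.smul_def, smul_eq_mul,
    smul_eq_mul, mul_left_comm]
  rw [ENNReal.rpow_natCast] at h1
  gcongr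

theorem euclideanHausdorffMeasure_image_eq_zero {K : ℝ≥0} {f : X → Y} {s : Set X}
    (h : LipschitzOnWith K f s) {N : ℕ} (hs : μHE[N] s = 0) : μHE[N] (f '' s) = 0 := by
  have := euclideanHausdorffMeasure_image_le h N
  rw [hs, mul_zero] at this
  exact le_antisymm this zero_le

theorem BiLipschitzOn.mono {f : X → Y} {s t : Set X} (h : BiLipschitzOn f s) (hts : t ⊆ s) :
    BiLipschitzOn f t :=
  h.imp fun _ hC x hx y hy => hC x (hts hx) y (hts hy)

theorem BiLipschitzOn.injOn {f : X → Y} {s : Set X} (h : BiLipschitzOn f s) : InjOn f s := by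
  obtain ⟨C, hC⟩ := h
  intro x hx y hy hxy
  have := (hC x hx y hy).2
  rw [hxy, dist_self, mul_zero] at this
  exact dist_le_zero.1 this

/-- The inverse of `f` on `f '' t` is Lipschitz and so preserves null sets. This carries null sets
in `ℝ^N` back to `X`. -/
theorem BiLipschitzOn.measure_eq_zero {f : X → Y} {s : Set X} (h : BiLipschitzOn f s) {N : ℕ}
    {t : Set X} (hts : t ⊆ s) (h0 : μHE[N] (f '' t) = 0) : μHE[N] t = 0 := by
  rcases t.eq_empty_or_nonempty with rfl | ⟨x₀, hx₀⟩
  · simp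
  have : Nonempty X := ⟨x₀⟩
  have hinj := h.injOn.mono hts
  obtain ⟨C, hC⟩ := h
  have h1 : LipschitzOnWith C.toNNReal (Function.invFunOn f t) (f '' t) := by
    refine LipschitzOnWith.of_dist_le_mul ?_
    rintro _ ⟨x, hx, rfl⟩ _ ⟨y, hy, rfl⟩
    rw [hinj.leftInvOn_invFunOn hx, hinj.leftInvOn_invFunOn hy]
    refine (hC x (hts hx) y (hts hy)).2.trans ?_
    exact mul_le_mul_of_nonneg_right (Real.le_coe_toNNReal C) dist_nonneg
  have h2 := euclideanHausdorffMeasure_image_eq_zero h1 h0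
  rwa [hinj.invFunOn_image Subset.rfl] at h2

end Aux

/-! ## Regular charts -/

section Charts

variable {X : Type*} [MetricSpace X] [MeasurableSpace X] [BorelSpace X] {N : ℕ}

theorem IsRegularChart.congr {p : X} {ε r : ℝ} {u Ψ : X → E N} (h : IsRegularChart N p ε r u)
    (heq : EqOn Ψ u (ball p r)) : IsRegularChart N p ε r Ψ where
  isEmbedding := by
    have : (ball p r).domRestrict Ψ = (ball p r).domRestrict u := funext fun x => heq x.2
    rw [this]; exact h.isEmbedding
  lipschitz x hx y hy := by rw [heq hx, heq hy]; exact h.lipschitz x hx y hy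
  image := by rw [heq.image_eq]; exact h.image
  volume_ge := h.volume_ge
  volume_le := h.volume_le
  pieces := by
    obtain ⟨U, h1, h2, h3, h4, h5⟩ := h.pieces
    refine ⟨U, h1, h2, h3, h4, fun i => ?_⟩
    obtain ⟨C, hC⟩ := h5 i
    refine ⟨C, fun x hx y hy => ?_⟩
    rw [heq (h3 i hx), heq (h3 i hy)]
    exact hC x hx y hy

/-- A regular chart on `ball p r` that is globally defined with Lipschitz coordinates. -/
structure IsGlobalChart (N : ℕ) (p : X) (ε r : ℝ) (Ψ : X → E N) : Prop where
  chart : IsRegularChart N p ε r Ψ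
  lip : ∀ j, LipschitzWith (1 + ε).toNNReal (fun x => Ψ x j)
  ε_pos : 0 < ε
  ε_lt : ε < 1 / 5
  r_pos : 0 < r

/-- The part of the domain of a regular chart that is mapped to the ball in its image. -/
def chartDom (p : X) (ε r : ℝ) (Ψ : X → E N) : Set X :=
  ball p r ∩ Ψ ⁻¹' ball 0 ((1 - 2 * ε) * r)

/-- McShane extension, coordinate by coordinate. Push-forwards need a map defined on all of `X`, and
extending the coordinates separately keeps the constant `1 + ε` for each of them, which is the
constant that enters the mass inequality. -/
theorem IsRegularChart.exists_global {p : X} {ε r : ℝ} {u : X → E N}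
    (h : IsRegularChart N p ε r u) (hε : 0 < ε) (hε' : ε < 1 / 5) (hr : 0 < r) :
    ∃ Ψ : X → E N, EqOn Ψ u (ball p r) ∧ IsGlobalChart N p ε r Ψ := by
  have h1 : ∀ j, ∃ g : X → ℝ, LipschitzWith (1 + ε).toNNReal g ∧
      EqOn (fun x => u x j) g (ball p r) := by
    intro j
    refine LipschitzOnWith.extend_real (LipschitzOnWith.of_dist_le_mul fun x hx y hy => ?_)
    refine le_trans ?_ ((h.lipschitz x hx y hy).trans ?_)
    · rw [dist_eq_norm, dist_eq_norm, ← PiLp.sub_apply]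
      exact PiLp.norm_apply_le _ _
    · exact mul_le_mul_of_nonneg_right (Real.le_coe_toNNReal _) dist_nonneg
  choose g hg hgu using h1
  have heq : EqOn (fun x => WithLp.toLp 2 fun j => g j x) u (ball p r) := fun x hx => by
    ext j
    exact (hgu j hx).symm
  exact ⟨_, heq, h.congr heq, hg, hε, hε', hr⟩

namespace IsGlobalChart

variable {p : X} {ε r : ℝ} {Ψ : X → E N}

theorem lipschitz (h : IsGlobalChart N p ε r Ψ) : ∃ C : ℝ≥0, LipschitzWith C Ψ := by
  have h1 : LipschitzWith (1 + ε).toNNReal (fun x => (Ψ x).ofLp) :=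
    LipschitzWith.of_dist_le_mul fun x y =>
      (dist_pi_le_iff (by positivity)).2 fun j => (h.lip j).dist_le_mul x y
  exact ⟨_, (PiLp.lipschitzWith_toLp 2 (fun _ : Fin N => ℝ)).comp h1⟩

theorem continuous (h : IsGlobalChart N p ε r Ψ) : Continuous Ψ :=
  h.lipschitz.choose_spec.continuous

theorem injOn (h : IsGlobalChart N p ε r Ψ) : InjOn Ψ (ball p r) := fun x hx y hy hxy => by
  have := h.chart.isEmbedding.injective (a₁ := ⟨x, hx⟩) (a₂ := ⟨y, hy⟩) hxy
  exact congrArg Subtype.val this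

theorem isOpen_chartDom (h : IsGlobalChart N p ε r Ψ) : IsOpen (chartDom p ε r Ψ) :=
  isOpen_ball.inter (isOpen_ball.preimage h.continuous)

theorem radius_pos (h : IsGlobalChart N p ε r Ψ) : 0 < (1 - 2 * ε) * r :=
  mul_pos (by linarith [h.ε_lt]) h.r_pos

/-- The inverse image of a compact subset of the model ball is compact. -/
theorem isCompact_preimage (h : IsGlobalChart N p ε r Ψ) {K : Set (E N)} (hK : IsCompact K)
    (hKB : K ⊆ ball 0 ((1 - 2 * ε) * r)) : IsCompact (ball p r ∩ Ψ ⁻¹' K) := by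
  have h1 : IsCompact ((ball p r).domRestrict Ψ ⁻¹' K) := by
    refine (h.chart.isEmbedding.isInducing.isCompact_preimage_iff ?_).2 hK
    rw [range_domRestrict]
    exact hKB.trans h.chart.image
  have h2 := h1.image continuous_subtype_val
  convert h2 using 1
  ext x
  constructor
  · rintro ⟨hx, hxK⟩
    exact ⟨⟨x, hx⟩, hxK, rfl⟩
  · rintro ⟨y, hy, rfl⟩
    exact ⟨y.2, hy⟩

/-- The embedding makes the image relatively open in `Ψ '' ball p r`, and that set contains the open
model ball; invariance of domain is not needed. -/
theorem isOpen_image (h : IsGlobalChart N p ε r Ψ) {W : Set X} (hW : IsOpen W)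
    (hWV : W ⊆ chartDom p ε r Ψ) : IsOpen (Ψ '' W) := by
  have h1 : IsOpen ((Subtype.val : ball p r → X) ⁻¹' W) := hW.preimage continuous_subtype_val
  obtain ⟨O, hO, hOW⟩ := h.chart.isEmbedding.isInducing.isOpen_iff.1 h1
  have : Ψ '' W = O ∩ ball 0 ((1 - 2 * ε) * r) := by
    ext y
    constructor
    · rintro ⟨x, hx, rfl⟩
      refine ⟨?_, (hWV hx).2⟩
      have : (⟨x, (hWV hx).1⟩ : ball p r) ∈ (Subtype.val : ball p r → X) ⁻¹' W := hx
      rw [← hOW] at this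
      exact this
    · rintro ⟨hyO, hyB⟩
      obtain ⟨x, hx, rfl⟩ := h.chart.image hyB
      refine ⟨x, ?_, rfl⟩
      have : (⟨x, hx⟩ : ball p r) ∈ (ball p r).domRestrict Ψ ⁻¹' O := hyO
      rw [hOW] at this
      exact this
  rw [this]
  exact hO.inter isOpen_ball

/-- The chart is not normalised by `Ψ p = 0`. Every point of the closed model ball has distance at
most `(1 + ε) r` from `Ψ p`; applied to the boundary point opposite to `Ψ p`, this gives `‖Ψ p‖ ≤ 3
ε r`, which is below `(1 - 2 ε) r` exactly because `ε < 1/5`. -/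
theorem mem_chartDom (h : IsGlobalChart N p ε r Ψ) : p ∈ chartDom p ε r Ψ := by
  refine ⟨mem_ball_self h.r_pos, ?_⟩
  have hr := h.r_pos
  have hR := h.radius_pos
  -- points of the model ball are within `(1 + ε) r` of `Ψ p`
  have hclose : ∀ y ∈ ball (0 : E N) ((1 - 2 * ε) * r), dist y (Ψ p) ≤ (1 + ε) * r := by
    intro y hy
    obtain ⟨x, hx, rfl⟩ := h.chart.image hy
    refine (h.chart.lipschitz x hx p (mem_ball_self hr)).trans ?_
    have : dist x p < r := hx
    have := h.ε_pos
    gcongr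
  have hnorm : ‖Ψ p‖ ≤ 3 * ε * r := by
    rcases eq_or_ne (Ψ p) 0 with h0 | h0
    · rw [h0, norm_zero]
      have := h.ε_pos
      positivity
    have hpos : 0 < ‖Ψ p‖ := norm_pos_iff.2 h0
    have hcl : closedBall (0 : E N) ((1 - 2 * ε) * r) ⊆ {y | dist y (Ψ p) ≤ (1 + ε) * r} := by
      rw [← closure_ball _ hR.ne']
      exact closure_minimal hclose (isClosed_le (continuous_id.dist continuous_const)
        continuous_const)
    have hmem : -((1 - 2 * ε) * r / ‖Ψ p‖) • Ψ p ∈ closedBall (0 : E N) ((1 - 2 * ε) * r) := by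
      rw [mem_closedBall_zero_iff, norm_smul, norm_neg, Real.norm_of_nonneg (by positivity),
        div_mul_cancel₀ _ hpos.ne']
    have h1 : dist (-((1 - 2 * ε) * r / ‖Ψ p‖) • Ψ p) (Ψ p) ≤ (1 + ε) * r := hcl hmem
    have e : -((1 - 2 * ε) * r / ‖Ψ p‖) • Ψ p - Ψ p = -(((1 - 2 * ε) * r / ‖Ψ p‖ + 1) • Ψ p) := by
      module
    rw [dist_eq_norm, e, norm_neg, norm_smul, Real.norm_of_nonneg (by positivity), add_mul,
      div_mul_cancel₀ _ hpos.ne'] at h1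
    linarith
  rw [mem_preimage, mem_ball_zero_iff]
  refine hnorm.trans_lt ?_
  have := h.ε_lt
  gcongr
  linarith

end IsGlobalChart

end Charts

/-! ## The degree of a current in a regular chart -/

section Degree

variable {X : Type*} [MetricSpace X] [MeasurableSpace X] [BorelSpace X] {N : ℕ}
  {p : X} {ε r : ℝ} {Ψ : X → E N}

/-- Pull-back of a test function in the model ball, extended by zero. -/
theorem IsGlobalChart.exists_pullback (h : IsGlobalChart N p ε r Ψ) (g : LipBs (E N))
    (hg : tsupport (g : E N → ℝ) ⊆ ball 0 ((1 - 2 * ε) * r)) :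
    ∃ F : LipBs X, (F : X → ℝ) = (ball p r).indicator ((g : E N → ℝ) ∘ Ψ) ∧
      tsupport (F : X → ℝ) ⊆ ball p r ∩ Ψ ⁻¹' tsupport (g : E N → ℝ) := by
  set S : Set X := ball p r ∩ Ψ ⁻¹' tsupport (g : E N → ℝ) with hS
  have hSc : IsCompact S := h.isCompact_preimage
    (isCompact_of_isClosed_isBounded (isClosed_tsupport _) (LipBs.isBounded_tsupport g)) hg
  set F : X → ℝ := (ball p r).indicator ((g : E N → ℝ) ∘ Ψ) with hF
  have hsupp : Function.support F ⊆ S := by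
    intro x hx
    have hxb : x ∈ ball p r := by
      by_contra hxb
      exact hx (indicator_of_notMem hxb _)
    refine ⟨hxb, subset_tsupport _ ?_⟩
    rwa [Function.mem_support, hF, indicator_of_mem hxb] at hx
  have htsupp : tsupport F ⊆ S := closure_minimal hsupp hSc.isClosed
  -- The gap `δ` between the compact support and the complement of the ball makes the extension by
  -- zero Lipschitz: across the boundary the increment is at most `M = (M / δ) * δ`.
  obtain ⟨δ, hδ, hδS⟩ := hSc.exists_thickening_subset_open isOpen_ball
    (inter_subset_left : S ⊆ ball p r)
  obtain ⟨M, hM0, hM⟩ := LipBs.exists_bound g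
  obtain ⟨⟨C, hC⟩, -⟩ := g.2
  obtain ⟨D, hD⟩ := h.lipschitz
  have hFM : ∀ x, |F x| ≤ M := by
    intro x
    by_cases hx : x ∈ ball p r
    · rw [hF, indicator_of_mem hx]; exact hM _
    · rw [hF, indicator_of_notMem hx]; simpa using hM0
  -- the increment between a point of the ball and a point outside of it
  have hout : ∀ x y, x ∈ ball p r → y ∉ ball p r → |F x - F y| ≤ M / δ * dist x y := by
    intro x y hx hy
    have hy0 : F y = 0 := indicator_of_notMem hy _
    rw [hy0, sub_zero]
    by_cases hxS : x ∈ S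
    · have hxy : δ ≤ dist x y := by
        by_contra hlt
        exact hy (hδS (mem_thickening_iff.2 ⟨x, hxS, by rw [dist_comm]; exact not_le.1 hlt⟩))
      calc |F x| ≤ M := hFM x
        _ = M / δ * δ := by field_simp
        _ ≤ M / δ * dist x y := by gcongr
    · have : F x = 0 := by
        by_contra h0
        exact hxS (hsupp h0)
      rw [this, abs_zero]
      positivity
  have hLip : LipschitzWith (C * D + (M / δ).toNNReal) F := by
    refine LipschitzWith.of_dist_le_mul fun x y => ?_
    rw [Real.dist_eq]
    push_cast
    rw [Real.coe_toNNReal _ (by positivity), add_mul]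
    have h1 : 0 ≤ (C : ℝ) * D * dist x y := by positivity
    have h2 : 0 ≤ M / δ * dist x y := by positivity
    by_cases hx : x ∈ ball p r <;> by_cases hy : y ∈ ball p r
    · have h3 := (hC.comp hD).dist_le_mul x y
      rw [Real.dist_eq] at h3
      push_cast at h3
      rw [hF, indicator_of_mem hx, indicator_of_mem hy]
      linarith
    · linarith [hout x y hx hy]
    · have := hout y x hy hx
      rw [abs_sub_comm, dist_comm y x] at this
      linarith
    · rw [hF, indicator_of_notMem hx, indicator_of_notMem hy, sub_zero, abs_zero]
      linarith
  exact ⟨⟨F, ⟨_, hLip⟩, hSc.isBounded.subset hsupp⟩, rfl, htsupp⟩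

/-- The current `T` has degree `c` in the chart `Ψ`: its push-forward under `Ψ` is `c` times the
standard Euclidean current in the model ball. -/
def HasDegree (T : Functional X N) (p : X) (ε r : ℝ) (Ψ : X → E N) (c : ℝ) : Prop :=
  ∀ (hΨ : ∃ C : ℝ≥0, LipschitzWith C Ψ) (g : LipBs (E N)) (F : LipBs X) (π : Fin N → LipLoc (E N)),
    tsupport (g : E N → ℝ) ⊆ ball 0 ((1 - 2 * ε) * r) →
    (F : X → ℝ) = (ball p r).indicator ((g : E N → ℝ) ∘ Ψ) →
    (∀ j, ∃ L : ℝ≥0, LipschitzWith L (π j : E N → ℝ)) →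
    T F (fun j => LipLoc.comp (π j) Ψ hΨ)
      = c * ∫ x, (g : E N → ℝ) x * jacobian (fun j => (π j : E N → ℝ)) x

/-- The coordinate functions of `ℝ^N` as test functions. -/
def coordLoc (j : Fin N) : LipLoc (E N) :=
  ⟨fun y => y j, lipschitzWith_mem_lipLoc (C := 1) (LipschitzWith.of_dist_le_mul fun x y => by
    rw [NNReal.coe_one, one_mul, dist_eq_norm, dist_eq_norm, ← PiLp.sub_apply]
    exact PiLp.norm_apply_le _ _)⟩

theorem coordLoc_apply (j : Fin N) (y : E N) : (coordLoc j : E N → ℝ) y = y j := rfl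

theorem lipschitzWith_coordLoc (j : Fin N) : LipschitzWith 1 (coordLoc j : E N → ℝ) :=
  LipschitzWith.of_dist_le_mul fun x y => by
    rw [NNReal.coe_one, one_mul, dist_eq_norm, dist_eq_norm, coordLoc_apply, coordLoc_apply,
      ← PiLp.sub_apply]
    exact PiLp.norm_apply_le _ _

theorem LipLoc.exists_lipschitzWith_comp {Y : Type*} [MetricSpace Y] {π : LipLoc Y} {Φ : X → Y}
    (hΦ : ∃ C : ℝ≥0, LipschitzWith C Φ) (hπ : ∃ L : ℝ≥0, LipschitzWith L (π : Y → ℝ)) :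
    ∃ L : ℝ≥0, LipschitzWith L (LipLoc.comp π Φ hΦ : X → ℝ) := by
  obtain ⟨C, hC⟩ := hΦ
  obtain ⟨L, hL⟩ := hπ
  exact ⟨_, hL.comp hC⟩

/-- By the constancy theorem a locally integral cycle has a degree in every chart. -/
theorem exists_hasDegree {n : ℕ} {T : Functional X (n + 1)} {μ : Measure X}
    (hT : IsCurrentWithMass T μ) (hrect : IsLocIntegerRectifiable T) (hbd : HasBoundary T 0)
    {Ψ : X → E (n + 1)} (h : IsGlobalChart (n + 1) p ε r Ψ) :
    ∃ c : ℤ, HasDegree T p ε r Ψ c := by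
  obtain ⟨θ, hθint, hΨ, hpush⟩ := hrect.pushforward (ball p r) measurableSet_ball isBounded_ball Ψ
    h.lipschitz
  -- the push-forward of `T` is given by `θ`
  have key : ∀ (g : LipBs (E (n + 1))) (F : LipBs X) (π : Fin (n + 1) → LipLoc (E (n + 1))),
      (F : X → ℝ) = (ball p r).indicator ((g : E (n + 1) → ℝ) ∘ Ψ) →
      (∀ j, ∃ L : ℝ≥0, LipschitzWith L (π j : E (n + 1) → ℝ)) →
      T F (fun j => LipLoc.comp (π j) Ψ hΨ)
        = ∫ x, (θ x : ℝ) * (g : E (n + 1) → ℝ) x * jacobian (fun j => (π j : E (n + 1) → ℝ)) x := by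
    intro g F π hF hπ
    have h1 := hT.limVal_of_hasBorelValue (hpush g π)
    rw [← hF] at h1
    exact hT.limVal_unique (fun j => LipLoc.exists_lipschitzWith_comp hΨ (hπ j))
      (LipBs.continuous F).aestronglyMeasurable (LimVal.self F _) h1
  have hgrad : ∀ φ : E (n + 1) → ℝ, ContDiff ℝ 1 φ → HasCompactSupport φ →
      tsupport φ ⊆ ball 0 ((1 - 2 * ε) * r) →
      ∀ j, ∫ x, (θ x : ℝ) * fderiv ℝ φ x (EuclideanSpace.single j 1) = 0 := by
    intro φ hφ hφc hφs j
    obtain ⟨L, hL⟩ := hφ.lipschitzWith_of_hasCompactSupport hφc one_ne_zero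
    let φ' : LipBs (E (n + 1)) := ⟨φ, ⟨L, hL⟩, hφc.isCompact.isBounded.subset (subset_tsupport φ)⟩
    obtain ⟨σ, -, -, hσ1, hσs⟩ := exists_cutoff hφc.isCompact isOpen_ball hφs
    obtain ⟨Fφ, hFφ, hFφs⟩ := h.exists_pullback φ' hφs
    obtain ⟨Fσ, hFσ, hFσs⟩ := h.exists_pullback σ hσs
    -- All coordinates except the `j`-th, with coordinate `0` filling the place of the `j`-th when
    -- `j ≠ 0`.
    let τ : Fin n → LipLoc (E (n + 1)) := fun k => coordLoc (Equiv.swap 0 j k.succ)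
    have h1 := hbd Fφ (fun k => LipLoc.comp (τ k) Ψ hΨ) Fσ fun x hx => by
      obtain ⟨hxb, hx'⟩ := hFφs hx
      rw [hFσ, indicator_of_mem hxb]
      exact hσ1 _ hx'
    -- `Fφ` and `φ ∘ Ψ` agree only on the ball; this suffices by locality because `Fσ` is supported
    -- there.
    have h2 := hT.current.isMetricFunctional.congr Fσ
      (π := Fin.cons (α := fun _ => LipLoc X) (LipBs.toLipLoc Fφ) fun k => LipLoc.comp (τ k) Ψ hΨ)
      (π' := fun i => LipLoc.comp ((Fin.cons (α := fun _ => LipLoc (E (n + 1)))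
        (LipBs.toLipLoc φ') τ : Fin (n + 1) → LipLoc (E (n + 1))) i) Ψ hΨ)
      (U := ball p r) isOpen_ball
      ((subset_tsupport _).trans (hFσs.trans inter_subset_left)) (by
        intro i x hx
        refine Fin.cases ?_ (fun k => ?_) i
        · show (Fφ : X → ℝ) x = φ (Ψ x)
          rw [hFφ, indicator_of_mem hx]; rfl
        · rfl)
    have hLips : ∀ i, ∃ L : ℝ≥0, LipschitzWith L (((Fin.cons (α := fun _ => LipLoc (E (n + 1)))
        (LipBs.toLipLoc φ') τ : Fin (n + 1) → LipLoc (E (n + 1))) i : E (n + 1) → ℝ)) := by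
      intro i
      refine Fin.cases ⟨L, hL⟩ (fun k => ⟨1, lipschitzWith_coordLoc _⟩) i
    have h3 := key σ Fσ _ hFσ hLips
    rw [← h2, ← h1] at h3
    have hjac : (fun i => (((Fin.cons (α := fun _ => LipLoc (E (n + 1)))
        (LipBs.toLipLoc φ') τ : Fin (n + 1) → LipLoc (E (n + 1))) i : E (n + 1) → ℝ)))
        = Fin.cons φ (fun k (y : E (n + 1)) => y (Equiv.swap 0 j k.succ)) := by
      funext i
      refine Fin.cases ?_ (fun k => ?_) i <;> rfl
    rw [hjac] at h3
    simp only [jacobian_cons_swap] at h3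
    have h4 : ∀ x, (θ x : ℝ) * (σ : E (n + 1) → ℝ) x
        * (((Equiv.Perm.sign (Equiv.swap 0 j) : ℤ) : ℝ) * fderiv ℝ φ x (EuclideanSpace.single j 1))
        = ((Equiv.Perm.sign (Equiv.swap 0 j) : ℤ) : ℝ) *
          ((θ x : ℝ) * fderiv ℝ φ x (EuclideanSpace.single j 1)) := by
      intro x
      by_cases hx : x ∈ tsupport φ
      · rw [hσ1 x hx]; ring
      · have : fderiv ℝ φ x = 0 := by
          by_contra hne
          exact hx (support_fderiv_subset ℝ (Function.mem_support.2 hne))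
        rw [this]; simp
    simp only [h4] at h3
    rw [integral_const_mul] at h3
    change (0 : ℝ) = _ at h3
    have hsgn : ((Equiv.Perm.sign (Equiv.swap 0 j) : ℤ) : ℝ) ≠ 0 := by
      exact_mod_cast Units.ne_zero _
    exact (mul_eq_zero.1 h3.symm).resolve_left hsgn
  obtain ⟨c₀, hc₀⟩ := ae_eq_const_of_integral_mul_fderiv_eq_zero hθint _ hgrad
  -- The constant is attained at a point of the ball, so it is a value of `θ` and hence an integer.
  obtain ⟨y, hyB, hy⟩ : ∃ y ∈ ball (0 : E (n + 1)) ((1 - 2 * ε) * r), (θ y : ℝ) = c₀ := by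
    by_contra hno
    push Not at hno
    have h0 : volume (ball (0 : E (n + 1)) ((1 - 2 * ε) * r)) = 0 :=
      measure_eq_zero_iff_ae_notMem.2 (hc₀.mono fun x hx hxb => hno x hxb (hx hxb))
    exact (measure_ball_pos volume _ h.radius_pos).ne' h0
  refine ⟨θ y, fun hΨ' g F π hg hF hπ => ?_⟩
  rw [key g F π hF hπ, ← integral_const_mul]
  refine integral_congr_ae (hc₀.mono fun x hx => ?_)
  dsimp only
  by_cases hxB : x ∈ ball (0 : E (n + 1)) ((1 - 2 * ε) * r)
  · rw [hx hxB, hy]; ring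
  · rw [image_eq_zero_of_notMem_tsupport fun hxs => hxB (hg hxs)]; ring

/-- The value of a current of degree `c` on a compact subset of the chart domain. -/
theorem HasDegree.limVal_of_isCompact {T : Functional X N} {μ : Measure X}
    (hT : IsCurrentWithMass T μ) (h : IsGlobalChart N p ε r Ψ) {c : ℝ}
    (hdeg : HasDegree T p ε r Ψ c) (hΨ : ∃ C : ℝ≥0, LipschitzWith C Ψ) {C : Set X}
    (hC : IsCompact C) (hCV : C ⊆ chartDom p ε r Ψ) (g : LipBs (E N)) {π : Fin N → LipLoc (E N)}
    (hπ : ∀ j, ∃ L : ℝ≥0, LipschitzWith L (π j : E N → ℝ)) :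
    LimVal T μ (fun j => LipLoc.comp (π j) Ψ hΨ) (C.indicator ((g : E N → ℝ) ∘ Ψ))
      (c * ∫ x in Ψ '' C, (g : E N → ℝ) x * jacobian (fun j => (π j : E N → ℝ)) x) := by
  have hK : IsCompact (Ψ '' C) := hC.image h.continuous
  obtain ⟨σ, S, hS, hσ0, hσ1, hσK, hσU, hσS, hσlim⟩ := exists_cutoff_seq hK isOpen_ball
    (image_subset_iff.2 fun x hx => (hCV hx).2)
  obtain ⟨M, hM0, hM⟩ := LipBs.exists_bound g
  have hσabs : ∀ k x, |(σ k : E N → ℝ) x| ≤ 1 := fun k x => by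
    rw [abs_of_nonneg (hσ0 k x)]; exact hσ1 k x
  let gs : ℕ → LipBs (E N) := fun k =>
    ⟨fun x => (g : E N → ℝ) x * (σ k : E N → ℝ) x, mul_mem_lipBs g (σ k).2.1.choose_spec (hσabs k)⟩
  have hgs : ∀ k x, (gs k : E N → ℝ) x = (g : E N → ℝ) x * (σ k : E N → ℝ) x := fun _ _ => rfl
  have hgsU : ∀ k, tsupport (gs k : E N → ℝ) ⊆ ball 0 ((1 - 2 * ε) * r) := fun k =>
    (closure_mono (Function.support_mul_subset_right _ _)).trans (hσU k)
  choose F hF hFs using fun k => h.exists_pullback (gs k) (hgsU k)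
  have hgsM : ∀ k x, |(gs k : E N → ℝ) x| ≤ M := fun k x => by
    rw [hgs, abs_mul]
    exact (mul_le_of_le_one_right (abs_nonneg _) (hσabs k x)).trans (hM x)
  refine LimVal.of_dominated (g := fun k => (F k : X → ℝ))
    (v := fun k => T (F k) (fun j => LipLoc.comp (π j) Ψ hΨ))
    (fun k => (LipBs.continuous (F k)).aestronglyMeasurable) (fun k => LimVal.self _ _)
    ((ball p r).indicator fun _ => M) ?_ (fun k => Eventually.of_forall fun x => ?_)
    (Eventually.of_forall fun x => ?_) ?_
  · exact (integrable_indicator_iff measurableSet_ball).2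
      (integrableOn_const (hT.measure_lt_top isBounded_ball).ne)
  · rw [hF k]
    by_cases hx : x ∈ ball p r
    · rw [indicator_of_mem hx, indicator_of_mem hx]; exact hgsM k _
    · rw [indicator_of_notMem hx, indicator_of_notMem hx, norm_zero]
  · simp only [hF]
    by_cases hx : x ∈ ball p r
    · simp only [indicator_of_mem hx, Function.comp_apply, hgs]
      have h1 := (hσlim (Ψ x)).const_mul ((g : E N → ℝ) (Ψ x))
      convert h1 using 2
      by_cases hxC : x ∈ C
      · rw [indicator_of_mem hxC, indicator_of_mem (mem_image_of_mem _ hxC), mul_one]; rfl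
      · rw [indicator_of_notMem hxC, indicator_of_notMem, mul_zero]
        rintro ⟨y, hy, hyx⟩
        exact hxC (h.injOn (hCV hy).1 hx hyx ▸ hy)
    · have hxC : x ∉ C := fun hxC => hx (hCV hxC).1
      simp only [indicator_of_notMem hx, indicator_of_notMem hxC]
      exact tendsto_const_nhds
  · simp only [fun k => hdeg hΨ (gs k) (F k) π (hgsU k) (hF k) hπ]
    refine Tendsto.const_mul c ?_
    rw [← integral_indicator hK.measurableSet]
    obtain ⟨J, hJ⟩ := exists_abs_jacobian_le hπ
    have hSm : volume (closure S) ≠ ⊤ := hS.closure.measure_lt_top.ne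
    refine tendsto_integral_of_dominated_convergence ((closure S).indicator fun _ => M * J)
      (fun k => ?_) ?_ (fun k => Eventually.of_forall fun x => ?_)
      (Eventually.of_forall fun x => ?_)
    · exact (LipBs.continuous (gs k)).aestronglyMeasurable.mul
        (measurable_jacobian _).aestronglyMeasurable
    · exact (integrable_indicator_iff isClosed_closure.measurableSet).2 (integrableOn_const hSm)
    · by_cases hx : x ∈ closure S
      · rw [indicator_of_mem hx, norm_mul]
        exact mul_le_mul (hgsM k x) (hJ x) (abs_nonneg _) hM0
      · have : (σ k : E N → ℝ) x = 0 := by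
          by_contra hne
          exact hx (subset_closure (hσS k hne))
        rw [indicator_of_notMem hx, hgs, this]; simp
    · have h1 := ((hσlim x).const_mul ((g : E N → ℝ) x)).mul_const
        (jacobian (fun j => (π j : E N → ℝ)) x)
      simp only [hgs]
      convert h1 using 2
      by_cases hx : x ∈ Ψ '' C
      · rw [indicator_of_mem hx, indicator_of_mem hx, mul_one]
      · rw [indicator_of_notMem hx, indicator_of_notMem hx]; ring

end Degree

/-! ## Bounds for the degree, and reflected charts -/

section DegreeBounds

variable {X : Type*} [MetricSpace X] [MeasurableSpace X] [BorelSpace X] {N : ℕ}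
  {p : X} {ε r : ℝ} {Ψ : X → E N}

/-- The image of `W` is a nonempty open subset of `ℝ^N`, hence of positive volume, and a Lipschitz
map cannot produce it from a null set. -/
theorem IsGlobalChart.measure_pos (h : IsGlobalChart N p ε r Ψ) {W : Set X} (hW : IsOpen W)
    (hWV : W ⊆ chartDom p ε r Ψ) (hne : W.Nonempty) : 0 < (μHE[N] : Measure X) W := by
  obtain ⟨C, hC⟩ := h.lipschitz
  have h1 : 0 < volume (Ψ '' W) := (h.isOpen_image hW hWV).measure_pos _ (hne.image _)
  refine pos_iff_ne_zero.2 fun h0 => h1.ne' ?_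
  rw [← EuclideanSpace.euclideanHausdorffMeasure_eq_volume]
  exact euclideanHausdorffMeasure_image_eq_zero hC.lipschitzOnWith h0

/-- The mass bound for the degree. -/
theorem HasDegree.abs_mul_le {T : Functional X N} (hT : IsCurrentWithMass T μHE[N])
    (h : IsGlobalChart N p ε r Ψ) {c : ℝ} (hdeg : HasDegree T p ε r Ψ c) :
    |c| * (1 - 3 * ε) ^ N ≤ (1 + ε) ^ (N + 1) := by
  have hr := h.r_pos
  have hε := h.ε_pos
  have hε' := h.ε_lt
  -- Strictly inside the model ball, to leave room for a cutoff that equals `1` on the closed ball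
  -- of radius `ρ`.
  set ρ : ℝ := (1 - 3 * ε) * r with hρ
  have hρ0 : 0 < ρ := mul_pos (by linarith) hr
  have hρlt : ρ < (1 - 2 * ε) * r := by rw [hρ]; gcongr; linarith
  obtain ⟨σ, hσ0, hσ1, hσK, hσU⟩ := exists_cutoff (isCompact_closedBall (0 : E N) ρ)
    isOpen_ball (closedBall_subset_ball hρlt)
  obtain ⟨F, hF, -⟩ := h.exists_pullback σ hσU
  have h1 := hdeg h.lipschitz σ F (fun j => coordLoc j) hσU hF fun j =>
    ⟨1, lipschitzWith_coordLoc j⟩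
  have hjac : ∀ x : E N, jacobian (fun j => (coordLoc j : E N → ℝ)) x = 1 := jacobian_coord
  simp only [hjac, mul_one] at h1
  have h2 := hT.abs_apply_le F (fun j => LipLoc.comp (coordLoc j) Ψ h.lipschitz)
    (L := (1 + ε).toNNReal) (by simpa using by linarith) h.lip
  rw [h1, Real.coe_toNNReal _ (by linarith)] at h2
  have hω : 0 < unitBallVolume N := by
    refine ENNReal.toReal_pos (measure_ball_pos _ _ one_pos).ne' measure_ball_lt_top.ne
  have h3 : ∫ x, |(F : X → ℝ) x| ∂μHE[N] ≤ (1 + ε) * unitBallVolume N * r ^ N := by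
    calc ∫ x, |(F : X → ℝ) x| ∂μHE[N] ≤ ∫ x, (ball p r).indicator (fun _ => (1 : ℝ)) x ∂μHE[N] := by
          refine integral_mono (hT.integrable F).abs ((integrable_indicator_iff
            measurableSet_ball).2 (integrableOn_const (hT.measure_lt_top isBounded_ball).ne)) ?_
          intro x
          dsimp only
          rw [hF]
          by_cases hx : x ∈ ball p r
          · rw [indicator_of_mem hx, indicator_of_mem hx, Function.comp_apply,
              abs_of_nonneg (hσ0 _)]
            exact hσ1 _
          · rw [indicator_of_notMem hx, indicator_of_notMem hx, abs_zero]
      _ = (μHE[N] : Measure X).real (ball p r) := by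
          rw [integral_indicator_const _ measurableSet_ball, smul_eq_mul, mul_one]
      _ ≤ _ := ENNReal.toReal_le_of_le_ofReal (by positivity) h.chart.volume_le
  have h4 : unitBallVolume N * ρ ^ N ≤ ∫ x, (σ : E N → ℝ) x := by
    have e : unitBallVolume N * ρ ^ N = ∫ x, (closedBall (0 : E N) ρ).indicator (fun _ => (1 : ℝ)) x := by
      rw [integral_indicator_const _ measurableSet_closedBall, smul_eq_mul, mul_one,
        measureReal_def, Measure.addHaar_closedBall _ _ hρ0.le, ENNReal.toReal_mul,
        ENNReal.toReal_ofReal (by positivity), finrank_euclideanSpace_fin, mul_comm]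
      rfl
    rw [e]
    have hσint : Integrable (σ : E N → ℝ) :=
      (LipBs.continuous σ).integrable_of_hasCompactSupport
        (isCompact_of_isClosed_isBounded (isClosed_tsupport _) (LipBs.isBounded_tsupport σ))
    refine integral_mono ((integrable_indicator_iff measurableSet_closedBall).2
      (integrableOn_const measure_closedBall_lt_top.ne)) hσint fun x => ?_
    by_cases hx : x ∈ closedBall (0 : E N) ρ
    · rw [indicator_of_mem hx, hσK x hx]
    · rw [indicator_of_notMem hx]; exact hσ0 x
  have h5 : |c| * (unitBallVolume N * ρ ^ N) ≤ (1 + ε) ^ N * ((1 + ε) * unitBallVolume N * r ^ N) := by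
    calc |c| * (unitBallVolume N * ρ ^ N) ≤ |c| * ∫ x, (σ : E N → ℝ) x := by gcongr
      _ = |c * ∫ x, (σ : E N → ℝ) x| := by
          rw [abs_mul, abs_of_nonneg (integral_nonneg hσ0)]
      _ ≤ _ := h2.trans (by gcongr)
  rw [hρ, mul_pow] at h5
  have h6 : 0 < unitBallVolume N * r ^ N := by positivity
  refine le_of_mul_le_mul_right ?_ h6
  calc |c| * (1 - 3 * ε) ^ N * (unitBallVolume N * r ^ N)
      = |c| * (unitBallVolume N * ((1 - 3 * ε) ^ N * r ^ N)) := by ring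
    _ ≤ _ := h5
    _ = _ := by ring

/-- At `ε = 0` the inequality is `1 < 2`, so it persists for small `ε`. Combined with the mass bound
for the degree it yields `|c| < 2`. -/
theorem exists_small_accuracy (N : ℕ) :
    ∃ ε : ℝ, 0 < ε ∧ ε < 1 / 5 ∧ (1 + ε) ^ (N + 1) < 2 * (1 - 3 * ε) ^ N := by
  have h1 : ∀ᶠ ε in 𝓝[>] (0 : ℝ), (1 + ε) ^ (N + 1) < 2 * (1 - 3 * ε) ^ N := by
    refine Filter.Eventually.filter_mono nhdsWithin_le_nhds ?_
    refine ContinuousAt.eventually_lt (f := fun ε : ℝ => (1 + ε) ^ (N + 1))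
      (g := fun ε : ℝ => 2 * (1 - 3 * ε) ^ N) (by fun_prop) (by fun_prop) ?_
    norm_num
  have h2 : ∀ᶠ ε in 𝓝[>] (0 : ℝ), ε < 1 / 5 :=
    Filter.Eventually.filter_mono nhdsWithin_le_nhds (eventually_lt_nhds (by norm_num))
  obtain ⟨ε, ⟨h1, h2⟩, h3⟩ := ((h1.and h2).and self_mem_nhdsWithin).exists
  exact ⟨ε, h3, h2, h1⟩

/-- If the degree vanishes, then `T` vanishes on compact pieces on which the chart is bi-Lipschitz. -/
theorem HasDegree.limVal_eq_zero {T : Functional X N} {μ : Measure X} (hT : IsCurrentWithMass T μ)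
    (h : IsGlobalChart N p ε r Ψ) (hdeg : HasDegree T p ε r Ψ 0) {C : Set X} (hC : IsCompact C)
    (hCV : C ⊆ chartDom p ε r Ψ) (hbi : BiLipschitzOn Ψ C) (f : LipBs X) {π : Fin N → LipLoc X}
    (hπ : ∀ j, ∃ L : ℝ≥0, LipschitzWith L (π j : X → ℝ)) :
    LimVal T μ π (C.indicator (f : X → ℝ)) 0 := by
  obtain ⟨M, hM0, hM⟩ := LipBs.exists_bound f
  obtain ⟨g, ⟨L, hg⟩, hgf⟩ := exists_lipschitz_factor hbi f.2.1.choose_spec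
  obtain ⟨σ, hσ0, hσ1, hσK, hσU⟩ := exists_cutoff (hC.image h.continuous) isOpen_univ
    (subset_univ _)
  -- The factor `g` need not be bounded or have bounded support. On `Ψ '' C` neither the truncation
  -- at `±M` nor the cutoff changes it, since `|f| ≤ M` and `σ = 1` there.
  let g' : LipBs (E N) := ⟨fun x => (σ : E N → ℝ) x * max (-M) (min M (g x)),
    mul_mem_lipBs σ ((hg.const_min M).const_max (-M)) (B := M) fun x =>
      abs_le.2 ⟨le_max_left _ _, max_le (by linarith) (min_le_left _ _)⟩⟩
  choose q hq hqπ using fun j => exists_lipschitz_factor hbi (hπ j).choose_spec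
  let π' : Fin N → LipLoc (E N) := fun j => ⟨q j, lipschitzWith_mem_lipLoc (hq j).choose_spec⟩
  have h1 := hdeg.limVal_of_isCompact hT h h.lipschitz hC hCV g' (π := π') hq
  rw [zero_mul] at h1
  have h2 : C.indicator ((g' : E N → ℝ) ∘ Ψ) = C.indicator (f : X → ℝ) := by
    refine indicator_congr fun x hx => ?_
    show (σ : E N → ℝ) (Ψ x) * max (-M) (min M (g (Ψ x))) = (f : X → ℝ) x
    rw [hσK _ (mem_image_of_mem _ hx), hgf x hx, one_mul, min_eq_right (abs_le.1 (hM x)).2,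
      max_eq_right (abs_le.1 (hM x)).1]
  rw [h2] at h1
  exact hT.limVal_congr (π := fun j => LipLoc.comp (π' j) Ψ h.lipschitz)
    (fun j => LipLoc.exists_lipschitzWith_comp h.lipschitz (hq j)) hπ hC.isClosed
    (fun j x hx => hqπ j x hx) (fun x hx => indicator_of_notMem hx _) h1

/-- With degree `0`, `T` vanishes on compact pieces on which `Ψ` is biLipschitz. Inner regularity
and the countable decomposition of the chart extend this to every test function supported in the
chart domain, so the mass of that domain is `0`, although its measure is positive. -/
theorem HasDegree.ne_zero [CompleteSpace X] [SecondCountableTopology X] {T : Functional X N}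
    (hT : IsCurrentWithMass T μHE[N]) (h : IsGlobalChart N p ε r Ψ) {c : ℝ}
    (hdeg : HasDegree T p ε r Ψ c) : c ≠ 0 := by
  rintro rfl
  set V := chartDom p ε r Ψ with hV
  have hVo : IsOpen V := h.isOpen_chartDom
  have hVb : IsBounded V := isBounded_ball.subset inter_subset_left
  obtain ⟨U, hUm, hUd, hUb, hUc, hUbi⟩ := h.chart.pieces
  have hzero : ∀ (f : LipBs X) (π : Fin N → LipLoc X), (∀ j, LipschitzWith 1 (π j : X → ℝ)) →
      tsupport (f : X → ℝ) ⊆ V → T f π = 0 := by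
    intro f π hπ hfV
    have hπ' : ∀ j, ∃ L : ℝ≥0, LipschitzWith L (π j : X → ℝ) := fun j => ⟨1, hπ j⟩
    obtain ⟨M, hM0, hM⟩ := LipBs.exists_bound f
    have hfm : AEStronglyMeasurable (f : X → ℝ) μHE[N] :=
      (LipBs.continuous f).aestronglyMeasurable
    have hA : ∀ i, MeasurableSet (U i ∩ V) := fun i => (hUm i).inter hVo.measurableSet
    have hpiece : ∀ i, LimVal T μHE[N] π ((U i ∩ V).indicator (f : X → ℝ)) 0 := by
      intro i
      -- Restricting to the bounded set `V` gives a finite Borel measure on a complete separable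
      -- space, for which measurable sets are exhausted by compact ones.
      have : IsFiniteMeasure ((μHE[N] : Measure X).restrict V) :=
        ⟨by rw [Measure.restrict_apply_univ]; exact hT.measure_lt_top hVb⟩
      have hK : ∀ k : ℕ, ∃ K ⊆ U i ∩ V, IsCompact K ∧
          ((μHE[N] : Measure X).restrict V) ((U i ∩ V) \ K) < ENNReal.ofReal (1 / ((k : ℝ) + 1)) :=
        fun k => (hA i).exists_isCompact_sdiff_lt (measure_ne_top _ _)
          (ENNReal.ofReal_pos.2 (by positivity)).ne'
      choose K hKU hKc hKm using hK
      refine LimVal.of_tendsto (g := fun k => (K k).indicator (f : X → ℝ)) (v := fun _ => 0)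
        (fun k => hfm.indicator (hKc k).measurableSet)
        (fun k => hdeg.limVal_eq_zero hT h (hKc k) ((hKU k).trans inter_subset_right)
          ((hUbi i).mono ((hKU k).trans inter_subset_left)) f hπ') ?_ tendsto_const_nhds
      have hbound : ∀ k, ∫⁻ x, ‖(K k).indicator (f : X → ℝ) x - (U i ∩ V).indicator (f : X → ℝ) x‖ₑ
          ∂μHE[N] ≤ ENNReal.ofReal M * ENNReal.ofReal (1 / ((k : ℝ) + 1)) := by
        intro k
        calc _ ≤ ∫⁻ x, ((U i ∩ V) \ K k).indicator (fun _ => ENNReal.ofReal M) x ∂μHE[N] := by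
              refine lintegral_mono fun x => ?_
              by_cases hxK : x ∈ K k
              · simp [hxK, hKU k hxK]
              · by_cases hxU : x ∈ U i ∩ V
                · have hx : x ∈ (U i ∩ V) \ K k := ⟨hxU, hxK⟩
                  rw [indicator_of_notMem hxK, indicator_of_mem hxU, indicator_of_mem hx, zero_sub,
                    enorm_neg, Real.enorm_eq_ofReal_abs]
                  exact ENNReal.ofReal_le_ofReal (hM x)
                · simp [hxK, hxU]
          _ = ENNReal.ofReal M * μHE[N] ((U i ∩ V) \ K k) := by
              rw [lintegral_indicator_const ((hA i).diff (hKc k).measurableSet)]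
          _ ≤ _ := by
              gcongr
              refine le_trans (le_of_eq ?_) (hKm k).le
              rw [Measure.restrict_apply ((hA i).diff (hKc k).measurableSet)]
              congr 1
              exact (inter_eq_left.2 fun x hx => hx.1.2).symm
      refine tendsto_of_tendsto_of_tendsto_of_le_of_le tendsto_const_nhds ?_
        (fun k => zero_le) hbound
      have h0 : Tendsto (fun k : ℕ => ENNReal.ofReal (1 / ((k : ℝ) + 1))) atTop (𝓝 0) := by
        have := ENNReal.tendsto_ofReal (tendsto_one_div_add_atTop_nhds_zero_nat (𝕜 := ℝ))
        rwa [ENNReal.ofReal_zero] at this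
      have := ENNReal.Tendsto.const_mul (a := ENNReal.ofReal M) h0 (Or.inr ENNReal.ofReal_ne_top)
      rwa [mul_zero] at this
    have hsum : ∀ m : ℕ, LimVal T μHE[N] π
        (fun x => ∑ i ∈ Finset.range m, (U i ∩ V).indicator (f : X → ℝ) x) 0 := by
      intro m
      induction m with
      | zero =>
        have h0 := LimVal.self (T := T) (μ := μHE[N]) (0 : LipBs X) π
        rw [map_zero] at h0
        simp only [Finset.range_zero, Finset.sum_empty]
        exact h0
      | succ m ih =>
        simp only [Finset.sum_range_succ]
        have := ih.add (hpiece m) (Finset.aestronglyMeasurable_fun_sum _ fun i _ =>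
          hfm.indicator (hA i))
        rwa [add_zero] at this
    have hpartial : ∀ m x, (∑ i ∈ Finset.range m, (U i ∩ V).indicator (f : X → ℝ) x)
        = (⋃ i ∈ Finset.range m, U i ∩ V).indicator (f : X → ℝ) x := by
      intro m x
      rw [Finset.indicator_biUnion_apply]
      intro i _ j _ hij
      exact (hUd hij).mono inter_subset_left inter_subset_left
    have hlim : LimVal T μHE[N] π (f : X → ℝ) 0 := by
      refine LimVal.of_dominated (g := fun m x => ∑ i ∈ Finset.range m,
        (U i ∩ V).indicator (f : X → ℝ) x) (v := fun _ => 0) (fun m =>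
        Finset.aestronglyMeasurable_fun_sum _ fun i _ => hfm.indicator (hA i)) hsum
        (fun x => |(f : X → ℝ) x|) (hT.integrable f).abs
        (fun m => Eventually.of_forall fun x => ?_) ?_ tendsto_const_nhds
      · rw [hpartial, Real.norm_eq_abs]
        by_cases hx : x ∈ ⋃ i ∈ Finset.range m, U i ∩ V
        · rw [indicator_of_mem hx]
        · rw [indicator_of_notMem hx, abs_zero]; exact abs_nonneg _
      · have hae : ∀ᵐ x ∂(μHE[N] : Measure X), x ∉ ball p r \ ⋃ i, U i :=
          measure_eq_zero_iff_ae_notMem.1 hUc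
        filter_upwards [hae] with x hx
        by_cases hxV : x ∈ V
        · have hxU : x ∈ ⋃ i, U i := by
            by_contra hno
            exact hx ⟨hxV.1, hno⟩
          obtain ⟨i, hi⟩ := mem_iUnion.1 hxU
          refine tendsto_const_nhds.congr' ?_
          filter_upwards [eventually_gt_atTop i] with m hm
          rw [hpartial, indicator_of_mem]
          exact mem_biUnion (Finset.mem_coe.2 (Finset.mem_range.2 hm)) ⟨hi, hxV⟩
        · have : (f : X → ℝ) x = 0 := image_eq_zero_of_notMem_tsupport fun hxs => hxV (hfV hxs)
          simp only [hpartial, this]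
          refine tendsto_const_nhds.congr fun m => ?_
          rw [indicator_of_notMem]
          simp only [mem_iUnion, not_exists]
          exact fun i _ hi => hxV hi.2
    exact hT.limVal_unique hπ' hfm (LimVal.self f π) hlim
  have hmass : massOn T V = 0 := by
    refine le_antisymm ?_ zero_le
    unfold massOn
    refine iSup_le fun m => iSup_le fun f => iSup_le fun π => iSup_le fun hπ => iSup_le fun hf =>
      iSup_le fun _ => ?_
    rw [Finset.sum_eq_zero fun l _ => hzero (f l) (π l) (hπ l) (hf l)]
    simp
  have h0 : (μHE[N] : Measure X) V = 0 := by
    rw [← hT.massMeasure V hVo.measurableSet]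
    refine le_antisymm (le_trans ?_ hmass.le) zero_le
    exact iInf_le_of_le V (iInf_le_of_le hVo (iInf_le _ Subset.rfl))
  exact (h.measure_pos hVo Subset.rfl ⟨p, h.mem_chartDom⟩).ne' h0

end DegreeBounds

/-! ### Reflection of charts reverses the degree -/

section Reflection

variable {n : ℕ}

/-- The sign of the `j`-th coordinate under the reflection in the first coordinate. -/
def reflSign (j : Fin (n + 1)) : ℝ := if j = 0 then -1 else 1

/-- The reflection of `ℝ^{n+1}` in the first coordinate. -/
noncomputable def reflect (n : ℕ) : E (n + 1) ≃ₗᵢ[ℝ] E (n + 1) :=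
  LinearIsometryEquiv.piLpCongrRight 2 fun j : Fin (n + 1) =>
    if j = 0 then LinearIsometryEquiv.neg ℝ else LinearIsometryEquiv.refl ℝ ℝ

theorem reflect_apply (x : E (n + 1)) (j : Fin (n + 1)) : reflect n x j = reflSign j * x j := by
  unfold reflect reflSign
  by_cases hj : j = 0 <;> simp [hj]

theorem reflect_single (j : Fin (n + 1)) :
    reflect n (EuclideanSpace.single j 1) = reflSign j • EuclideanSpace.single j 1 := by
  ext i
  rw [reflect_apply, PiLp.smul_apply, PiLp.single_apply, smul_eq_mul]
  by_cases hij : i = j <;> simp [hij]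

/-- The reflection scales the columns of the Jacobian matrix by `reflSign`, and the product of these
factors is `-1`. -/
theorem jacobian_comp_reflect (π : Fin (n + 1) → E (n + 1) → ℝ) (x : E (n + 1)) :
    jacobian (fun j => π j ∘ reflect n) x = - jacobian π (reflect n x) := by
  unfold jacobian
  have e : (Matrix.of fun i j : Fin (n + 1) => fderiv ℝ (π i ∘ reflect n) x
      (EuclideanSpace.single j 1)) = Matrix.of fun i j => reflSign j *
        (Matrix.of fun i j : Fin (n + 1) => fderiv ℝ (π i) (reflect n x)
          (EuclideanSpace.single j 1)) i j := by
    ext i j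
    have h1 := (reflect n).toContinuousLinearEquiv.comp_right_fderiv (f := π i) (x := x)
    have h2 : fderiv ℝ (π i ∘ reflect n) x (EuclideanSpace.single j 1)
        = fderiv ℝ (π i) (reflect n x) (reflect n (EuclideanSpace.single j 1)) :=
      congrArg (fun A : E (n + 1) →L[ℝ] ℝ => A (EuclideanSpace.single j 1)) h1
    rw [Matrix.of_apply, Matrix.of_apply, Matrix.of_apply, h2, reflect_single, map_smul, smul_eq_mul]
  rw [e, Matrix.det_mul_row]
  have hprod : ∏ j : Fin (n + 1), reflSign j = -1 := by
    rw [Fin.prod_univ_succ]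
    simp [reflSign]
  rw [hprod, neg_one_mul]

variable {X : Type*} [MetricSpace X] [MeasurableSpace X] [BorelSpace X]
  {p : X} {ε r : ℝ} {Ψ : X → E (n + 1)}

theorem IsGlobalChart.reflect (h : IsGlobalChart (n + 1) p ε r Ψ) :
    IsGlobalChart (n + 1) p ε r (reflect n ∘ Ψ) where
  chart :=
    { isEmbedding := (MetricCurrents.reflect n).toHomeomorph.isEmbedding.comp h.chart.isEmbedding
      lipschitz := fun x hx y hy => by
        simpa using h.chart.lipschitz x hx y hy
      image := by
        intro y hy
        have hy' : (MetricCurrents.reflect n).symm y ∈ ball (0 : E (n + 1)) ((1 - 2 * ε) * r) := by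
          simpa using hy
        obtain ⟨x, hx, hxy⟩ := h.chart.image hy'
        exact ⟨x, hx, by simp [hxy]⟩
      volume_ge := h.chart.volume_ge
      volume_le := h.chart.volume_le
      pieces := by
        obtain ⟨U, h1, h2, h3, h4, h5⟩ := h.chart.pieces
        refine ⟨U, h1, h2, h3, h4, fun i => ?_⟩
        obtain ⟨C, hC⟩ := h5 i
        refine ⟨C, fun x hx y hy => ?_⟩
        simpa using hC x hx y hy }
  lip j := by
    refine LipschitzWith.of_dist_le_mul fun x y => ?_
    refine le_trans (le_of_eq ?_) ((h.lip j).dist_le_mul x y)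
    rw [Real.dist_eq, Real.dist_eq, Function.comp_apply, Function.comp_apply, reflect_apply,
      reflect_apply, ← mul_sub, abs_mul]
    have : |reflSign j| = 1 := by unfold reflSign; split_ifs <;> simp
    rw [this, one_mul]
  ε_pos := h.ε_pos
  ε_lt := h.ε_lt
  r_pos := h.r_pos

/-- Testing `reflect n ∘ Ψ` with `(g, π)` is the same as testing `Ψ` with both composed with the
reflection. The reflection preserves volume, so only the sign of the Jacobian changes. -/
theorem HasDegree.reflect {T : Functional X (n + 1)} (h : IsGlobalChart (n + 1) p ε r Ψ) {c : ℝ}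
    (hdeg : HasDegree T p ε r Ψ c) : HasDegree T p ε r (reflect n ∘ Ψ) (-c) := by
  intro hΨ g F π hg hF hπ
  have hρ : ∃ C : ℝ≥0, LipschitzWith C (MetricCurrents.reflect n) :=
    ⟨1, (MetricCurrents.reflect n).lipschitz⟩
  let g' : LipBs (E (n + 1)) := ⟨(g : E (n + 1) → ℝ) ∘ MetricCurrents.reflect n,
    ⟨_, g.2.1.choose_spec.comp (MetricCurrents.reflect n).lipschitz⟩, by
      rw [Function.support_comp_eq_preimage]
      exact (MetricCurrents.reflect n).antilipschitz.isBounded_preimage g.2.2⟩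
  have hg' : tsupport (g' : E (n + 1) → ℝ) ⊆ ball 0 ((1 - 2 * ε) * r) := by
    have h1 : tsupport (g' : E (n + 1) → ℝ) ⊆
        MetricCurrents.reflect n ⁻¹' tsupport (g : E (n + 1) → ℝ) :=
      closure_minimal (fun x hx => subset_tsupport (g : E (n + 1) → ℝ) hx)
        ((isClosed_tsupport _).preimage (MetricCurrents.reflect n).continuous)
    intro x hx
    have := hg (h1 hx)
    simpa using this
  have h1 := hdeg h.lipschitz g' F (fun j => LipLoc.comp (π j) (MetricCurrents.reflect n) hρ) hg' hF
    fun j => LipLoc.exists_lipschitzWith_comp hρ (hπ j)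
  have h2 : (fun j => LipLoc.comp (π j) (MetricCurrents.reflect n ∘ Ψ) hΨ)
      = fun j => LipLoc.comp (LipLoc.comp (π j) (MetricCurrents.reflect n) hρ) Ψ h.lipschitz := rfl
  rw [h2, h1, neg_mul, ← mul_neg, ← integral_neg]
  congr 1
  have h3 := (MetricCurrents.reflect n).measurePreserving.integral_comp
    (MetricCurrents.reflect n).toHomeomorph.measurableEmbedding
    (fun x => -((g : E (n + 1) → ℝ) x * jacobian (fun j => (π j : E (n + 1) → ℝ)) x))
  rw [← h3]
  refine integral_congr_ae (Eventually.of_forall fun x => ?_)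
  have h4 : jacobian (fun j => (LipLoc.comp (π j) (MetricCurrents.reflect n) hρ : E (n + 1) → ℝ)) x
    = -jacobian (fun j => (π j : E (n + 1) → ℝ)) (MetricCurrents.reflect n x) :=
    jacobian_comp_reflect _ x
  dsimp only
  rw [h4, mul_neg]
  rfl

end Reflection

/-! ## Weights and the degree -/

section Relation

variable {X : Type*} [MetricSpace X] [MeasurableSpace X] [BorelSpace X] {N : ℕ}
  {p : X} {ε r : ℝ} {Ψ : X → E N} {K : Set (E N)} {f : E N → X} {Φ : X → E N} {θ : E N → ℝ}

theorem BiLipschitzOn.continuousOn {Y Z : Type*} [MetricSpace Y] [MetricSpace Z] {f : Y → Z}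
    {K : Set Y} (hf : BiLipschitzOn f K) : ContinuousOn f K :=
  hf.lipschitzOnWith.choose_spec.continuousOn

theorem BiLipschitzOn.isCompact_image {Y Z : Type*} [MetricSpace Y] [MetricSpace Z] {f : Y → Z}
    {K : Set Y} (hf : BiLipschitzOn f K) {K' : Set Y} (hK' : IsCompact K') (hKK : K' ⊆ K) :
    IsCompact (f '' K') :=
  hK'.image_of_continuousOn (hf.continuousOn.mono hKK)

/-- The value of `T` on a compact piece of the image of an atlas chart. -/
theorem PushforwardRestrictEq.limVal {T : Functional X N} {μ : Measure X}
    (hT : IsCurrentWithMass T μ) (hK : IsCompact K) (hf : BiLipschitzOn f K)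
    (hΦf : ∀ a ∈ K, Φ (f a) = a) (hθ : Integrable θ)
    (hpush : PushforwardRestrictEq T (f '' K) Φ θ) (hΦ : ∃ C : ℝ≥0, LipschitzWith C Φ)
    {K' : Set (E N)} (hK' : IsCompact K') (hKK : K' ⊆ K) {π : Fin N → LipLoc (E N)}
    (hπ : ∀ j, ∃ L : ℝ≥0, LipschitzWith L (π j : E N → ℝ)) :
    LimVal T μ (fun j => LipLoc.comp (π j) Φ hΦ) ((f '' K').indicator fun _ => 1)
      (∫ x in K', θ x * jacobian (fun j => (π j : E N → ℝ)) x) := by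
  obtain ⟨σ, S, hS, hσ0, hσ1, hσK, hσU, hσS, hσlim⟩ := exists_cutoff_seq hK' isOpen_univ
    (subset_univ K')
  have hfK : IsCompact (f '' K) := hf.isCompact_image hK Subset.rfl
  have hσabs : ∀ k x, |(σ k : E N → ℝ) x| ≤ 1 := fun k x => by
    rw [abs_of_nonneg (hσ0 k x)]; exact hσ1 k x
  obtain ⟨hΦ', hpush⟩ := hpush
  have hcont : Continuous Φ := hΦ.choose_spec.continuous
  refine LimVal.of_dominated (g := fun k => (f '' K).indicator ((σ k : E N → ℝ) ∘ Φ))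
    (v := fun k => euclideanCurrent θ (σ k) fun j => (π j : E N → ℝ))
    (fun k => ((LipBs.continuous (σ k)).comp hcont).aestronglyMeasurable.indicator
      hfK.measurableSet) (fun k => hT.limVal_of_hasBorelValue (hpush (σ k) π))
    ((f '' K).indicator fun _ => 1) ?_ (fun k => Eventually.of_forall fun x => ?_)
    (Eventually.of_forall fun x => ?_) ?_
  · exact (integrable_indicator_iff hfK.measurableSet).2
      (integrableOn_const (hT.measure_lt_top hfK.isBounded).ne)
  · by_cases hx : x ∈ f '' K
    · rw [indicator_of_mem hx, indicator_of_mem hx]; exact hσabs k _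
    · rw [indicator_of_notMem hx, indicator_of_notMem hx, norm_zero]
  · by_cases hx : x ∈ f '' K
    · obtain ⟨a, ha, rfl⟩ := hx
      simp only [indicator_of_mem (mem_image_of_mem f ha), Function.comp_apply, hΦf a ha]
      convert hσlim a using 2
      by_cases haK : a ∈ K'
      · rw [indicator_of_mem haK, indicator_of_mem (mem_image_of_mem f haK)]
      · rw [indicator_of_notMem haK, indicator_of_notMem]
        rintro ⟨b, hb, hba⟩
        exact haK (hf.injOn (hKK hb) ha hba ▸ hb)
    · have hx' : x ∉ f '' K' := fun h => hx (image_mono hKK h)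
      simp only [indicator_of_notMem hx, indicator_of_notMem hx']
      exact tendsto_const_nhds
  · simp only [euclideanCurrent_eq]
    rw [← integral_indicator hK'.measurableSet]
    obtain ⟨J, hJ⟩ := exists_abs_jacobian_le hπ
    refine tendsto_integral_of_dominated_convergence (fun x => |θ x| * J) (fun k => ?_)
      (hθ.abs.mul_const J) (fun k => Eventually.of_forall fun x => ?_)
      (Eventually.of_forall fun x => ?_)
    · exact (hθ.aestronglyMeasurable.mul (LipBs.continuous (σ k)).aestronglyMeasurable).mul
        (measurable_jacobian _).aestronglyMeasurable
    · rw [norm_mul, norm_mul]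
      exact mul_le_mul (mul_le_of_le_one_right (abs_nonneg _) (hσabs k x)) (hJ x) (abs_nonneg _)
        (abs_nonneg _)
    · have h1 := ((hσlim x).const_mul (θ x)).mul_const (jacobian (fun j => (π j : E N → ℝ)) x)
      convert h1 using 2
      by_cases hx : x ∈ K'
      · rw [indicator_of_mem hx, indicator_of_mem hx, mul_one]
      · rw [indicator_of_notMem hx, indicator_of_notMem hx]; ring

/-- Since `f` is continuous only on `K`, the set is written as `K` minus the closed set of points of
`K` that are mapped to the complement of `V`. -/
theorem measurableSet_inter_preimage {Y Z : Type*} [MetricSpace Y] [MeasurableSpace Y]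
    [BorelSpace Y] [TopologicalSpace Z] {K : Set Y} (hK : IsClosed K) {f : Y → Z}
    (hf : ContinuousOn f K) {V : Set Z} (hV : IsOpen V) : MeasurableSet (K ∩ f ⁻¹' V) := by
  have h1 : K ∩ f ⁻¹' V = K \ (K ∩ f ⁻¹' Vᶜ) := by
    ext x
    simp only [mem_inter_iff, mem_preimage, Set.mem_sdiff, mem_compl_iff]
    tauto
  rw [h1]
  exact hK.measurableSet.diff (hf.preimage_isClosed_of_isClosed hK hV.isClosed_compl).measurableSet

/-- The weight of `T` in an atlas chart and the degree of `T` in a regular chart are related by the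
transition map `G`. -/
theorem HasDegree.ae_weight_mul_det {T : Functional X N} {μ : Measure X}
    (hT : IsCurrentWithMass T μ)
    (h : IsGlobalChart N p ε r Ψ) {c : ℝ} (hdeg : HasDegree T p ε r Ψ c) (hK : IsCompact K)
    (hf : BiLipschitzOn f K) (hΦf : ∀ a ∈ K, Φ (f a) = a) (hθ : Integrable θ)
    (hpush : PushforwardRestrictEq T (f '' K) Φ θ) {G : E N → E N}
    (hG : ∃ C : ℝ≥0, LipschitzWith C G) (hGf : ∀ a ∈ K, G a = Ψ (f a)) :
    ∀ᵐ a, a ∈ K → f a ∈ chartDom p ε r Ψ →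
      θ a * (fderiv ℝ G a).det = c * |(fderiv ℝ G a).det| := by
  have hGc : ∀ j, ∃ L : ℝ≥0, LipschitzWith L (fun y => G y j) := fun j =>
    ⟨_, (lipschitzWith_coordLoc j).comp hG.choose_spec⟩
  set π : Fin N → LipLoc (E N) := fun j => ⟨fun y => G y j, lipschitzWith_mem_lipLoc
    (hGc j).choose_spec⟩ with hπdef
  have hπ : ∀ j, ∃ L : ℝ≥0, LipschitzWith L (π j : E N → ℝ) := hGc
  set J : E N → ℝ := jacobian fun j => (π j : E N → ℝ) with hJ
  have hJdet : ∀ a, DifferentiableAt ℝ G a → J a = (fderiv ℝ G a).det := fun a ha =>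
    jacobian_eq_det ha
  obtain ⟨M, hM⟩ := exists_abs_jacobian_le hπ
  have hJm : Measurable J := measurable_jacobian _
  set Q : Set (E N) := (K ∩ f ⁻¹' chartDom p ε r Ψ) ∩ {a | DifferentiableAt ℝ G a} with hQ
  have hQm : MeasurableSet Q :=
    (measurableSet_inter_preimage hK.isClosed hf.continuousOn h.isOpen_chartDom).inter
      (measurableSet_of_differentiableAt ℝ G)
  have hΦ : ∃ C : ℝ≥0, LipschitzWith C Φ := hpush.1
  have hint1 : Integrable (fun a => θ a * J a) :=
    hθ.mul_bdd (c := M) hJm.aestronglyMeasurable (Eventually.of_forall hM)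
  have hint2 : ∀ {A : Set (E N)}, A ⊆ K → IntegrableOn (fun a => c * |J a|) A := fun {A} hA => by
    refine Integrable.const_mul ?_ c
    refine Measure.integrableOn_of_bounded (M := M)
      ((measure_mono hA).trans_lt hK.measure_lt_top).ne hJm.abs.aestronglyMeasurable
      (Eventually.of_forall fun a => ?_)
    rw [Real.norm_eq_abs, abs_abs]
    exact hM a
  -- Both terms compute the value of `T` on the indicator of `f '' K'` with the coordinates of `Ψ`
  -- as entries: the first through the density `θ`, the second through the degree and the area
  -- formula for `G`.
  have key : ∀ K' ⊆ Q, IsCompact K' → ∫ a in K', (θ a * J a - c * |J a|) = 0 := by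
    intro K' hK'Q hK'
    have hKK : K' ⊆ K := fun a ha => (hK'Q ha).1.1
    have hCc : IsCompact (f '' K') := hf.isCompact_image hK' hKK
    have hCV : f '' K' ⊆ chartDom p ε r Ψ := by
      rintro _ ⟨a, ha, rfl⟩
      exact (hK'Q ha).1.2
    obtain ⟨g, hg0, hg1, hgK, -⟩ := exists_cutoff (hCc.image h.continuous) isOpen_univ
      (subset_univ _)
    have h1 := hdeg.limVal_of_isCompact hT h h.lipschitz hCc hCV g (π := fun j => coordLoc j)
      fun j => ⟨1, lipschitzWith_coordLoc j⟩
    have h2 := hpush.limVal hT hK hf hΦf hθ hΦ hK' hKK hπ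
    have h3 : (f '' K').indicator ((g : E N → ℝ) ∘ Ψ) = (f '' K').indicator fun _ => 1 :=
      indicator_congr fun x hx => hgK _ (mem_image_of_mem Ψ hx)
    have himg : Ψ '' (f '' K') = G '' K' := by
      rw [image_image]
      exact image_congr fun a ha => (hGf a (hKK ha)).symm
    have h4 : ∫ x in Ψ '' (f '' K'), (g : E N → ℝ) x
        * jacobian (fun j => (coordLoc j : E N → ℝ)) x = ∫ a in K', |J a| := by
      have e1 : ∫ x in Ψ '' (f '' K'), (g : E N → ℝ) x
          * jacobian (fun j => (coordLoc j : E N → ℝ)) x = ∫ x in G '' K', (1 : ℝ) := by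
        rw [← himg]
        refine setIntegral_congr_fun (hCc.image h.continuous).measurableSet fun x hx => ?_
        have : jacobian (fun j => (coordLoc j : E N → ℝ)) x = 1 := jacobian_coord x
        simp only [this, hgK x hx, mul_one]
      rw [e1, integral_image_eq_integral_abs_det_fderiv_smul volume hK'.measurableSet
        (fun a ha => (hK'Q ha).2.hasFDerivAt.hasFDerivWithinAt)]
      · refine setIntegral_congr_fun hK'.measurableSet fun a ha => ?_
        simp only [smul_eq_mul, mul_one, hJdet a (hK'Q ha).2]
      · intro a ha b hb hab
        rw [hGf a (hKK ha), hGf b (hKK hb)] at hab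
        exact hf.injOn (hKK ha) (hKK hb) (h.injOn (hK'Q ha).1.2.1 (hK'Q hb).1.2.1 hab)
    rw [h3, h4] at h1
    -- `Ψ` and `G ∘ Φ` agree only on the compact set `f '' K'`, which need not be a neighbourhood of
    -- anything; hence the strengthened form of locality.
    have h5 := hT.limVal_congr (π := fun j => LipLoc.comp (coordLoc j) Ψ h.lipschitz)
      (π' := fun j => LipLoc.comp (π j) Φ hΦ)
      (fun j => LipLoc.exists_lipschitzWith_comp h.lipschitz ⟨1, lipschitzWith_coordLoc j⟩)
      (fun j => LipLoc.exists_lipschitzWith_comp hΦ (hπ j)) hCc.isClosed (by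
        rintro j _ ⟨a, ha, rfl⟩
        show Ψ (f a) j = G (Φ (f a)) j
        rw [hΦf a (hKK ha), hGf a (hKK ha)])
      (fun x hx => indicator_of_notMem hx _) h1
    have h6 := hT.limVal_unique (fun j => LipLoc.exists_lipschitzWith_comp hΦ (hπ j))
      (aestronglyMeasurable_const.indicator hCc.measurableSet) h5 h2
    rw [integral_sub hint1.integrableOn (hint2 hKK), integral_const_mul, h6, sub_self]
  have hae := ae_eq_zero_of_setIntegral_isCompact_eq_zero hQm
    (hint1.integrableOn.sub (hint2 fun a ha => ha.1.1)) key
  filter_upwards [hae, hG.choose_spec.ae_differentiableAt] with a ha hd haK haV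
  have := ha ⟨⟨haK, haV⟩, hd⟩
  rw [← hJdet a hd]
  exact sub_eq_zero.1 this

/-- The transition map between an atlas chart and a regular chart is nondegenerate. -/
theorem IsGlobalChart.ae_det_ne_zero (h : IsGlobalChart N p ε r Ψ)
    (hf : BiLipschitzOn f K) {G : E N → E N}
    (hG : ∃ C : ℝ≥0, LipschitzWith C G) (hGf : ∀ a ∈ K, G a = Ψ (f a)) :
    ∀ᵐ a, a ∈ K → f a ∈ chartDom p ε r Ψ → (fderiv ℝ G a).det ≠ 0 := by
  obtain ⟨U, hUm, hUd, hUb, hUc, hUbi⟩ := h.chart.pieces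
  -- Critical points of `G`. Their image under `G` is null; since `Ψ` is biLipschitz on each `U i`
  -- and `f` on `K`, nullity returns first to `f '' Z` and then to `Z`.
  set Z : Set (E N) := {a | a ∈ K ∧ f a ∈ chartDom p ε r Ψ ∧ DifferentiableAt ℝ G a ∧
    (fderiv ℝ G a).det = 0} with hZ
  have h1 : volume (G '' Z) = 0 :=
    addHaar_image_eq_zero_of_det_fderivWithin_eq_zero volume
      (fun a ha => ha.2.2.1.hasFDerivAt.hasFDerivWithinAt) fun a ha => ha.2.2.2
  rw [← EuclideanSpace.euclideanHausdorffMeasure_eq_volume] at h1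
  have h2 : ∀ i, (μHE[N] : Measure X) (f '' Z ∩ U i) = 0 := fun i => by
    refine (hUbi i).measure_eq_zero inter_subset_right (measure_mono_null ?_ h1)
    rintro _ ⟨_, ⟨⟨a, ha, rfl⟩, -⟩, rfl⟩
    exact ⟨a, ha, hGf a ha.1⟩
  have h3 : (μHE[N] : Measure X) (f '' Z) = 0 := by
    refine measure_mono_null (t := (⋃ i, f '' Z ∩ U i) ∪ (ball p r \ ⋃ i, U i)) ?_
      (measure_union_null (measure_iUnion_null h2) hUc)
    rintro _ ⟨a, ha, rfl⟩
    by_cases haU : f a ∈ ⋃ i, U i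
    · obtain ⟨i, hi⟩ := mem_iUnion.1 haU
      exact Or.inl (mem_iUnion.2 ⟨i, mem_image_of_mem f ha, hi⟩)
    · exact Or.inr ⟨ha.2.1.1, haU⟩
  have h4 : volume Z = 0 := by
    rw [← EuclideanSpace.euclideanHausdorffMeasure_eq_volume]
    exact hf.measure_eq_zero (fun a ha => ha.1) h3
  filter_upwards [measure_eq_zero_iff_ae_notMem.1 h4, hG.choose_spec.ae_differentiableAt]
    with a ha hd haK haV h0
  exact ha ⟨haK, haV, hd, h0⟩

/-- At points where `K` is thin a derivative within `K` is not unique, so the derivative chosen by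
`fderivWithin` can differ from that of the extension `G`; such points form a null set. -/
theorem ae_fderivWithin_eq {g : E N → E N} (hK : MeasurableSet K) {G : E N → E N}
    (hG : ∃ C : ℝ≥0, LipschitzWith C G) (hGg : ∀ a ∈ K, G a = g a) :
    ∀ᵐ a, a ∈ K → fderivWithin ℝ g K a = fderiv ℝ G a := by
  set Q : Set (E N) := K ∩ {a | DifferentiableAt ℝ G a} with hQ
  have hQm : MeasurableSet Q := hK.inter (measurableSet_of_differentiableAt ℝ G)
  have h1 := ae_eq_of_hasFDerivWithinAt hQm (g := G) (A := fun a => fderivWithin ℝ g K a)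
    (B := fun a => fderiv ℝ G a)
    (fun a ha => by
      have h2 : fderivWithin ℝ g K a = fderivWithin ℝ G K a :=
        fderivWithin_congr (fun b hb => (hGg b hb).symm) (hGg a ha.1).symm
      rw [h2]
      exact ha.2.differentiableWithinAt.hasFDerivWithinAt.mono inter_subset_left)
    (fun a ha => ha.2.hasFDerivAt.hasFDerivWithinAt)
  filter_upwards [h1, hG.choose_spec.ae_differentiableAt] with a ha hd haK
  exact ha ⟨haK, hd⟩

/-- `Ψ ∘ f` is Lipschitz only on `K`; extending it to `ℝ^N` makes Rademacher's theorem and the area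
formula available. -/
theorem exists_transition (h : IsGlobalChart N p ε r Ψ) (hf : BiLipschitzOn f K) :
    ∃ G : E N → E N, (∃ C : ℝ≥0, LipschitzWith C G) ∧ ∀ a ∈ K, G a = Ψ (f a) := by
  obtain ⟨C, hC⟩ := h.lipschitz
  obtain ⟨D, hD⟩ := hf.lipschitzOnWith
  obtain ⟨G, hG, hGf⟩ := (hC.comp_lipschitzOnWith hD).extend_finite_dimension
  exact ⟨G, ⟨_, hG⟩, fun a ha => (hGf ha).symm⟩

/-- The relation between weight and degree in terms of the differential of the transition map. -/
theorem HasDegree.ae_weight {T : Functional X N} {μ : Measure X} (hT : IsCurrentWithMass T μ)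
    (h : IsGlobalChart N p ε r Ψ) {c : ℝ} (hdeg : HasDegree T p ε r Ψ c) (hK : IsCompact K)
    (hf : BiLipschitzOn f K) (hΦf : ∀ a ∈ K, Φ (f a) = a) (hθ : Integrable θ)
    (hpush : PushforwardRestrictEq T (f '' K) Φ θ) :
    ∀ᵐ a, a ∈ K → f a ∈ chartDom p ε r Ψ → (fderivWithin ℝ (Ψ ∘ f) K a).det ≠ 0 ∧
      θ a * (fderivWithin ℝ (Ψ ∘ f) K a).det = c * |(fderivWithin ℝ (Ψ ∘ f) K a).det| := by
  obtain ⟨G, hG, hGf⟩ := exists_transition h hf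
  filter_upwards [hdeg.ae_weight_mul_det hT h hK hf hΦf hθ hpush hG hGf,
    h.ae_det_ne_zero hf hG hGf, ae_fderivWithin_eq hK.measurableSet hG (g := Ψ ∘ f) hGf]
    with a h1 h2 h3 haK haV
  rw [h3 haK]
  exact ⟨h2 haK haV, h1 haK haV⟩

end Relation

/-! ## Atlases and weights -/

section Atlases

variable {X : Type*} [MetricSpace X] [MeasurableSpace X] [BorelSpace X] {N : ℕ}
  {p : X} {ε r : ℝ} {Ψ : X → E N}

/-- Almost every point of a chart domain belongs to `set(T)`. -/
theorem IsGlobalChart.ae_mem_currentSet {T : Functional X N} (hT : IsCurrentWithMass T μHE[N])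
    (h : IsGlobalChart N p ε r Ψ) :
    ∀ᵐ x ∂(μHE[N] : Measure X), x ∈ chartDom p ε r Ψ → x ∈ currentSet T := by
  obtain ⟨U, hUm, hUd, hUb, hUc, hUbi⟩ := h.chart.pieces
  obtain ⟨L, hL⟩ := h.lipschitz
  have hω : 0 < unitBallVolume N := by
    refine ENNReal.toReal_pos (measure_ball_pos _ _ one_pos).ne' measure_ball_lt_top.ne
  have hωe : volume (ball (0 : E N) 1) = ENNReal.ofReal (unitBallVolume N) :=
    (ENNReal.ofReal_toReal measure_ball_lt_top.ne).symm
  have hpiece : ∀ i, ∀ᵐ x ∂(μHE[N] : Measure X), x ∈ U i → x ∈ currentSet T := by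
    intro i
    -- Lebesgue density is applied to the Euclidean image of `U i` and pulled back: the points of `U
    -- i` over non-density points form a null set because `Ψ` is biLipschitz on `U i`.
    have hdens := Besicovitch.ae_tendsto_measure_inter_div (volume : Measure (E N)) (Ψ '' U i)
    set bad : Set X := {x | x ∈ U i ∧ ¬ Tendsto (fun s => volume (Ψ '' U i ∩ closedBall (Ψ x) s) /
      volume (closedBall (Ψ x) s)) (𝓝[>] 0) (𝓝 1)} with hbad
    have hbad0 : (μHE[N] : Measure X) bad = 0 := by
      refine (hUbi i).measure_eq_zero (fun x hx => hx.1) ?_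
      rw [EuclideanSpace.euclideanHausdorffMeasure_eq_volume]
      have h1 := le_antisymm ((Measure.le_restrict_apply _ _).trans (ae_iff.1 hdens).le) zero_le
      refine measure_mono_null ?_ h1
      rintro _ ⟨x, hx, rfl⟩
      exact ⟨hx.2, mem_image_of_mem Ψ hx.1⟩
    obtain ⟨C, hC⟩ := hUbi i
    filter_upwards [measure_eq_zero_iff_ae_notMem.1 hbad0] with x hx hxU
    have hlim : Tendsto (fun s => volume (Ψ '' U i ∩ closedBall (Ψ x) s) /
      volume (closedBall (Ψ x) s)) (𝓝[>] 0) (𝓝 1) := by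
      by_contra hno
      exact hx ⟨hxU, hno⟩
    -- With this `D`, points of `U i` whose images are within `s / D` of `Ψ x` lie within `s / 2` of
    -- `x`, hence in the open ball of radius `s`.
    set D : ℝ := 2 * max C 1 with hD
    have hDpos : 0 < D := by positivity
    set L' : ℝ≥0 := max L 1 with hL'
    have hL'pos : 0 < L' := lt_of_lt_of_le one_pos (le_max_right _ _)
    -- A lower bound for the density: half of a Euclidean ball is filled, its radius is reduced by
    -- `D`, and `Ψ` enlarges measure by at most `L' ^ N`.
    set b : ℝ := 2⁻¹ * (L' ^ N : ℝ)⁻¹ * (D⁻¹) ^ N with hb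
    have hbpos : 0 < b := by positivity
    have hev : ∀ᶠ s in 𝓝[>] (0 : ℝ), ENNReal.ofReal b ≤
        mass T (ball x s) / ENNReal.ofReal (unitBallVolume N * s ^ N) := by
      have h1 : Tendsto (fun s : ℝ => s / D) (𝓝[>] 0) (𝓝[>] 0) := by
        refine tendsto_nhdsWithin_of_tendsto_nhds_of_eventually_within _ ?_ ?_
        · have : Tendsto (fun s : ℝ => s / D) (𝓝 0) (𝓝 (0 / D)) := tendsto_id.div_const D
          rw [zero_div] at this
          exact this.mono_left nhdsWithin_le_nhds
        · filter_upwards [self_mem_nhdsWithin] with s hs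
          exact div_pos hs hDpos
      have h2 := (hlim.comp h1).eventually_const_le (u := 2⁻¹) (by norm_num)
      filter_upwards [h2, self_mem_nhdsWithin] with s hs (hs0 : 0 < s)
      have hsD : 0 < s / D := div_pos hs0 hDpos
      rw [hT.massMeasure _ measurableSet_ball]
      have h3 : Ψ '' U i ∩ closedBall (Ψ x) (s / D) ⊆ Ψ '' ball x s := by
        rintro _ ⟨⟨y, hy, rfl⟩, hyx⟩
        refine ⟨y, ?_, rfl⟩
        have h4 := (hC y hy x hxU).2
        have h5 : dist (Ψ y) (Ψ x) ≤ s / D := hyx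
        have h6 : C * dist (Ψ y) (Ψ x) ≤ max C 1 * (s / D) :=
          mul_le_mul (le_max_left _ _) h5 dist_nonneg (by positivity)
        have h7 : max C 1 * (s / D) = s / 2 := by
          rw [hD]; field_simp
        rw [mem_ball]
        linarith
      have h4 : volume (closedBall (Ψ x) (s / D)) = ENNReal.ofReal ((s / D) ^ N * unitBallVolume N) := by
        rw [Measure.addHaar_closedBall _ _ hsD.le, finrank_euclideanSpace_fin, hωe,
          ← ENNReal.ofReal_mul (by positivity)]
      have h5 : volume (Ψ '' ball x s) ≤ (L' : ℝ≥0∞) ^ N * μHE[N] (ball x s) := by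
        rw [← EuclideanSpace.euclideanHausdorffMeasure_eq_volume]
        exact euclideanHausdorffMeasure_image_le
          ((hL.weaken (le_max_left _ _)).lipschitzOnWith) N
      have h6 : 2⁻¹ * ENNReal.ofReal ((s / D) ^ N * unitBallVolume N)
          ≤ (L' : ℝ≥0∞) ^ N * μHE[N] (ball x s) := by
        have h7 : (2⁻¹ : ℝ≥0∞) ≤ volume (Ψ '' U i ∩ closedBall (Ψ x) (s / D)) /
          volume (closedBall (Ψ x) (s / D)) := hs
        rw [ENNReal.le_div_iff_mul_le (Or.inl (measure_closedBall_pos _ _ hsD).ne')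
          (Or.inl measure_closedBall_lt_top.ne), h4] at h7
        exact h7.trans ((measure_mono h3).trans h5)
      have hfin : μHE[N] (ball x s) ≠ ⊤ := (hT.measure_lt_top isBounded_ball).ne
      rw [ENNReal.le_div_iff_mul_le (Or.inl (ENNReal.ofReal_pos.2 (by positivity)).ne')
        (Or.inl ENNReal.ofReal_ne_top), ← ENNReal.ofReal_mul hbpos.le]
      refine ENNReal.ofReal_le_of_le_toReal ?_
      have h7 := ENNReal.toReal_mono (ENNReal.mul_ne_top (by finiteness) hfin) h6
      rw [ENNReal.toReal_mul, ENNReal.toReal_mul, ENNReal.toReal_ofReal (by positivity),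
        ENNReal.toReal_pow, ENNReal.coe_toReal, ENNReal.toReal_inv, ENNReal.toReal_ofNat] at h7
      have hLN : (0 : ℝ) < (L' : ℝ) ^ N := by positivity
      rw [hb]
      calc _ = ((L' : ℝ) ^ N)⁻¹ * (2⁻¹ * ((s / D) ^ N * unitBallVolume N)) := by
            rw [div_pow, inv_pow]; ring
        _ ≤ ((L' : ℝ) ^ N)⁻¹ * ((L' : ℝ) ^ N * (μHE[N] (ball x s)).toReal) := by gcongr
        _ = _ := by field_simp
    exact (ENNReal.ofReal_pos.2 hbpos).trans_le (le_liminf_of_le (by isBoundedDefault) hev)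
  filter_upwards [ae_all_iff.2 hpiece, measure_eq_zero_iff_ae_notMem.1 hUc] with x hx hxc hxV
  by_cases hxU : x ∈ ⋃ i, U i
  · obtain ⟨i, hi⟩ := mem_iUnion.1 hxU
    exact hx i hi
  · exact absurd ⟨hxV.1, hxU⟩ hxc

/-- In a second countable space a set that is null near each of its points is null. This patches
statements that are proved in chart domains. -/
theorem ae_of_ae_locally [SecondCountableTopology X] {μ : Measure X} {P : X → Prop}
    (h : ∀ᵐ q ∂μ, ∃ W ∈ 𝓝 q, ∀ᵐ x ∂μ, x ∈ W → P x) : ∀ᵐ x ∂μ, P x := by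
  set S : Set X := {q | ∃ W ∈ 𝓝 q, ∀ᵐ x ∂μ, x ∈ W → P x} with hS
  have h1 : μ {x | x ∈ S ∧ ¬ P x} = 0 := by
    refine measure_null_of_locally_null _ fun q hq => ?_
    obtain ⟨W, hW, hWP⟩ := hq.1
    refine ⟨W ∩ {x | x ∈ S ∧ ¬ P x}, ?_, ?_⟩
    · exact inter_mem (mem_nhdsWithin_of_mem_nhds hW) self_mem_nhdsWithin
    · refine measure_mono_null ?_ (ae_iff.1 hWP)
      rintro x ⟨hxW, -, hxP⟩ hno
      exact hxP (hno hxW)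
  filter_upwards [h, measure_eq_zero_iff_ae_notMem.1 h1] with x hx hx'
  by_contra hno
  exact hx' ⟨hx, hno⟩

/-- A property that holds almost everywhere in each atlas chart holds almost everywhere. -/
theorem IsAtlas.ae_of_forall {T : Functional X N} {A : ChartFamily X N} (hA : IsAtlas T A)
    (hT : ∀ᵐ x ∂(μHE[N] : Measure X), x ∈ currentSet T) {P : X → Prop}
    (h : ∀ i, ∀ᵐ a : E N, a ∈ A.K i → P (A.f i a)) : ∀ᵐ x ∂(μHE[N] : Measure X), P x := by
  have h1 : ∀ i, (μHE[N] : Measure X) (A.f i '' {a | a ∈ A.K i ∧ ¬ P (A.f i a)}) = 0 := by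
    intro i
    obtain ⟨C, hC⟩ := (hA.biLipschitz i).lipschitzOnWith
    refine euclideanHausdorffMeasure_image_eq_zero (hC.mono fun a ha => ha.1) ?_
    rw [EuclideanSpace.euclideanHausdorffMeasure_eq_volume]
    refine measure_mono_null ?_ (ae_iff.1 (h i))
    exact fun a ha hno => ha.2 (hno ha.1)
  have h2 := ae_all_iff.2 fun i => measure_eq_zero_iff_ae_notMem.1 (h1 i)
  filter_upwards [hT, measure_eq_zero_iff_ae_notMem.1 hA.cover, h2] with x hx hxc hx2
  have hxU : x ∈ ⋃ i, A.f i '' A.K i := by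
    by_contra hno
    exact hxc ⟨hx, hno⟩
  obtain ⟨i, a, ha, rfl⟩ := mem_iUnion.1 hxU
  by_contra hno
  exact hx2 i ⟨a, ⟨ha, hno⟩, rfl⟩

theorem BiLipschitzOn.exists_lipschitz_leftInverse {f : E N → X} {K : Set (E N)}
    (hf : BiLipschitzOn f K) :
    ∃ Φ : X → E N, (∃ C : ℝ≥0, LipschitzWith C Φ) ∧ ∀ a ∈ K, Φ (f a) = a := by
  have hinj := hf.injOn
  obtain ⟨C, hC⟩ := hf
  have h1 : LipschitzOnWith C.toNNReal (Function.invFunOn f K) (f '' K) := by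
    refine LipschitzOnWith.of_dist_le_mul ?_
    rintro _ ⟨x, hx, rfl⟩ _ ⟨y, hy, rfl⟩
    rw [hinj.leftInvOn_invFunOn hx, hinj.leftInvOn_invFunOn hy]
    exact (hC x hx y hy).2.trans
      (mul_le_mul_of_nonneg_right (Real.le_coe_toNNReal C) dist_nonneg)
  obtain ⟨Φ, hΦ, heq⟩ := h1.extend_finite_dimension
  exact ⟨Φ, ⟨_, hΦ⟩, fun a ha => by
    rw [← heq (mem_image_of_mem f ha), hinj.leftInvOn_invFunOn ha]⟩

/-- The density of the push-forward vanishes off the chart domain `K`. -/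
theorem PushforwardRestrictEq.ae_eq_zero {T : Functional X N} {μ : Measure X}
    (hT : IsCurrentWithMass T μ) {K : Set (E N)} (hK : IsCompact K) {f : E N → X} {Φ : X → E N}
    {θ : E N → ℝ} (hΦf : ∀ a ∈ K, Φ (f a) = a) (hθ : Integrable θ)
    (hpush : PushforwardRestrictEq T (f '' K) Φ θ) : ∀ᵐ a, a ∉ K → θ a = 0 := by
  obtain ⟨hΦ, hpush⟩ := hpush
  refine ae_eq_zero_of_setIntegral_isCompact_eq_zero (Q := Kᶜ) hK.isClosed.measurableSet.compl
    hθ.integrableOn fun K' hK' hK'c => ?_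
  obtain ⟨σ, S, hS, hσ0, hσ1, hσK, hσU, hσS, hσlim⟩ := exists_cutoff_seq hK'c hK.isClosed.isOpen_compl
    hK'
  have h1 : ∀ k, ∫ x, θ x * (σ k : E N → ℝ) x = 0 := by
    intro k
    have h2 := hT.limVal_of_hasBorelValue (hpush (σ k) fun j => coordLoc j)
    -- On `f '' K` the map `Φ` takes values in `K`, where `σ k` vanishes; so the push-forward tests
    -- `T` with the zero function.
    have h3 : (f '' K).indicator ((σ k : E N → ℝ) ∘ Φ) = ((0 : LipBs X) : X → ℝ) := by
      funext x
      by_cases hx : x ∈ f '' K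
      · obtain ⟨a, ha, rfl⟩ := hx
        rw [indicator_of_mem (mem_image_of_mem f ha), Function.comp_apply, hΦf a ha]
        exact image_eq_zero_of_notMem_tsupport fun hs => hσU k hs ha
      · rw [indicator_of_notMem hx]; rfl
    rw [h3] at h2
    have h4 := hT.limVal_unique (fun j => LipLoc.exists_lipschitzWith_comp hΦ
      ⟨1, lipschitzWith_coordLoc j⟩) (LipBs.continuous (0 : LipBs X)).aestronglyMeasurable h2
      (LimVal.self _ _)
    rw [map_zero, euclideanCurrent_eq] at h4
    have h5 : ∀ x : E N, jacobian (fun j => (coordLoc j : E N → ℝ)) x = 1 := jacobian_coord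
    simp only [h5, mul_one] at h4
    exact h4
  have h2 : Tendsto (fun k => ∫ x, θ x * (σ k : E N → ℝ) x) atTop (𝓝 (∫ x in K', θ x)) := by
    rw [← integral_indicator hK'c.measurableSet]
    refine tendsto_integral_of_dominated_convergence (fun x => |θ x|) (fun k => ?_) hθ.abs
      (fun k => Eventually.of_forall fun x => ?_) (Eventually.of_forall fun x => ?_)
    · exact hθ.aestronglyMeasurable.mul (LipBs.continuous (σ k)).aestronglyMeasurable
    · rw [norm_mul]
      refine mul_le_of_le_one_right (abs_nonneg _) ?_
      rw [Real.norm_of_nonneg (hσ0 k x)]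
      exact hσ1 k x
    · have h3 := (hσlim x).const_mul (θ x)
      convert h3 using 2
      by_cases hx : x ∈ K'
      · rw [indicator_of_mem hx, indicator_of_mem hx, mul_one]
      · rw [indicator_of_notMem hx, indicator_of_notMem hx, mul_zero]
  simp only [h1] at h2
  exact tendsto_nhds_unique h2 tendsto_const_nhds

/-- Each chart has a density by rectifiability. Measurable representatives, moved to `X` by the left
inverses `Φ i`, are glued along the pairwise disjoint images. Since each density vanishes a.e. off
`K i`, the indicator in `IsWeight` changes it only on a null set. -/
theorem IsAtlas.exists_weight {T : Functional X N} {μ : Measure X} (hT : IsCurrentWithMass T μ)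
    (hrect : IsLocIntegerRectifiable T) {A : ChartFamily X N} (hA : IsAtlas T A) :
    ∃ θ : X → ℝ, IsWeight T A θ := by
  choose Φ hΦ hΦf using fun i => (hA.biLipschitz i).exists_lipschitz_leftInverse
  have hcomp : ∀ i, IsCompact (A.f i '' A.K i) := fun i =>
    (hA.biLipschitz i).isCompact_image (hA.isCompact i) Subset.rfl
  choose θ hθ hpush using fun i => hrect.pushforward (A.f i '' A.K i)
    (hcomp i).measurableSet (hcomp i).isBounded (Φ i) (hΦ i)
  set θ' : ℕ → E N → ℝ := fun i => (hθ i).aestronglyMeasurable.mk _ with hθ'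
  have hθ'm : ∀ i, Measurable (θ' i) := fun i =>
    (hθ i).aestronglyMeasurable.stronglyMeasurable_mk.measurable
  have hθ'ae : ∀ i, (fun a => (θ i a : ℝ)) =ᵐ[volume] θ' i := fun i =>
    (hθ i).aestronglyMeasurable.ae_eq_mk
  obtain ⟨g, hg, hgeq⟩ := exists_measurable_piecewise (fun i => A.f i '' A.K i)
    (fun i => (hcomp i).measurableSet) (fun i => θ' i ∘ Φ i)
    (fun i => (hθ'm i).comp (hΦ i).choose_spec.continuous.measurable) fun i j hij x hx =>
      absurd hx.2 (disjoint_left.1 (hA.disjoint hij) hx.1)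
  have hae : ∀ i, (fun a => (θ i a : ℝ)) =ᵐ[volume] (A.K i).indicator (g ∘ A.f i) := by
    intro i
    filter_upwards [hθ'ae i, (hpush i).ae_eq_zero hT (hA.isCompact i) (hΦf i) (hθ i)] with a ha ha0
    by_cases haK : a ∈ A.K i
    · rw [indicator_of_mem haK, Function.comp_apply, hgeq i (mem_image_of_mem _ haK),
        Function.comp_apply, hΦf i a haK, ha]
    · rw [indicator_of_notMem haK, ha0 haK]
  refine ⟨g, hg, fun i => ⟨(hθ i).congr (hae i), Φ i, hΦ i, hΦf i, ?_⟩⟩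
  obtain ⟨hL, hp⟩ := hpush i
  refine ⟨hL, fun f π => ?_⟩
  have h1 := hp f π
  have h2 : euclideanCurrent (fun a => (θ i a : ℝ)) (f : E N → ℝ) (fun j => (π j : E N → ℝ))
      = euclideanCurrent ((A.K i).indicator (g ∘ A.f i)) (f : E N → ℝ) (fun j => (π j : E N → ℝ)) := by
    rw [euclideanCurrent_eq, euclideanCurrent_eq]
    exact integral_congr_ae ((hae i).mono fun a ha => by dsimp only; rw [← ha])
  rw [← h2]
  exact h1

end Atlases

/-! ## Oriented atlases -/

section Oriented

variable {X : Type*} [MetricSpace X] [MeasurableSpace X] [BorelSpace X]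

/-- A measurable set of finite measure is covered up to a null set by disjoint compact subsets. -/
theorem exists_disjoint_isCompact {μ : Measure X} [μ.InnerRegularCompactLTTop] {A : Set X}
    (hA : MeasurableSet A) (hμA : μ A ≠ ⊤) :
    ∃ C : ℕ → Set X, (∀ k, IsCompact (C k)) ∧ (∀ k, C k ⊆ A) ∧
      (Pairwise fun k l => Disjoint (C k) (C l)) ∧ μ (A \ ⋃ k, C k) = 0 := by
  have hstep : ∀ (k : ℕ) (S : {S : Set X // MeasurableSet S ∧ S ⊆ A}), ∃ K ⊆ S.1, IsCompact K ∧
      μ (S.1 \ K) < ENNReal.ofReal (1 / ((k : ℝ) + 1)) := fun k S =>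
    S.2.1.exists_isCompact_sdiff_lt (ne_top_of_le_ne_top hμA (measure_mono S.2.2))
      (ENNReal.ofReal_pos.2 (by positivity)).ne'
  choose K hKS hKc hKm using hstep
  -- `S k` is what remains after removing `k` compact sets; the next compact set takes all of it but
  -- measure less than `1 / (k + 1)`.
  let S : ℕ → {S : Set X // MeasurableSet S ∧ S ⊆ A} := fun k =>
    Nat.rec ⟨A, hA, Subset.rfl⟩ (fun k S => ⟨S.1 \ K k S, S.2.1.diff (hKc k S).measurableSet,
      sdiff_subset.trans S.2.2⟩) k
  have hS0 : (S 0).1 = A := rfl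
  have hSs : ∀ k, (S (k + 1)).1 = (S k).1 \ K k (S k) := fun _ => rfl
  have hanti : Antitone fun k => (S k).1 := antitone_nat_of_succ_le fun k => by
    rw [hSs]; exact sdiff_subset
  have hdisj : ∀ k l, k < l → Disjoint (K k (S k)) (K l (S l)) := by
    intro k l hkl
    have h1 : K l (S l) ⊆ (S k).1 \ K k (S k) := by
      rw [← hSs]
      exact (hKS l (S l)).trans (hanti (Nat.succ_le_of_lt hkl))
    exact disjoint_left.2 fun x hx hx' => (h1 hx').2 hx
  refine ⟨fun k => K k (S k), fun k => hKc k _, fun k => (hKS k _).trans (S k).2.2,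
    fun k l hkl => ?_, ?_⟩
  · rcases lt_or_gt_of_ne hkl with h | h
    · exact hdisj k l h
    · exact (hdisj l k h).symm
  · have hsub : ∀ k, A \ ⋃ k, K k (S k) ⊆ (S k).1 := by
      intro k
      induction k with
      | zero => exact sdiff_subset
      | succ k ih =>
        intro x hx
        rw [hSs]
        exact ⟨ih hx, fun hxK => hx.2 (mem_iUnion.2 ⟨k, hxK⟩)⟩
    have hle : ∀ k : ℕ, μ (A \ ⋃ k, K k (S k)) ≤ ENNReal.ofReal (1 / ((k : ℝ) + 1)) := by
      intro k
      refine (measure_mono fun x hx => ?_).trans (hKm k (S k)).le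
      have := hsub (k + 1) hx
      rwa [hSs] at this
    have h0 : Tendsto (fun k : ℕ => ENNReal.ofReal (1 / ((k : ℝ) + 1))) atTop (𝓝 0) := by
      have := ENNReal.tendsto_ofReal (tendsto_one_div_add_atTop_nhds_zero_nat (𝕜 := ℝ))
      rwa [ENNReal.ofReal_zero] at this
    exact le_antisymm (ge_of_tendsto' h0 hle) zero_le

variable {n : ℕ} {T : Functional X (n + 1)}

/-- Every regular point has a chart in which the current has degree one. -/
theorem IsRegularPoint.exists_degree_one [CompleteSpace X] [SecondCountableTopology X]
    (hT : IsCurrentWithMass T μHE[n + 1]) (hrect : IsLocIntegerRectifiable T)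
    (hbd : HasBoundary T 0) {p : X} (hp : IsRegularPoint (n + 1) p) :
    ∃ (ε r : ℝ) (Ψ : X → E (n + 1)), IsGlobalChart (n + 1) p ε r Ψ ∧ HasDegree T p ε r Ψ 1 := by
  obtain ⟨ε, hε, hε', hεN⟩ := exists_small_accuracy (n + 1)
  obtain ⟨r, hr, u, hu⟩ := hp ε hε
  obtain ⟨Ψ, -, hΨ⟩ := hu.exists_global hε hε' hr
  obtain ⟨c, hc⟩ := exists_hasDegree hT hrect hbd hΨ
  have h1 := hc.abs_mul_le hT hΨ
  have h2 := hc.ne_zero hT hΨ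
  have h3 : |c| < 2 := by
    have hpos : (0 : ℝ) < (1 - 3 * ε) ^ (n + 1) := pow_pos (by linarith) _
    have h4 : |(c : ℝ)| < 2 := lt_of_mul_lt_mul_right (h1.trans_lt hεN) hpos.le
    exact_mod_cast h4
  have h4 : c ≠ 0 := by exact_mod_cast h2
  rw [abs_lt] at h3
  have h5 : c = 1 ∨ c = -1 := by omega
  rcases h5 with rfl | rfl
  · exact ⟨ε, r, Ψ, hΨ, by simpa using hc⟩
  · exact ⟨ε, r, _, hΨ.reflect, by simpa using hc.reflect hΨ⟩

theorem IsGlobalChart.chartDom_mem_nhds {N : ℕ} {p : X} {ε r : ℝ} {Ψ : X → E N}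
    (h : IsGlobalChart N p ε r Ψ) : chartDom p ε r Ψ ∈ 𝓝 p :=
  h.isOpen_chartDom.mem_nhds h.mem_chartDom

/-- Almost every point of `X` belongs to `set(T)`. -/
theorem IsETR.ae_mem_currentSet [SecondCountableTopology X] {N : ℕ} {T : Functional X N}
    (hT : IsCurrentWithMass T μHE[N]) {R : Set X} (hR : IsETR N R) :
    ∀ᵐ x ∂(μHE[N] : Measure X), x ∈ currentSet T := by
  refine ae_of_ae_locally ?_
  filter_upwards [(measure_eq_zero_iff_ae_notMem.1 hR.null)] with p hp
  obtain ⟨r, hr, u, hu⟩ := hR.regular p (not_not.1 hp) (1 / 10) (by norm_num)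
  obtain ⟨Ψ, -, hΨ⟩ := hu.exists_global (by norm_num) (by norm_num) hr
  exact ⟨_, hΨ.chartDom_mem_nhds, hΨ.ae_mem_currentSet hT⟩

/-- Weights have absolute value one. -/
theorem IsWeight.ae_eq_one_or [CompleteSpace X] [SecondCountableTopology X]
    (hT : IsCurrentWithMass T μHE[n + 1]) (hrect : IsLocIntegerRectifiable T)
    (hbd : HasBoundary T 0) {R : Set X} (hR : IsETR (n + 1) R) {A : ChartFamily X (n + 1)}
    (hA : IsAtlas T A) {θ : X → ℝ} (hθ : IsWeight T A θ) :
    ∀ᵐ x ∂(μHE[n + 1] : Measure X), θ x = 1 ∨ θ x = -1 := by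
  refine ae_of_ae_locally ?_
  filter_upwards [(measure_eq_zero_iff_ae_notMem.1 hR.null)] with p hp
  obtain ⟨ε, r, Ψ, hΨ, hdeg⟩ := (hR.regular p (not_not.1 hp)).exists_degree_one hT hrect hbd
  refine ⟨_, hΨ.chartDom_mem_nhds, hA.ae_of_forall (hR.ae_mem_currentSet hT) fun i => ?_⟩
  obtain ⟨hint, Φ, hΦ, hΦf, hpush⟩ := hθ.2 i
  filter_upwards [hdeg.ae_weight hT hΨ (hA.isCompact i) (hA.biLipschitz i) hΦf hint hpush]
    with a ha haK haV
  obtain ⟨h1, h2⟩ := ha haK haV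
  rw [indicator_of_mem haK, Function.comp_apply, one_mul] at h2
  rcases abs_cases (fderivWithin ℝ (Ψ ∘ A.f i) (A.K i) a).det with h3 | h3
  · left
    rw [h3.1] at h2
    exact mul_right_cancel₀ h1 (h2.trans (one_mul _).symm)
  · right
    rw [h3.1] at h2
    exact mul_right_cancel₀ h1 (h2.trans (neg_one_mul _).symm)

/-- Near a point at which the atlas is oriented, the weight is constant. -/
theorem IsWeight.exists_ae_eq_of_isOrientedAt [CompleteSpace X] [SecondCountableTopology X]
    (hT : IsCurrentWithMass T μHE[n + 1]) (hrect : IsLocIntegerRectifiable T)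
    (hbd : HasBoundary T 0) {R : Set X} (hR : IsETR (n + 1) R) {A : ChartFamily X (n + 1)}
    (hA : IsAtlas T A) {θ : X → ℝ} (hθ : IsWeight T A θ) {p : X} (hp : IsOrientedAt A p) :
    ∃ r : ℝ, 0 < r ∧ ∃ σ : ℝ, (σ = 1 ∨ σ = -1) ∧
      ∀ᵐ x ∂(μHE[n + 1] : Measure X), x ∈ ball p r → θ x = σ := by
  obtain ⟨ε, r, s, u, hε, hε', hs, hsr, hu, hdet⟩ := hp
  obtain ⟨Ψ, hΨu, hΨ⟩ := hu.exists_global hε hε' (hs.trans_le hsr)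
  obtain ⟨c, hc⟩ := exists_hasDegree hT hrect hbd hΨ
  have h1 : ∀ᵐ x ∂(μHE[n + 1] : Measure X), x ∈ chartDom p ε r Ψ ∩ ball p s → θ x = c := by
    refine hA.ae_of_forall (hR.ae_mem_currentSet hT) fun i => ?_
    obtain ⟨hint, Φ, hΦ, hΦf, hpush⟩ := hθ.2 i
    filter_upwards [hc.ae_weight hT hΨ (hA.isCompact i) (hA.biLipschitz i) hΦf hint hpush, hdet i]
      with a ha ha' haK haV
    obtain ⟨h1, h2⟩ := ha haK haV.1
    have h3 := ha' haK haV.2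
    -- The derivative depends only on the germ within `K i`. By continuity of `f i` on `K i`, nearby
    -- points are mapped into `ball p r`, where `u` and its global extension coincide.
    have h4 : fderivWithin ℝ (u ∘ A.f i) (A.K i) a = fderivWithin ℝ (Ψ ∘ A.f i) (A.K i) a := by
      refine Filter.EventuallyEq.fderivWithin_eq ?_ (hΨu haV.1.1).symm
      have h5 : ∀ᶠ b in 𝓝[A.K i] a, A.f i b ∈ ball p r :=
        ((hA.biLipschitz i).continuousOn a haK).eventually (isOpen_ball.mem_nhds haV.1.1)
      exact h5.mono fun b hb => (hΨu hb).symm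
    rw [h4] at h3
    rw [abs_of_pos h3, indicator_of_mem haK] at h2
    exact mul_right_cancel₀ h3.ne' h2
  have hWo : IsOpen (chartDom p ε r Ψ ∩ ball p s) := hΨ.isOpen_chartDom.inter isOpen_ball
  have hpW : p ∈ chartDom p ε r Ψ ∩ ball p s := ⟨hΨ.mem_chartDom, mem_ball_self hs⟩
  obtain ⟨ρ, hρ, hρW⟩ := Metric.isOpen_iff.1 hWo p hpW
  refine ⟨ρ, hρ, c, ?_, h1.mono fun x hx hxρ => hx (hρW hxρ)⟩
  -- The chart given by the orientation may be too coarse for the mass bound to force `|c| = 1`;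
  -- instead `c` is identified through `θ = ±1` a.e. on an open set of positive measure.
  by_contra hno
  refine (hΨ.measure_pos hWo inter_subset_left ⟨p, hpW⟩).ne' ?_
  refine measure_eq_zero_iff_ae_notMem.2 ?_
  filter_upwards [h1, hθ.ae_eq_one_or hT hrect hbd hR hA] with x hx hx' hxW
  rw [hx hxW] at hx'
  exact hno hx'

/-- There is an atlas that is oriented at every regular point. -/
theorem IsETR.exists_oriented_atlas [CompleteSpace X] [SecondCountableTopology X] [Nonempty X]
    (hT : IsCurrentWithMass T μHE[n + 1]) (hrect : IsLocIntegerRectifiable T)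
    (hbd : HasBoundary T 0) {R : Set X} (hR : IsETR (n + 1) R) :
    ∃ A : ChartFamily X (n + 1), IsAtlas T A ∧ ∀ p ∈ R, IsOrientedAt A p := by
  rcases R.eq_empty_or_nonempty with rfl | hRne
  -- If there are no regular points then `X` is null and the empty family covers.
  · refine ⟨⟨fun _ => ∅, fun _ _ => Classical.arbitrary X⟩, ⟨fun i => isCompact_empty,
      fun i => ⟨0, by simp⟩, fun i j _ => by simp, ?_⟩, by simp⟩
    exact measure_mono_null (subset_univ _) (by simpa using hR.null)
  have hchart : ∀ p ∈ R, ∃ (ε r : ℝ) (Ψ : X → E (n + 1)), IsGlobalChart (n + 1) p ε r Ψ ∧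
      HasDegree T p ε r Ψ 1 := fun p hp => (hR.regular p hp).exists_degree_one hT hrect hbd
  choose! ε r Ψ hΨ hdeg using hchart
  obtain ⟨t, htR, htc, htcov⟩ := TopologicalSpace.countable_cover_nhdsWithin
    (f := fun p => chartDom p (ε p) (r p) (Ψ p)) (s := R)
    fun p hp => mem_nhdsWithin_of_mem_nhds (hΨ p hp).chartDom_mem_nhds
  have htne : t.Nonempty := by
    obtain ⟨p, hp⟩ := hRne
    obtain ⟨q, hq, -⟩ := mem_iUnion₂.1 (htcov hp)
    exact ⟨q, hq⟩
  obtain ⟨e, rfl⟩ := htc.exists_eq_range htne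
  have heR : ∀ j, e j ∈ R := fun j => htR (mem_range_self j)
  set V : ℕ → Set X := fun j => chartDom (e j) (ε (e j)) (r (e j)) (Ψ (e j)) with hV
  have hVo : ∀ j, IsOpen (V j) := fun j => (hΨ _ (heR j)).isOpen_chartDom
  have hVb : ∀ j, IsBounded (V j) := fun j => isBounded_ball.subset inter_subset_left
  choose U hUm hUd hUb hUc hUbi using fun j => (hΨ _ (heR j)).chart.pieces
  -- Removing the earlier domains `V l` makes the pieces disjoint for different `j`; a point is
  -- assigned to the first domain that contains it.
  set B : ℕ → ℕ → Set X := fun j i => (U j i ∩ V j) \ ⋃ l ∈ Finset.range j, V l with hB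
  have hBm : ∀ j i, MeasurableSet (B j i) := fun j i =>
    ((hUm j i).inter (hVo j).measurableSet).diff
      (Finset.measurableSet_biUnion _ fun l _ => (hVo l).measurableSet)
  have hcomp : ∀ j i, ∃ C : ℕ → Set X, (∀ k, IsCompact (C k)) ∧ (∀ k, C k ⊆ B j i) ∧
      (Pairwise fun k l => Disjoint (C k) (C l)) ∧
      (μHE[n + 1] : Measure X) (B j i \ ⋃ k, C k) = 0 := by
    intro j i
    have : IsFiniteMeasure ((μHE[n + 1] : Measure X).restrict (V j)) :=
      ⟨by rw [Measure.restrict_apply_univ]; exact hT.measure_lt_top (hVb j)⟩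
    obtain ⟨C, h1, h2, h3, h4⟩ := exists_disjoint_isCompact
      (μ := (μHE[n + 1] : Measure X).restrict (V j)) (hBm j i) (measure_ne_top _ _)
    refine ⟨C, h1, h2, h3, ?_⟩
    rw [Measure.restrict_apply ((hBm j i).diff
      (MeasurableSet.iUnion fun k => (h1 k).measurableSet)), inter_eq_left.2] at h4
    · exact h4
    · exact fun x hx => hx.1.1.2
  choose C hCc hCB hCd hC0 using hcomp
  -- reindex the compact pieces by the natural numbers
  let φ : ℕ ≃ ℕ × ℕ × ℕ := (Denumerable.eqv (ℕ × ℕ × ℕ)).symm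
  let D : ℕ → Set X := fun m => C (φ m).1 (φ m).2.1 (φ m).2.2
  let Θ : ℕ → X → E (n + 1) := fun m => Ψ (e (φ m).1)
  have hDbi : ∀ m, BiLipschitzOn (Θ m) (D m) := fun m =>
    (hUbi (φ m).1 (φ m).2.1).mono fun x hx => (hCB _ _ _ hx).1.1
  let A : ChartFamily X (n + 1) := ⟨fun m => Θ m '' D m, fun m => Function.invFunOn (Θ m) (D m)⟩
  have hAinv : ∀ m, ∀ x ∈ D m, A.f m (Θ m x) = x := fun m x hx =>
    (hDbi m).injOn.leftInvOn_invFunOn hx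
  have hAimg : ∀ m, A.f m '' A.K m = D m := fun m => (hDbi m).injOn.invFunOn_image Subset.rfl
  have hAbi : ∀ m, BiLipschitzOn (A.f m) (A.K m) := by
    intro m
    obtain ⟨L, hL⟩ := hDbi m
    refine ⟨L, ?_⟩
    rintro _ ⟨x, hx, rfl⟩ _ ⟨y, hy, rfl⟩
    rw [hAinv m x hx, hAinv m y hy]
    exact (hL x hx y hy).symm
  have hA : IsAtlas T A := by
    refine ⟨fun m => (hCc _ _ _).image (hΨ _ (heR _)).continuous, hAbi, fun m l hml => ?_, ?_⟩
    · dsimp only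
      rw [hAimg, hAimg]
      have hne : φ m ≠ φ l := fun h => hml (φ.injective h)
      rw [disjoint_left]
      intro x hxm hxl
      have hxm' := hCB _ _ _ hxm
      have hxl' := hCB _ _ _ hxl
      have hj : (φ m).1 = (φ l).1 := by
        rcases lt_trichotomy (φ m).1 (φ l).1 with h | h | h
        · exact absurd (mem_biUnion (Finset.mem_coe.2 (Finset.mem_range.2 h)) hxm'.1.2) hxl'.2
        · exact h
        · exact absurd (mem_biUnion (Finset.mem_coe.2 (Finset.mem_range.2 h)) hxl'.1.2) hxm'.2
      have hi : (φ m).2.1 = (φ l).2.1 := by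
        by_contra hi
        rw [hj] at hxm'
        exact disjoint_left.1 (hUd (φ l).1 hi) hxm'.1.1 hxl'.1.1
      have hk : (φ m).2.2 = (φ l).2.2 := by
        by_contra hk
        have hxm2 : x ∈ C (φ m).1 (φ m).2.1 (φ m).2.2 := hxm
        rw [hj, hi] at hxm2
        exact disjoint_left.1 (hCd (φ l).1 (φ l).2.1 hk) hxm2 hxl
      exact hne (Prod.ext hj (Prod.ext hi hk))
    · simp only [hAimg]
      refine measure_mono_null (t := Rᶜ ∪ ((⋃ j, (ball (e j) (r (e j)) \ ⋃ i, U j i)) ∪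
        ⋃ j, ⋃ i, (B j i \ ⋃ k, C j i k))) ?_ (measure_union_null hR.null (measure_union_null
          (measure_iUnion_null hUc) (measure_iUnion_null fun j => measure_iUnion_null fun i =>
            hC0 j i)))
      rintro x ⟨-, hxD⟩
      by_cases hxR : x ∈ R
      swap
      · exact Or.inl hxR
      have hex : ∃ j, x ∈ V j := by
        have := htcov hxR
        simp only [mem_iUnion, mem_range, exists_prop, exists_exists_eq_and] at this
        exact this
      classical
      set j := Nat.find hex with hj
      have hxj : x ∈ V j := Nat.find_spec hex
      by_cases hxU : x ∈ ⋃ i, U j i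
      · obtain ⟨i, hi⟩ := mem_iUnion.1 hxU
        refine Or.inr (Or.inr (mem_iUnion₂.2 ⟨j, i, ⟨⟨hi, hxj⟩, ?_⟩, ?_⟩))
        · simp only [mem_iUnion, not_exists]
          exact fun l hl hxl => Nat.find_min hex (Finset.mem_range.1 hl) hxl
        · intro hxC
          obtain ⟨k, hk⟩ := mem_iUnion.1 hxC
          refine hxD (mem_iUnion.2 ⟨φ.symm (j, i, k), ?_⟩)
          show x ∈ C (φ (φ.symm (j, i, k))).1 (φ (φ.symm (j, i, k))).2.1 (φ (φ.symm (j, i, k))).2.2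
          rw [φ.apply_symm_apply]
          exact hk
      · exact Or.inr (Or.inl (mem_iUnion.2 ⟨j, hxj.1, hxU⟩))
  refine ⟨A, hA, fun p hp => ?_⟩
  -- The weight serves as an intermediary: the degree-one charts used to build the atlas give weight
  -- `1`, and comparison with the degree-one chart at `p` then makes the transition determinant
  -- equal to its absolute value.
  obtain ⟨θ, -, hθ⟩ := hA.exists_weight hT hrect
  obtain ⟨s, hs, hsV⟩ := Metric.isOpen_iff.1 (hΨ p hp).isOpen_chartDom p (hΨ p hp).mem_chartDom
  refine ⟨ε p, r p, min s (r p), Ψ p, (hΨ p hp).ε_pos, (hΨ p hp).ε_lt, lt_min hs (hΨ p hp).r_pos,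
    min_le_right _ _, (hΨ p hp).chart, fun m => ?_⟩
  obtain ⟨hint, Φ, hΦ, hΦf, hpush⟩ := hθ m
  have hid : ∀ a ∈ A.K m, id a = Θ m (A.f m a) := by
    rintro _ ⟨x, hx, rfl⟩
    rw [hAinv m x hx, id]
  -- Against its own regular chart the transition map of the `m`-th atlas chart is the identity on
  -- `K m`, so `G = id` has determinant `1`.
  have h1 := (hdeg _ (heR (φ m).1)).ae_weight_mul_det hT (hΨ _ (heR (φ m).1)) (hA.isCompact m)
    (hAbi m) hΦf hint hpush (G := id) ⟨1, LipschitzWith.id⟩ hid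
  have h2 := (hdeg p hp).ae_weight hT (hΨ p hp) (hA.isCompact m) (hAbi m) hΦf hint hpush
  filter_upwards [h1, h2] with a ha1 ha2 haK has
  have haD : A.f m a ∈ D m := by rw [← hAimg]; exact mem_image_of_mem _ haK
  have ha1' := ha1 haK (hCB _ _ _ haD).1.2
  obtain ⟨h3, h4⟩ := ha2 haK (hsV (ball_subset_ball (min_le_left _ _) has))
  have h5 : (fderiv ℝ (id : E (n + 1) → E (n + 1)) a).det = 1 := by
    rw [fderiv_id]; simp [ContinuousLinearMap.det]
  rw [h5, mul_one, abs_one, mul_one] at ha1'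
  rw [ha1', one_mul, one_mul] at h4
  rw [h4]
  exact abs_pos.2 h3

/-- If the atlas is oriented everywhere and `R` is a.e.-connected, then the weight is constant. -/
theorem IsWeight.exists_ae_eq [CompleteSpace X] [SecondCountableTopology X]
    (hT : IsCurrentWithMass T μHE[n + 1]) (hrect : IsLocIntegerRectifiable T)
    (hbd : HasBoundary T 0) {R : Set X} (hR : IsETR (n + 1) R) {A : ChartFamily X (n + 1)}
    (hA : IsAtlas T A) {θ : X → ℝ} (hθ : IsWeight T A θ) (hconn : IsAEConnected (n + 1) R)
    (hor : ∀ p ∈ R, IsOrientedAt A p) :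
    ∃ σ : ℝ, (σ = 1 ∨ σ = -1) ∧ ∀ᵐ x ∂(μHE[n + 1] : Measure X), θ x = σ := by
  have hnull : ∀ᵐ x ∂(μHE[n + 1] : Measure X), x ∈ R :=
    (measure_eq_zero_iff_ae_notMem.1 hR.null).mono fun x hx => not_not.1 hx
  rcases R.eq_empty_or_nonempty with rfl | ⟨p, hp⟩
  · exact ⟨1, Or.inl rfl, hnull.mono fun x hx => absurd hx (notMem_empty x)⟩
  have hloc : ∀ q ∈ R, ∃ r : ℝ, 0 < r ∧ ∃ σ : ℝ, (σ = 1 ∨ σ = -1) ∧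
      ∀ᵐ x ∂(μHE[n + 1] : Measure X), x ∈ ball q r → θ x = σ := fun q hq =>
    hθ.exists_ae_eq_of_isOrientedAt hT hrect hbd hR hA (hor q hq)
  obtain ⟨r, hr, σ, hσ, hσp⟩ := hloc p hp
  refine ⟨σ, hσ, ?_⟩
  -- Points near which the weight is a.e. `τ`. These sets are open in `X`, and on `R` those for `σ`
  -- and `-σ` are complementary, so their preimages under a curve in `R` are clopen.
  set Q : ℝ → Set X := fun τ => {q | ∃ r : ℝ, 0 < r ∧
    ∀ᵐ x ∂(μHE[n + 1] : Measure X), x ∈ ball q r → θ x = τ} with hQ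
  have hQo : ∀ τ, IsOpen (Q τ) := by
    intro τ
    refine Metric.isOpen_iff.2 fun q hq => ?_
    obtain ⟨ρ, hρ, hq⟩ := hq
    refine ⟨ρ, hρ, fun q' hq' => ⟨ρ - dist q' q, sub_pos.2 hq', hq.mono fun x hx hxq' => hx ?_⟩⟩
    have := dist_triangle x q' q
    have h2 : dist x q' < ρ - dist q' q := hxq'
    rw [mem_ball]; linarith
  have hQdisj : ∀ q ∈ R, q ∈ Q σ → q ∉ Q (-σ) := by
    rintro q hq ⟨ρ, hρ, h1⟩ ⟨ρ', hρ', h2⟩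
    obtain ⟨r', hr', u, hu⟩ := hR.regular q hq (1 / 10) (by norm_num)
    obtain ⟨Ψ, -, hΨ⟩ := hu.exists_global (by norm_num) (by norm_num) hr'
    have hWo : IsOpen (chartDom q (1 / 10) r' Ψ ∩ (ball q ρ ∩ ball q ρ')) :=
      hΨ.isOpen_chartDom.inter (isOpen_ball.inter isOpen_ball)
    refine (hΨ.measure_pos hWo inter_subset_left
      ⟨q, hΨ.mem_chartDom, mem_ball_self hρ, mem_ball_self hρ'⟩).ne' ?_
    refine measure_eq_zero_iff_ae_notMem.2 ?_
    filter_upwards [h1, h2] with x hx1 hx2 hx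
    have h3 := (hx1 hx.2.1).symm.trans (hx2 hx.2.2)
    rcases hσ with rfl | rfl <;> norm_num at h3
  have hQcov : ∀ q ∈ R, q ∈ Q σ ∨ q ∈ Q (-σ) := by
    intro q hq
    obtain ⟨ρ, hρ, τ, hτ, h1⟩ := hloc q hq
    have h2 : τ = σ ∨ τ = -σ := by
      rcases hσ with rfl | rfl <;> rcases hτ with rfl | rfl <;> norm_num
    rcases h2 with rfl | rfl
    · exact Or.inl ⟨ρ, hρ, h1⟩
    · exact Or.inr ⟨ρ, hρ, h1⟩
  have hjoin : ∀ q, JoinedIn R p q → q ∈ Q σ := by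
    rintro q ⟨γ, hγ⟩
    have hclopen : IsClopen (γ ⁻¹' Q σ) := by
      refine ⟨?_, (hQo σ).preimage γ.continuous⟩
      have h1 : γ ⁻¹' Q σ = (γ ⁻¹' Q (-σ))ᶜ := by
        ext s
        constructor
        · exact fun hs => hQdisj _ (hγ s) hs
        · exact fun hs => (hQcov _ (hγ s)).resolve_right hs
      rw [h1]
      exact ((hQo (-σ)).preimage γ.continuous).isClosed_compl
    have h1 := hclopen.eq_univ ⟨0, by rw [mem_preimage, γ.source]; exact ⟨r, hr, hσp⟩⟩
    have h2 : (1 : unitInterval) ∈ γ ⁻¹' Q σ := by rw [h1]; exact mem_univ _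
    rwa [mem_preimage, γ.target] at h2
  refine ae_of_ae_locally ?_
  filter_upwards [hnull, hconn p hp] with q hq hpq
  obtain ⟨ρ, hρ, h1⟩ := hjoin q (hpq hq)
  exact ⟨ball q ρ, ball_mem_nhds q hρ, h1⟩

end Oriented

end MetricCurrents

/-! ### The proposition -/

theorem mainTheorem8 {X : Type*} [MetricSpace X] [CompleteSpace X]
    [TopologicalSpace.SeparableSpace X] [Nonempty X] [MeasurableSpace X] [BorelSpace X]
    (n : ℕ) (R : Set X) (hR : MetricCurrents.IsETR (n + 1) R)
    (T : MetricCurrents.Functional X (n + 1)) (hT : MetricCurrents.IsLocallyIntegral T)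
    (hmass : MetricCurrents.IsMassMeasure T μHE[n + 1]) (hbd : MetricCurrents.HasBoundary T 0) :
    (∃ A : MetricCurrents.ChartFamily X (n + 1), MetricCurrents.IsAtlas T A ∧
      ∀ p ∈ R, MetricCurrents.IsOrientedAt A p) ∧
    ∀ A : MetricCurrents.ChartFamily X (n + 1), MetricCurrents.IsAtlas T A →
      (∃ θ : X → ℝ, MetricCurrents.IsWeight T A θ) ∧
      ∀ θ : X → ℝ, MetricCurrents.IsWeight T A θ →
        (∀ᵐ x ∂(μHE[n + 1] : Measure X), θ x = 1 ∨ θ x = -1) ∧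
        (∀ p ∈ R, MetricCurrents.IsOrientedAt A p →
          ∃ r : ℝ, 0 < r ∧ ∃ σ : ℝ, (σ = 1 ∨ σ = -1) ∧
            ∀ᵐ x ∂(μHE[n + 1] : Measure X), x ∈ ball p r → θ x = σ) ∧
        (MetricCurrents.IsAEConnected (n + 1) R →
          (∀ p ∈ R, MetricCurrents.IsOrientedAt A p) →
          ∃ σ : ℝ, (σ = 1 ∨ σ = -1) ∧ ∀ᵐ x ∂(μHE[n + 1] : Measure X), θ x = σ) := by
  have : SecondCountableTopology X := UniformSpace.secondCountable_of_separable X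
  have hmassT : MetricCurrents.IsCurrentWithMass T μHE[n + 1] := ⟨hT.1.isCurrent, hmass⟩
  refine ⟨hR.exists_oriented_atlas hmassT hT.1 hbd, fun A hA => ⟨hA.exists_weight hmassT hT.1,
    fun θ hθ => ⟨hθ.ae_eq_one_or hmassT hT.1 hbd hR hA, fun p _ hp =>
      hθ.exists_ae_eq_of_isOrientedAt hmassT hT.1 hbd hR hA hp, fun hconn hor =>
      hθ.exists_ae_eq hmassT hT.1 hbd hR hA hconn hor⟩⟩⟩
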